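/- **Setting.** Let $d\in\{2,3\}$, let $\Omega\subset\mathbb R^d$ be a convex polygonal/polyhedral domain, and let $\Gamma_C\subset\Gamma_D\subset\partial\Omega$ be such that $\Gamma_C$, $\Gamma_D$ and $\partial\Omega\setminus\Gamma_D$ have positive $(d-1)$-measure; put $\Gamma_C'=\partial\Omega\setminus\Gamma_C$. Let $\{\mathcal T_h\}_h$ be a shape regular and quasi-uniform family of conforming simplicial meshes of $\Omega$, fitted to $\Gamma_C$ and $\Gamma_D$. Write $h_\kappa$, $h_F$ for the diameters of elements $\kappa$ and faces $F$, $h=\max_\kappa h_\kappa$, $\mathcal F$ for the set of all faces, $\mathcal F_i$ for the interior faces, $\mathcal F_\Gamma$ for the boundary faces in $\Gamma$. Each face has a unit normal $n_F$ (of arbitrary fixed orientation on interior faces, outward on the boundary); $[v]$ and $\{v\}$ are the jump $v(\cdot-0\,n_F)-v(\cdot+0\,n_F)$ and the average of $v$ across an interior face, and $[v]=\{v\}=v$ on boundary faces. A bar denotes the mean value over a face. Let $$X_h^\Gamma=\Big\{v_h: v_h|_\kappa\in\mathbb P_1(\kappa)\ \forall\kappa\in\mathcal T_h,\ \int_F[v_h]\,ds=0\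 \ \forall F\in\mathcal F_i\cup\mathcal F_\Gamma\Big\},\qquad V_h=X_h^{\Gamma_D},\quad W_h=X_h^{\Gamma_C'}.$$ For $\gamma_V,\gamma_W>0$ let $$a_h(u,w)=\sum_\kappa\int_\kappa\nabla u\cdot\nabla w\,dx,\qquad s_V(u,v)=\sum_{F\in\mathcal F_i\cup\mathcal F_{\Gamma_D}}\int_F\gamma_Vh_F^{-1}[u][v]\,ds,$$ and let $s_W$ be either of $$s_W(z,w)=\sum_\kappa\int_\kappa\gamma_W\nabla z\cdot\nabla w\,dx\qquad\text{or}\qquad s_W(z,w)=\sum_{F\in\mathcal F_i\cup\mathcal F_{\Gamma_C'}}\int_F\gamma_Wh_F^{-1}[z][w]\,ds.$$ Set $$A_h[(u,z),(v,w)]=a_h(u,w)-s_W(z,w)+a_h(v,z)+s_V(u,v),$$ $$|||v|||_V=\gamma_V^{1/2}\Big(\sum_\kappa\|h\nabla v\|_\kappa^2\Big)^{1/2}+\gamma_V^{1/2}\Big(\sum_{F\in\mathcal F_i\cup\mathcal F_{\Gamma_C}}h_F\|[n_F\cdot\nabla v]\|_F^2\Big)^{1/2}+s_V(v,v)^{1/2},$$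 $$|||(v,w)|||=|||v|||_V+\|w\|_{s_W},\qquad \|w\|_{s_W}=s_W(w,w)^{1/2}.$$ Let $C_i$ and $c_{\mathcal T}$ denote constants in the inequalities $$h_\kappa\|\nabla w_h\|_\kappa+h_\kappa^{1/2}\|w_h\|_{\partial\kappa}\le C_i\|w_h\|_\kappa,\qquad \|h^{-1}w_h\|_\Omega\le c_{\mathcal T}\Big(\sum_{F\in\mathcal F}h_F^{-1}\big\|\overline{\{w_h\}}\big\|_F^2\Big)^{1/2}$$ for all $w_h\in W_h$ and $\kappa\in\mathcal T_h$. **Theorem.** Constants $C_i,c_{\mathcal T}>0$ for which these inequalities hold on all meshes of the family exist. Moreover, for either choice of $s_W$, there is a constant $c_s>0$, independent of $\gamma_V$, $\gamma_W$ and of the mesh in the family, such that, whenever $\gamma_V\gamma_W\le(C_ic_{\mathcal T})^{-2}$ with such constants $C_i$, $c_{\mathcal T}$, for all $(x_h,y_h)\in V_h\times W_h$ $$c_s\,|||(x_h,y_h)|||\le\sup_{\substack{(v_h,w_h)\in V_h\times W_h\\ |||(v_h,w_h)|||\ne0}}\frac{A_h[(x_h,y_h),(v_h,w_h)]}{|||(v_h,w_h)|||}.$$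 -/

import Mathlib

open MeasureTheory

noncomputable section

namespace CRCauchy

/-- The Euclidean space `ℝᵈ`. -/
abbrev E (d : ℕ) : Type := EuclideanSpace ℝ (Fin d)

/-- A convex polygonal / polyhedral domain: the nonempty interior of the convex hull of a
finite set of points. -/
def IsConvexPolytopalDomain {d : ℕ} (Ω : Set (E d)) : Prop :=
  Ω.Nonempty ∧ ∃ s : Finset (E d), Ω = interior (convexHull ℝ (s : Set (E d)))

/-- A conforming tesselation of `Ω` into nonoverlapping simplices. A simplex is given by the set of
its `d + 1` affinely independent vertices, and as a point set it is the convex hull of them.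
Two simplices meet exactly in the simplex spanned by their common vertices (possibly empty). -/
structure Mesh (d : ℕ) (Ω : Set (E d)) where
  cells : Finset (Finset (E d))
  card_eq : ∀ κ ∈ cells, κ.card = d + 1
  indep : ∀ κ ∈ cells, AffineIndependent ℝ (fun p : (κ : Set (E d)) => (p : E d))
  cover : (⋃ κ ∈ cells, convexHull ℝ (κ : Set (E d))) = closure Ω
  conforming : ∀ κ ∈ cells, ∀ κ' ∈ cells,
    convexHull ℝ (κ : Set (E d)) ∩ convexHull ℝ (κ' : Set (E d))
      = convexHull ℝ ((κ : Set (E d)) ∩ (κ' : Set (E d)))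

/-- The closed simplex spanned by a finite set of vertices. -/
def hull {d : ℕ} (s : Finset (E d)) : Set (E d) := convexHull ℝ (s : Set (E d))

/-- The open simplex spanned by a finite set of (affinely independent) vertices, that is, the
relative interior of the closed one: all barycentric coordinates are positive. -/
def openHull {d : ℕ} (s : Finset (E d)) : Set (E d) :=
  {x | ∃ w : E d → ℝ, (∀ p ∈ s, 0 < w p) ∧ ∑ p ∈ s, w p = 1 ∧ ∑ p ∈ s, w p • p = x}

/-- The diameter `h_κ` of an element or `h_F` of a face. -/
def size {d : ℕ} (s : Finset (E d)) : ℝ := Metric.diam (hull s)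

namespace Mesh

variable {d : ℕ} {Ω : Set (E d)}

open Classical in
/-- The element faces: spanned by `d` of the `d + 1` vertices of an element. -/
def faces (T : Mesh d Ω) : Finset (Finset (E d)) :=
  T.cells.biUnion fun κ => κ.powersetCard d

open Classical in
/-- The boundary faces: the faces lying in `∂Ω`. -/
def boundaryFaces (T : Mesh d Ω) : Finset (Finset (E d)) :=
  T.faces.filter fun F => hull F ⊆ frontier Ω

open Classical in
/-- The interior faces. -/
def interiorFaces (T : Mesh d Ω) : Finset (Finset (E d)) :=
  T.faces.filter fun F => ¬ hull F ⊆ frontier Ω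

open Classical in
/-- The boundary faces lying in a portion `Γ` of `∂Ω`. Relative interiors are used, so that it does
not matter whether or not `Γ` contains its own relative boundary. -/
def facesIn (T : Mesh d Ω) (Γ : Set (E d)) : Finset (Finset (E d)) :=
  T.boundaryFaces.filter fun F => openHull F ⊆ Γ

/-- The mesh is fitted to the portion `Γ` of `∂Ω`: no boundary face crosses the relative boundary
of `Γ`. -/
def IsFitted (T : Mesh d Ω) (Γ : Set (E d)) : Prop :=
  ∀ F ∈ T.boundaryFaces, openHull F ⊆ Γ ∨ Disjoint (openHull F) Γ

/-- The mesh size `h = max_κ h_κ`. -/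
def h (T : Mesh d Ω) : ℝ := ⨆ κ : T.cells, size κ.1

open Classical in
/-- The elements having `F` as a face (two of them for an interior face, one for a boundary
face). -/
def cellsAt (T : Mesh d Ω) (F : Finset (E d)) : Finset T.cells :=
  Finset.univ.filter fun κ => F ⊆ κ.1

end Mesh

/-- A mesh together with a choice of a unit normal `n_F` for every face: the orientation is
arbitrary on interior faces, and outward on boundary faces. -/
structure OrientedMesh (d : ℕ) (Ω : Set (E d)) extends Mesh d Ω where
  normal : Finset (E d) → E d
  normal_norm : ∀ F ∈ toMesh.faces, ‖normal F‖ = 1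
  normal_orth : ∀ F ∈ toMesh.faces, ∀ p ∈ F, ∀ q ∈ F, inner ℝ (normal F) (p - q) = 0
  normal_outward : ∀ F ∈ toMesh.boundaryFaces, ∀ κ ∈ cells, F ⊆ κ →
    ∀ p ∈ κ, ∀ q ∈ F, inner ℝ (normal F) (p - q) ≤ 0

/-- Shape regularity of a family of meshes: every element `κ` contains a ball of radius
`σ h_κ`, with one `σ > 0` for the whole family. -/
def ShapeRegular {d : ℕ} {Ω : Set (E d)} {ι : Type*} (T : ι → OrientedMesh d Ω) : Prop :=
  ∃ σ > 0, ∀ i, ∀ κ ∈ (T i).cells, ∃ x, Metric.ball x (σ * size κ) ⊆ hull κ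

/-- Quasi-uniformity of a family of meshes: `σ h ≤ h_κ` for every element, with one `σ > 0` for the
whole family. -/
def QuasiUniform {d : ℕ} {Ω : Set (E d)} {ι : Type*} (T : ι → OrientedMesh d Ω) : Prop :=
  ∃ σ > 0, ∀ i, ∀ κ ∈ (T i).cells, σ * (T i).h ≤ size κ

/-- Piecewise affine functions: one affine function on each element, no continuity. -/
abbrev Broken {d : ℕ} {Ω : Set (E d)} (T : OrientedMesh d Ω) : Type :=
  T.cells → (E d →ᵃ[ℝ] ℝ)

/-- The two choices of the adjoint stabilization `s_W`. -/
inductive AdjointStab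
  | gradient
  | jump

section Forms

variable {d : ℕ} {Ω : Set (E d)} (T : OrientedMesh d Ω)

/-- The surface integral `∫_F f ds`. -/
def faceIntegral (F : Finset (E d)) (f : E d → ℝ) : ℝ :=
  ∫ x in hull F, f x ∂(μHE[d - 1] : Measure (E d))

/-- The (elementwise constant) gradient of a piecewise affine function. -/
def grad (v : Broken T) (κ : T.cells) (x : E d) : E d :=
  gradient (fun y => v κ y) x

open Classical in
/-- `+1` if the element `κ` lies on the side of `F` out of which `n_F` points, that is, if points
`x - ε n_F` with `x` inside `F` and small `ε > 0` belong to `κ`, and `-1` if it lies on the other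
side. -/
def side (F : Finset (E d)) (κ : T.cells) : ℝ :=
  if ∀ p ∈ κ.1, ∀ q ∈ F, inner ℝ (T.normal F) (p - q) ≤ 0 then 1 else -1

/-- The jump `[v]` at a point `x` of the face `F`: the value from the side of `x - ε n_F` minus the
value from the side of `x + ε n_F` on an interior face, and the value `v(x)` itself on a boundary
face. -/
def jump (v : Broken T) (F : Finset (E d)) (x : E d) : ℝ :=
  ∑ κ ∈ T.cellsAt F, side T F κ * v κ x

/-- The jump `[n_F · ∇v]` of the normal derivative; it is `n_F · ∇v` on a boundary face. -/
def jumpNormalDeriv (v : Broken T) (F : Finset (E d)) (x : E d) : ℝ :=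
  ∑ κ ∈ T.cellsAt F, side T F κ * inner ℝ (T.normal F) (grad T v κ x)

/-- The average `{v}` at a point `x` of the face `F`: half the sum of the two values on an interior
face, the value itself on a boundary face. -/
def average (v : Broken T) (F : Finset (E d)) (x : E d) : ℝ :=
  ((T.cellsAt F).card : ℝ)⁻¹ * ∑ κ ∈ T.cellsAt F, v κ x

/-- The mean value over the face `F` of the average `{v}`. -/
def meanAverage (v : Broken T) (F : Finset (E d)) : ℝ :=
  (faceIntegral F fun _ => 1)⁻¹ * faceIntegral F (average T v F)

/-- The Crouzeix–Raviart space `X_h^Γ`: the jumps have zero mean over each interior face and over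
each face in `Γ`. -/
def X (Γ : Set (E d)) : Set (Broken T) :=
  {v | ∀ F ∈ T.interiorFaces ∪ T.facesIn Γ, faceIntegral F (jump T v F) = 0}

/-- `V_h`, with the zero mean condition on the Dirichlet part `ΓD` of the boundary. -/
def V (ΓD : Set (E d)) : Set (Broken T) := X T ΓD

/-- `W_h`, with the zero mean condition on the complement of the Cauchy part `ΓC`. -/
def W (ΓC : Set (E d)) : Set (Broken T) := X T (frontier Ω \ ΓC)

/-- The norm `‖v‖_κ` in `L²(κ)`. -/
def normCell (v : Broken T) (κ : T.cells) : ℝ :=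
  √(∫ x in hull κ.1, v κ x ^ 2)

/-- The norm `‖∇v‖_κ` in `L²(κ)`. -/
def normGradCell (v : Broken T) (κ : T.cells) : ℝ :=
  √(∫ x in hull κ.1, ‖grad T v κ x‖ ^ 2)

/-- The norm `‖v‖_{∂κ}` in `L²(∂κ)` of the trace from inside of `κ`. -/
def normBdryCell (v : Broken T) (κ : T.cells) : ℝ :=
  √(∑ F ∈ κ.1.powersetCard d, faceIntegral F fun x => v κ x ^ 2)

/-- The norm `‖v‖_Ω` in `L²(Ω)`. -/
def normL2 (v : Broken T) : ℝ := √(∑ κ, normCell T v κ ^ 2)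

/-- The broken norm `‖∇v‖_h`. -/
def normGrad (v : Broken T) : ℝ := √(∑ κ, normGradCell T v κ ^ 2)

/-- `C` is a constant for the inverse inequality
`h_κ ‖∇v‖_κ + h_κ^{1/2} ‖v‖_{∂κ} ≤ C ‖v‖_κ` on the space `S`. -/
def IsInverseConst (S : Set (Broken T)) (C : ℝ) : Prop :=
  ∀ v ∈ S, ∀ κ : T.cells,
    size κ.1 * normGradCell T v κ + √(size κ.1) * normBdryCell T v κ ≤ C * normCell T v κ

/-- `c` is a constant for the bound of `L²`-norms by face averages,
`‖h⁻¹ v‖_Ω ≤ c (∑_F h_F⁻¹ ‖mean of {v} over F‖_F²)^{1/2}`, on the space `S`. -/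
def IsFaceMeanConst (S : Set (Broken T)) (c : ℝ) : Prop :=
  ∀ v ∈ S, T.h⁻¹ * normL2 T v ≤
    c * √(∑ F ∈ T.faces, (size F)⁻¹ * faceIntegral F fun _ => meanAverage T v F ^ 2)

/-- `a_h(u, w) = ∑_κ ∫_κ ∇u · ∇w dx`. -/
def aForm (u w : Broken T) : ℝ :=
  ∑ κ, ∫ x in hull κ.1, inner ℝ (grad T u κ x) (grad T w κ x)

/-- The primal stabilization
`s_V(u, v) = ∑_F ∫_F γ_V h_F⁻¹ [u] [v] ds`, over the interior faces and those in `ΓD`. -/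
def sV (ΓD : Set (E d)) (γV : ℝ) (u v : Broken T) : ℝ :=
  ∑ F ∈ T.interiorFaces ∪ T.facesIn ΓD,
    faceIntegral F fun x => γV * (size F)⁻¹ * jump T u F x * jump T v F x

/-- The adjoint stabilization: either `s_W(z, w) = ∑_κ ∫_κ γ_W ∇z · ∇w dx`, or
`s_W(z, w) = ∑_F ∫_F γ_W h_F⁻¹ [z] [w] ds`, over the interior faces and those in the complement
of `ΓC`. -/
def sW (m : AdjointStab) (ΓC : Set (E d)) (γW : ℝ) (z w : Broken T) : ℝ :=
  match m with
  | .gradient => ∑ κ, ∫ x in hull κ.1, γW * inner ℝ (grad T z κ x) (grad T w κ x)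
  | .jump => ∑ F ∈ T.interiorFaces ∪ T.facesIn (frontier Ω \ ΓC),
      faceIntegral F fun x => γW * (size F)⁻¹ * jump T z F x * jump T w F x

/-- The bilinear form
`A_h[(u, z), (v, w)] = a_h(u, w) - s_W(z, w) + a_h(v, z) + s_V(u, v)`. -/
def A (m : AdjointStab) (ΓC ΓD : Set (E d)) (γV γW : ℝ) (u z v w : Broken T) : ℝ :=
  aForm T u w - sW T m ΓC γW z w + aForm T v z + sV T ΓD γV u v

/-- The mesh-dependent norm `|||v|||_V = γ_V^{1/2} ‖h ∇v‖_h`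
`+ γ_V^{1/2} (∑_F h_F ‖[n_F · ∇v]‖_F²)^{1/2} + s_V(v, v)^{1/2}`, with the sum over the interior
faces and those in `ΓC`. -/
def tripleV (ΓC ΓD : Set (E d)) (γV : ℝ) (v : Broken T) : ℝ :=
  √γV * (T.h * normGrad T v)
    + √γV * √(∑ F ∈ T.interiorFaces ∪ T.facesIn ΓC,
        size F * faceIntegral F fun x => jumpNormalDeriv T v F x ^ 2)
    + √(sV T ΓD γV v v)

/-- The composite norm `|||(v, w)||| = |||v|||_V + s_W(w, w)^{1/2}`. -/
def triple (m : AdjointStab) (ΓC ΓD : Set (E d)) (γV γW : ℝ) (v w : Broken T) : ℝ :=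
  tripleV T ΓC ΓD γV v + √(sW T m ΓC γW w w)

end Forms

end CRCauchy

end

/-!
The theorem is an inf-sup condition for a stabilized nonconforming method for the elliptic Cauchy
problem. Two facts carry it.

*A dual test function.* Integration by parts on each element turns `a_h(x, w)` into a sum over
faces of the jumps of the normal derivative of `x`, which are constant, times the means of `w`,
because `w` is a Crouzeix–Raviart function (`aForm_crFun`). Prescribing the means of `w` to be
`γ_V h_F [n_F · ∇x]` gives `a_h(x, w) = J`, the squared norm of these jumps, and the assumptions
on `C_i`, `c_𝒯` and `γ_V γ_W` give `s_W(w, w) ≤ c J` (`exists_dual_test`). Testing with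
`(x, α w - y)` for a small `α` therefore controls `s_V(x, x)`, `s_W(y, y)` and `J` (`infsup_algebra`).

*A discrete Poincaré inequality.* What is missing is the term `γ_V ‖h ∇x‖²` of the norm. The jump
of the whole gradient of `x` across a face is controlled by the jump of its normal component and,
through an inverse inequality for the tangential component, by the jump of `x` itself
(`Mesh.Regular.slope_sq_le`); on `ΓC` the same holds for the gradient instead of its jump. So it
suffices to bound a piecewise constant function by its jumps and its values on `ΓC`, uniformly in
the mesh. In `L¹` this follows from translations (`exists_poincare_L1`): along almost every
segment the function varies by at most the sum of its jumps across the crossed faces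
(`ae_pwConst_sub_le`), the segments parallel to `z` that cross a given face start in a set of
volume `O((|z| + h) h^(d-1))` (`volume_crosses_le`), and near a flat piece of `ΓC` there is a ball
that a translation moves out of the domain through `ΓC` (`exists_window`). The other segments in
use join points of the domain and stay inside by convexity. Applying the `L¹` inequality to
`|∇x|²` yields the `L²` version (`exists_poincare_slope`).

The existence of the constants `C_i` and `c_𝒯` is a scaling argument (`exists_inverseConst`,
`exists_faceMeanConst`). If `(x, y)` has norm zero, the supremum still has to be nonnegative,
which holds because `V_h` contains an element of positive norm (`exists_test_nonneg`).
-/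

open MeasureTheory

noncomputable section

namespace CRCauchy

variable {d : ℕ}

/-! ### Barycentric coordinates -/

/-- The constant gradient of an affine function, as a linear map. -/
def slope : (E d →ᵃ[ℝ] ℝ) →ₗ[ℝ] E d where
  toFun f := (InnerProductSpace.toDual ℝ (E d)).symm (LinearMap.toContinuousLinearMap f.linear)
  map_add' f g := by simp
  map_smul' c f := by simp

theorem inner_slope (f : E d →ᵃ[ℝ] ℝ) (v : E d) : inner ℝ (slope f) v = f.linear v := by
  simp [slope]

theorem affine_sub (f : E d →ᵃ[ℝ] ℝ) (x y : E d) : f x - f y = inner ℝ (slope f) (x - y) := by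
  rw [inner_slope]
  simpa using (f.linearMap_vsub x y).symm

theorem affine_add (f : E d →ᵃ[ℝ] ℝ) (x z : E d) : f (x + z) = f x + inner ℝ (slope f) z := by
  have := affine_sub f (x + z) x
  simp at this
  linarith

theorem affine_continuous (f : E d →ᵃ[ℝ] ℝ) : Continuous f := f.continuous_of_finiteDimensional

theorem grad_eq {Ω : Set (E d)} (T : OrientedMesh d Ω) (v : Broken T) (κ : T.cells) (x : E d) :
    grad T v κ x = slope (v κ) := by
  have h : HasGradientAt (fun y => v κ y) (slope (v κ)) x := by
    rw [hasGradientAt_iff_hasFDerivAt]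
    have h2 : (InnerProductSpace.toDual ℝ (E d)) (slope (v κ))
        = LinearMap.toContinuousLinearMap (v κ).linear := by simp [slope]
    rw [h2]
    have h3 : (fun y => v κ y) = fun y => LinearMap.toContinuousLinearMap (v κ).linear y + v κ 0 := by
      funext y
      have := affine_add (v κ) 0 y
      rw [inner_slope] at this
      simp at this ⊢
      linarith
    rw [h3]
    exact (ContinuousLinearMap.hasFDerivAt _).add_const _
  exact h.gradient

/-- `κ` is the vertex set of a nondegenerate simplex of full dimension. -/
structure IsSimplex (κ : Finset (E d)) : Prop where
  card : κ.card = d + 1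
  indep : AffineIndependent ℝ (fun p : (κ : Set (E d)) => (p : E d))

theorem Mesh.isSimplex {Ω : Set (E d)} (T : Mesh d Ω) {κ : Finset (E d)} (h : κ ∈ T.cells) :
    IsSimplex κ := ⟨T.card_eq κ h, T.indep κ h⟩

/-- The vertices of a full-dimensional simplex form an affine basis. -/
def IsSimplex.basis {κ : Finset (E d)} (h : IsSimplex κ) : AffineBasis κ ℝ (E d) where
  toFun p := p
  ind' := h.indep
  tot' := by
    have := (h.indep.affineSpan_eq_top_iff_card_eq_finrank_add_one (ι := κ)).2
      (by simp [h.card])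
    exact this

open Classical in
/-- The barycentric coordinate of the simplex `κ` belonging to its vertex `p`
(and `0` if `p` is no vertex). -/
def bary (κ : Finset (E d)) (p : E d) : E d →ᵃ[ℝ] ℝ :=
  if h : IsSimplex κ ∧ p ∈ κ then h.1.basis.coord ⟨p, h.2⟩ else 0

namespace IsSimplex

variable {κ : Finset (E d)} (h : IsSimplex κ)
include h

theorem bary_eq {p : E d} (hp : p ∈ κ) : bary κ p = h.basis.coord ⟨p, hp⟩ := by
  simp [bary, h, hp]

theorem bary_self {p : E d} (hp : p ∈ κ) : bary κ p p = 1 := by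
  rw [h.bary_eq hp]
  exact h.basis.coord_apply_eq ⟨p, hp⟩

theorem bary_ne {p q : E d} (hp : p ∈ κ) (hq : q ∈ κ) (hpq : q ≠ p) : bary κ p q = 0 := by
  rw [h.bary_eq hp]
  exact h.basis.coord_apply_ne (i := ⟨p, hp⟩) (j := ⟨q, hq⟩) (by simpa using hpq.symm)

theorem sum_bary (x : E d) : ∑ p ∈ κ, bary κ p x = 1 := by
  rw [← Finset.sum_coe_sort, ← h.basis.sum_coord_apply_eq_one x]
  exact Finset.sum_congr rfl fun p _ => by rw [h.bary_eq p.2]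

theorem sum_bary_smul (x : E d) : ∑ p ∈ κ, bary κ p x • p = x := by
  rw [← Finset.sum_coe_sort]
  conv_rhs => rw [← h.basis.linear_combination_coord_eq_self x]
  exact Finset.sum_congr rfl fun p _ => by rw [h.bary_eq p.2]; rfl

theorem affine_eq (f : E d →ᵃ[ℝ] ℝ) (x : E d) : f x = ∑ p ∈ κ, bary κ p x * f p := by
  have h1 := Finset.map_affineCombination κ (fun p : E d => p) (fun p => bary κ p x) (h.sum_bary x) f
  rw [Finset.affineCombination_eq_linear_combination _ _ _ (h.sum_bary x),
    Finset.affineCombination_eq_linear_combination _ _ _ (h.sum_bary x), h.sum_bary_smul] at h1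
  simpa using h1

theorem affine_eq_sum (f : E d →ᵃ[ℝ] ℝ) : f = ∑ p ∈ κ, f p • bary κ p := by
  ext x
  have : ∀ s : Finset (E d), (∑ p ∈ s, f p • bary κ p) x = ∑ p ∈ s, f p * bary κ p x := by
    classical
    intro s
    induction s using Finset.induction_on with
    | empty => simp
    | insert a s ha ih => simp [Finset.sum_insert ha, ih]
  rw [this, h.affine_eq f x]
  exact Finset.sum_congr rfl fun p _ => mul_comm _ _

theorem slope_eq (f : E d →ᵃ[ℝ] ℝ) : slope f = ∑ p ∈ κ, f p • slope (bary κ p) := by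
  conv_lhs => rw [h.affine_eq_sum f]
  simp [map_sum]

theorem sum_slope_bary : ∑ p ∈ κ, slope (bary κ p) = 0 := by
  have h1 := h.slope_eq (AffineMap.const ℝ (E d) (1 : ℝ))
  simp only [AffineMap.const_apply, one_smul] at h1
  rw [← h1]
  ext1
  simp [slope]

/-- The barycentric coordinates of an affine combination of vertices are its weights. -/
theorem bary_of_sum {s : Finset (E d)} (hs : s ⊆ κ) {w : E d → ℝ} (hw : ∑ p ∈ s, w p = 1)
    {q : E d} (hq : q ∈ κ) [Decidable (q ∈ s)] :
    bary κ q (∑ p ∈ s, w p • p) = if q ∈ s then w q else 0 := by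
  have h1 := Finset.map_affineCombination s (fun p : E d => p) w hw (bary κ q)
  rw [Finset.affineCombination_eq_linear_combination _ _ _ hw,
    Finset.affineCombination_eq_linear_combination _ _ _ hw] at h1
  rw [h1]
  simp only [Function.comp_apply, smul_eq_mul]
  split_ifs with hqs
  · rw [Finset.sum_eq_single q]
    · rw [h.bary_self hq, mul_one]
    · intro p hp hpq
      rw [h.bary_ne hq (hs hp) hpq, mul_zero]
    · exact fun h' => absurd hqs h'
  · refine Finset.sum_eq_zero fun p hp => ?_
    rw [h.bary_ne hq (hs hp) (fun e => hqs (e ▸ hp)), mul_zero]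

theorem sum_subset_bary {s : Finset (E d)} (hs : s ⊆ κ) {x : E d}
    (hx : ∀ p ∈ κ, p ∉ s → bary κ p x = 0) :
    ∑ p ∈ s, bary κ p x = 1 ∧ ∑ p ∈ s, bary κ p x • p = x := by
  constructor
  · rw [← h.sum_bary x]
    exact Finset.sum_subset hs fun p hp hps => hx p hp hps
  · conv_rhs => rw [← h.sum_bary_smul x]
    exact Finset.sum_subset hs fun p hp hps => by rw [hx p hp hps, zero_smul]

/-- A face of a simplex, of any dimension, in terms of the barycentric coordinates of the whole
simplex. -/
theorem mem_hull_subset {s : Finset (E d)} (hs : s ⊆ κ) {x : E d} :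
    x ∈ hull s ↔ (∀ p ∈ κ, 0 ≤ bary κ p x) ∧ ∀ p ∈ κ, p ∉ s → bary κ p x = 0 := by
  classical
  rw [hull, Finset.mem_convexHull']
  constructor
  · rintro ⟨w, hw0, hw1, rfl⟩
    refine ⟨fun p hp => ?_, fun p hp hps => ?_⟩
    · rw [h.bary_of_sum hs hw1 hp]
      split_ifs with hps
      exacts [hw0 p hps, le_rfl]
    · rw [h.bary_of_sum hs hw1 hp, if_neg hps]
  · rintro ⟨h0, h1⟩
    exact ⟨fun p => bary κ p x, fun p hp => h0 p (hs hp), h.sum_subset_bary hs h1⟩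

theorem mem_openHull_subset {s : Finset (E d)} (hs : s ⊆ κ) {x : E d} :
    x ∈ openHull s ↔ (∀ p ∈ s, 0 < bary κ p x) ∧ ∀ p ∈ κ, p ∉ s → bary κ p x = 0 := by
  classical
  constructor
  · rintro ⟨w, hw0, hw1, rfl⟩
    refine ⟨fun p hp => ?_, fun p hp hps => ?_⟩
    · rw [h.bary_of_sum hs hw1 (hs hp), if_pos hp]
      exact hw0 p hp
    · rw [h.bary_of_sum hs hw1 hp, if_neg hps]
  · rintro ⟨h0, h1⟩
    exact ⟨fun p => bary κ p x, h0, h.sum_subset_bary hs h1⟩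

theorem mem_hull {x : E d} : x ∈ hull κ ↔ ∀ p ∈ κ, 0 ≤ bary κ p x := by
  rw [h.mem_hull_subset (Finset.Subset.refl κ)]
  exact ⟨fun h => h.1, fun h => ⟨h, fun p hp hp' => absurd hp hp'⟩⟩

theorem range_basis : Set.range h.basis = (κ : Set (E d)) := by
  ext x
  constructor
  · rintro ⟨p, rfl⟩; exact p.2
  · intro hx; exact ⟨⟨x, hx⟩, rfl⟩

theorem interior_hull : interior (hull κ) = {x | ∀ p ∈ κ, 0 < bary κ p x} := by
  have h1 := h.basis.interior_convexHull
  rw [h.range_basis] at h1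
  rw [hull, h1]
  ext x
  simp only [Set.mem_ofPred_eq]
  constructor
  · intro hx p hp; rw [h.bary_eq hp]; exact hx _
  · intro hx p; have := hx p p.2; rwa [h.bary_eq p.2] at this

end IsSimplex

theorem hull_mono {s t : Finset (E d)} (h : s ⊆ t) : hull s ⊆ hull t :=
  convexHull_mono (by exact_mod_cast h)

theorem subset_hull {s : Finset (E d)} {p : E d} (hp : p ∈ s) : p ∈ hull s :=
  subset_convexHull ℝ _ (by exact_mod_cast hp)

theorem hull_convex (s : Finset (E d)) : Convex ℝ (hull s) := convex_convexHull ℝ _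

theorem isCompact_hull (s : Finset (E d)) : IsCompact (hull s) :=
  s.finite_toSet.isCompact_convexHull ℝ

theorem measurableSet_hull (s : Finset (E d)) : MeasurableSet (hull s) :=
  (isCompact_hull s).isClosed.measurableSet

theorem openHull_subset_hull (s : Finset (E d)) : openHull s ⊆ hull s := by
  rintro x ⟨w, h0, h1, rfl⟩
  rw [hull, Finset.mem_convexHull']
  exact ⟨w, fun p hp => (h0 p hp).le, h1, rfl⟩

theorem norm_sub_le_size {s : Finset (E d)} {x y : E d} (hx : x ∈ hull s) (hy : y ∈ hull s) :
    ‖x - y‖ ≤ size s := by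
  rw [← dist_eq_norm]
  exact Metric.dist_le_diam_of_mem (isCompact_hull s).isBounded hx hy

theorem size_nonneg (s : Finset (E d)) : 0 ≤ size s := Metric.diam_nonneg

theorem size_mono {s t : Finset (E d)} (h : s ⊆ t) : size s ≤ size t :=
  Metric.diam_mono (hull_mono h) (isCompact_hull t).isBounded

/-! ### Volumes and areas of simplices -/

/-- The `d`-dimensional volume of a simplex. -/
def vol (κ : Finset (E d)) : ℝ := (volume : Measure (E d)).real (hull κ)

/-- The `(d-1)`-dimensional area of a face. -/
def area (F : Finset (E d)) : ℝ := (μHE[d - 1] : Measure (E d)).real (hull F)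

theorem lintegral_Ioc_pow (n : ℕ) :
    ∫⁻ x in Set.Ioc (0 : ℝ) 1, ENNReal.ofReal (x ^ n) = ENNReal.ofReal ((n + 1 : ℝ)⁻¹) := by
  rw [← ofReal_integral_eq_lintegral_ofReal, ← intervalIntegral.integral_of_le zero_le_one,
    integral_pow]
  · simp
  · exact ((continuous_pow n).integrableOn_Icc (a := 0) (b := 1)).mono_set Set.Ioc_subset_Icc_self
  · filter_upwards [ae_restrict_mem measurableSet_Ioc] with x hx
    exact pow_nonneg hx.1.le n

theorem affine_homothety (f : E d →ᵃ[ℝ] ℝ) (p y : E d) (c : ℝ) :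
    f (AffineMap.homothety p c y) = c * f y + (1 - c) * f p := by
  rw [AffineMap.homothety_apply, vsub_eq_sub, vadd_eq_add, add_comm, affine_add, inner_smul_right,
    ← affine_sub]
  ring

namespace IsSimplex

variable {κ : Finset (E d)} (h : IsSimplex κ)
include h

theorem exists_ne (hd : 0 < d) (p : E d) : ∃ q ∈ κ, q ≠ p := by
  have : 1 < κ.card := by rw [h.card]; omega
  exact Finset.exists_mem_ne this p

theorem slope_bary_ne_zero (hd : 0 < d) {p : E d} (hp : p ∈ κ) : slope (bary κ p) ≠ 0 := by
  obtain ⟨q, hq, hqp⟩ := h.exists_ne hd p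
  intro h0
  have := affine_sub (bary κ p) p q
  rw [h.bary_self hp, h.bary_ne hp hq hqp, h0] at this
  simp at this

theorem mem_hull_erase [DecidableEq (E d)] {p : E d} (hp : p ∈ κ) {x : E d} :
    x ∈ hull (κ.erase p) ↔ (∀ q ∈ κ, 0 ≤ bary κ q x) ∧ bary κ p x = 0 := by
  rw [h.mem_hull_subset (Finset.erase_subset p κ)]
  refine and_congr_right fun _ => ⟨fun h1 => h1 p hp (by simp), fun h1 q hq hq' => ?_⟩
  have : q = p := by
    by_contra hne
    exact hq' (Finset.mem_erase.2 ⟨hne, hq⟩)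
  rw [this, h1]

/-- The slice of a simplex parallel to the face opposite to the vertex `p` is a homothetic copy of
that face. -/
theorem slice_eq_homothety [DecidableEq (E d)] {p : E d} (hp : p ∈ κ) {c : ℝ} (hc : 0 < c)
    (hc1 : c ≤ 1) :
    hull κ ∩ {y | bary κ p y = 1 - c} =
      AffineMap.homothety p c '' hull (κ.erase p) := by
  ext y
  constructor
  · rintro ⟨hy, hy1⟩
    refine ⟨AffineMap.homothety p c⁻¹ y, ?_, ?_⟩
    · rw [h.mem_hull_erase hp]
      rw [h.mem_hull] at hy
      have h1 : bary κ p (AffineMap.homothety p c⁻¹ y) = 0 := by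
        rw [affine_homothety, h.bary_self hp, hy1]; field_simp; ring
      refine ⟨fun q hq => ?_, h1⟩
      by_cases hqp : q = p
      · rw [hqp, h1]
      · rw [affine_homothety, h.bary_ne hq hp (Ne.symm hqp), mul_zero, add_zero]
        exact mul_nonneg (inv_nonneg.2 hc.le) (hy q hq)
    · rw [← AffineMap.homothety_mul_apply, mul_inv_cancel₀ hc.ne']
      simp
  · rintro ⟨x, hx, rfl⟩
    rw [h.mem_hull_erase hp] at hx
    have h1 : bary κ p (AffineMap.homothety p c x) = 1 - c := by
      rw [affine_homothety, h.bary_self hp, hx.2]; ring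
    refine ⟨?_, h1⟩
    rw [h.mem_hull]
    intro q hq
    by_cases hqp : q = p
    · rw [hqp, h1]; linarith
    · rw [affine_homothety, h.bary_ne hq hp (Ne.symm hqp), mul_zero, add_zero]
      exact mul_nonneg hc.le (hx.1 q hq)

/-- The volume of a simplex is height times base over the dimension; the height over the face
opposite to `p` is `1 / ‖∇λ_p‖`. -/
theorem volume_hull [DecidableEq (E d)] (hd : 0 < d) {p : E d} (hp : p ∈ κ) :
    volume (hull κ) = ENNReal.ofReal ((d * ‖slope (bary κ p)‖)⁻¹) *
      (μHE[d - 1] : Measure (E d)) (hull (κ.erase p)) := by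
  set g := slope (bary κ p) with hg
  have hg0 : g ≠ 0 := h.slope_bary_ne_zero hd hp
  have hgn : 0 < ‖g‖ := norm_pos_iff.2 hg0
  set v : E d := -((‖g‖ ^ 2)⁻¹ • g) with hv
  have hv0 : v ≠ 0 := by simp [hv, hg0]
  have hvn : ‖v‖ = ‖g‖⁻¹ := by
    rw [hv, norm_neg, norm_smul, norm_inv, norm_pow, norm_norm]; field_simp
  have hgv : inner ℝ g v = -1 := by
    rw [hv, inner_neg_right, inner_smul_right, real_inner_self_eq_norm_sq]; field_simp
  have hplane : ∀ x : ℝ, (AffineSubspace.mk' (x • v +ᵥ p) (Submodule.span ℝ {v})ᗮ : Set (E d)) =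
      {y | bary κ p y = 1 - x} := by
    intro x
    ext y
    rw [SetLike.mem_coe, AffineSubspace.mem_mk', Submodule.mem_orthogonal_singleton_iff_inner_right,
      hv, inner_neg_left, real_inner_smul_left, ← hv]
    have h2 : inner ℝ g (y -ᵥ (x • v +ᵥ p)) = bary κ p y - 1 + x := by
      rw [vadd_eq_add, vsub_eq_sub,
        show y - (x • v + p) = (y - p) - x • v by abel, inner_sub_right,
        inner_smul_right, hgv, hg, ← affine_sub, h.bary_self hp]
      ring
    rw [h2, Set.mem_ofPred_eq, neg_eq_zero, mul_eq_zero]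
    have : (‖g‖ ^ 2)⁻¹ ≠ 0 := by positivity
    constructor
    · rintro (h3 | h3)
      · exact absurd h3 this
      · linarith
    · intro h3; right; linarith
  -- Fubini for the hyperplanes orthogonal to `v`, which are the level sets of `bary κ p`; the
  -- vector `v` is scaled so that the slice at `x` is the face shrunk by the factor `x` towards
  -- `p`.
  have key := EuclideanGeometry.euclideanHausdorffMeasure_eq_lintegral p hv0
    (measurableSet_hull κ)
  rw [finrank_euclideanSpace_fin, EuclideanSpace.euclideanHausdorffMeasure_eq_volume] at key
  rw [key]
  set M := (μHE[d - 1] : Measure (E d)) (hull (κ.erase p)) with hM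
  have hint : ∫⁻ x : ℝ, (μHE[d - 1] : Measure (E d)) (hull κ ∩
      (AffineSubspace.mk' (x • v +ᵥ p) (Submodule.span ℝ {v})ᗮ : Set (E d))) =
      ∫⁻ x in Set.Ioc (0 : ℝ) 1, ENNReal.ofReal (x ^ (d - 1)) * M := by
    rw [← lintegral_indicator measurableSet_Ioc]
    refine lintegral_congr_ae ?_
    have h0 : ∀ᵐ x : ℝ, x ≠ 0 := by simp [ae_iff]
    filter_upwards [h0] with x hx0
    rw [hplane x]
    by_cases hx : x ∈ Set.Ioc (0 : ℝ) 1
    · rw [Set.indicator_of_mem hx, h.slice_eq_homothety hp hx.1 hx.2,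
        euclideanHausdorffMeasure_homothety_image _ _ hx.1.ne', ENNReal.smul_def, smul_eq_mul]
      congr 1
      rw [ENNReal.coe_pow, ENNReal.ofReal_pow hx.1.le, ENNReal.ofReal,
        Real.toNNReal_eq_nnnorm_of_nonneg hx.1.le]
    · rw [Set.indicator_of_notMem hx]
      have : hull κ ∩ {y | bary κ p y = 1 - x} = ∅ := by
        ext y
        simp only [Set.mem_inter_iff, Set.mem_ofPred_eq, Set.mem_empty_iff_false, iff_false, not_and]
        intro hy hy1
        rw [h.mem_hull] at hy
        apply hx
        have h3 := hy p hp
        have h4 : bary κ p y ≤ 1 := by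
          rw [← h.sum_bary y]
          exact Finset.single_le_sum (f := fun q => bary κ q y) (fun q hq => hy q hq) hp
        refine ⟨lt_of_le_of_ne (by linarith) (Ne.symm hx0), by linarith⟩
      rw [this, measure_empty]
  rw [hint, lintegral_mul_const _ (by fun_prop), lintegral_Ioc_pow, ← mul_assoc, ← ofReal_norm,
    hvn, ← ENNReal.ofReal_mul (by positivity)]
  congr 2
  have hcast : ((d - 1 : ℕ) : ℝ) + 1 = d := by rw [Nat.cast_sub hd]; simp
  rw [hcast, mul_inv, mul_comm]

theorem vol_pos : 0 < vol κ := by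
  refine ENNReal.toReal_pos ?_ (isCompact_hull κ).measure_lt_top.ne
  have h1 : (interior (hull κ)).Nonempty := by
    rw [hull, interior_convexHull_nonempty_iff_affineSpan_eq_top]
    rw [← h.range_basis]
    exact h.basis.tot
  exact ((isOpen_interior.measure_pos _ h1).trans_le (measure_mono interior_subset)).ne'

theorem measure_face_ne_top [DecidableEq (E d)] (hd : 0 < d) {p : E d} (hp : p ∈ κ) :
    (μHE[d - 1] : Measure (E d)) (hull (κ.erase p)) ≠ ⊤ := by
  intro htop
  have h1 := h.volume_hull hd hp
  have hg : 0 < ‖slope (bary κ p)‖ := norm_pos_iff.2 (h.slope_bary_ne_zero hd hp)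
  rw [htop, ENNReal.mul_top] at h1
  · exact (isCompact_hull κ).measure_lt_top.ne h1
  · rw [ne_eq, ENNReal.ofReal_eq_zero, not_le]; positivity

theorem area_face [DecidableEq (E d)] (hd : 0 < d) {p : E d} (hp : p ∈ κ) :
    area (κ.erase p) = d * vol κ * ‖slope (bary κ p)‖ := by
  have h1 := congrArg ENNReal.toReal (h.volume_hull hd hp)
  have hg : 0 < ‖slope (bary κ p)‖ := norm_pos_iff.2 (h.slope_bary_ne_zero hd hp)
  rw [ENNReal.toReal_mul, ENNReal.toReal_ofReal (by positivity)] at h1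
  change vol κ = _ * area (κ.erase p) at h1
  rw [h1]
  have : (d : ℝ) ≠ 0 := by positivity
  field_simp

theorem area_pos [DecidableEq (E d)] (hd : 0 < d) {p : E d} (hp : p ∈ κ) :
    0 < area (κ.erase p) := by
  have hg : 0 < ‖slope (bary κ p)‖ := norm_pos_iff.2 (h.slope_bary_ne_zero hd hp)
  have := h.vol_pos
  rw [h.area_face hd hp]
  positivity

end IsSimplex

theorem integrableOn_of_measure_ne_top {μ : Measure (E d)} {S : Set (E d)} (hS : IsCompact S)
    (hμ : μ S ≠ ⊤) {f : E d → ℝ} (hf : Continuous f) : IntegrableOn f S μ :=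
  hf.continuousOn.integrableOn_of_subset_isCompact hS hS.isClosed.measurableSet subset_rfl hμ

/-- Contraction by one half, stated for the push-forward: the area is multiplied by `2 ^ k`. -/
theorem map_homothety_half (k : ℕ) (p : E d) :
    (μHE[k] : Measure (E d)).map (AffineMap.homothety p (1 / 2 : ℝ)) =
      (2 ^ k : ENNReal) • (μHE[k] : Measure (E d)) := by
  have hc : Continuous (AffineMap.homothety p (1 / 2 : ℝ)) :=
    (AffineMap.homothety p (1 / 2 : ℝ)).continuous_of_finiteDimensional
  ext s hs
  rw [Measure.map_apply hc.measurable hs, euclideanHausdorffMeasure_homothety_preimage _ _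
    (by norm_num), Measure.smul_apply, smul_eq_mul, ENNReal.smul_def, smul_eq_mul]
  congr 1
  rw [ENNReal.coe_pow]
  congr 1
  have : (‖(1 / 2 : ℝ)‖₊)⁻¹ = 2 := by ext; norm_num
  rw [this]; norm_num

/-- On a convex set, the value of an affine function at a point of the set is bounded by its
mean square, since `f p = 2 f ((p + y) / 2) - f y` for every `y`. -/
theorem sq_le_integral_sq (k : ℕ) {S : Set (E d)} (hS : IsCompact S) (hconv : Convex ℝ S)
    (hμ : (μHE[k] : Measure (E d)) S ≠ ⊤) {p : E d} (hp : p ∈ S) (f : E d →ᵃ[ℝ] ℝ) :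
    (μHE[k] : Measure (E d)).real S * f p ^ 2 ≤
      (8 * 2 ^ k + 2) * ∫ x in S, f x ^ 2 ∂(μHE[k] : Measure (E d)) := by
  set μ := (μHE[k] : Measure (E d)) with hμdef
  set m := AffineMap.homothety p (1 / 2 : ℝ) with hm
  have hfc : Continuous f := affine_continuous f
  have hc : Continuous m := m.continuous_of_finiteDimensional
  have hemb : MeasurableEmbedding m := by
    refine hc.measurableEmbedding fun x y hxy => ?_
    simpa [hm, AffineMap.homothety_apply] using hxy
  have hmap := map_homothety_half k p
  rw [← hμdef, ← hm] at hmap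
  have hsub : S ⊆ m ⁻¹' S := by
    intro y hy
    rw [Set.mem_preimage, hm, AffineMap.homothety_apply, vsub_eq_sub, vadd_eq_add]
    have := hconv hy hp (by norm_num : (0 : ℝ) ≤ 1 / 2) (by norm_num : (0 : ℝ) ≤ 1 / 2) (by norm_num)
    convert this using 1
    module
  have hi1 : IntegrableOn (fun x => f x ^ 2) S μ :=
    integrableOn_of_measure_ne_top hS hμ (hfc.pow 2)
  have hi2 : IntegrableOn (fun x => f (m x) ^ 2) (m ⁻¹' S) μ := by
    have : IntegrableOn (fun x => f x ^ 2) S (μ.map m) := by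
      rw [hmap, IntegrableOn, Measure.restrict_smul]
      exact Integrable.smul_measure hi1 (ENNReal.pow_ne_top ENNReal.ofNat_ne_top)
    exact (hemb.integrableOn_map_iff).1 this
  have hint : ∫ x in m ⁻¹' S, f (m x) ^ 2 ∂μ = 2 ^ k * ∫ x in S, f x ^ 2 ∂μ := by
    rw [← hemb.setIntegral_map (μ := μ) (g := fun x => f x ^ 2), hmap, Measure.restrict_smul,
      integral_smul_measure]
    simp
  have h1 : ∫ x in S, f (m x) ^ 2 ∂μ ≤ 2 ^ k * ∫ x in S, f x ^ 2 ∂μ := by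
    rw [← hint]
    refine setIntegral_mono_set hi2 ?_ (Filter.Eventually.of_forall hsub)
    exact Filter.Eventually.of_forall fun x => sq_nonneg _
  have h2 : ∫ x in S, f p ^ 2 ∂μ ≤ ∫ x in S, (8 * f (m x) ^ 2 + 2 * f x ^ 2) ∂μ := by
    refine setIntegral_mono_on ?_ ?_ hS.isClosed.measurableSet fun y hy => ?_
    · exact integrableOn_of_measure_ne_top hS hμ continuous_const
    · exact integrableOn_of_measure_ne_top hS hμ (by fun_prop)
    · have h3 : f (m y) = 1 / 2 * f y + (1 - 1 / 2) * f p := affine_homothety f p y _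
      have h4 : f p = 2 * f (m y) - f y := by linarith
      rw [h4]
      nlinarith [sq_nonneg (2 * f (m y) + f y)]
  rw [setIntegral_const, smul_eq_mul, integral_add, integral_const_mul, integral_const_mul] at h2
  · linarith
  · exact integrableOn_of_measure_ne_top hS hμ (by fun_prop)
  · exact integrableOn_of_measure_ne_top hS hμ (by fun_prop)

/-! ### Face means and the Green formula -/

/-- The affine map exchanging the vertices `p` and `q` of the simplex `κ` and fixing the other
vertices. -/
def swapMap (κ : Finset (E d)) (p q : E d) (x : E d) : E d :=
  x + (bary κ p x - bary κ q x) • (q - p)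

theorem continuous_swapMap (κ : Finset (E d)) (p q : E d) : Continuous (swapMap κ p q) := by
  have := affine_continuous (bary κ p)
  have := affine_continuous (bary κ q)
  unfold swapMap
  fun_prop

theorem bary_swapMap (κ : Finset (E d)) (p q r x : E d) :
    bary κ r (swapMap κ p q x) =
      bary κ r x + (bary κ p x - bary κ q x) * (bary κ r q - bary κ r p) := by
  rw [swapMap, affine_add, inner_smul_right, ← affine_sub]

namespace IsSimplex

variable {κ : Finset (E d)} (h : IsSimplex κ)
include h

theorem bary_swapMap_left {p q : E d} (hp : p ∈ κ) (hq : q ∈ κ) (hpq : p ≠ q) (x : E d) :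
    bary κ p (swapMap κ p q x) = bary κ q x := by
  rw [bary_swapMap, h.bary_self hp, h.bary_ne hp hq hpq.symm]; ring

theorem bary_swapMap_right {p q : E d} (hp : p ∈ κ) (hq : q ∈ κ) (hpq : p ≠ q) (x : E d) :
    bary κ q (swapMap κ p q x) = bary κ p x := by
  rw [bary_swapMap, h.bary_self hq, h.bary_ne hq hp hpq]; ring

theorem bary_swapMap_other {p q r : E d} (hp : p ∈ κ) (hq : q ∈ κ) (hr : r ∈ κ) (hrp : r ≠ p)
    (hrq : r ≠ q) (x : E d) : bary κ r (swapMap κ p q x) = bary κ r x := by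
  rw [bary_swapMap, h.bary_ne hr hq hrq.symm, h.bary_ne hr hp hrp.symm]; ring

theorem swapMap_swapMap {p q : E d} (hp : p ∈ κ) (hq : q ∈ κ) (hpq : p ≠ q) (x : E d) :
    swapMap κ p q (swapMap κ p q x) = x := by
  rw [swapMap, h.bary_swapMap_left hp hq hpq, h.bary_swapMap_right hp hq hpq, swapMap]
  module

/-- Exchanging two vertices of a face preserves the area on the hyperplane of that face: the linear
part of the exchange is an involution, so its determinant is `±1`. -/
theorem measure_image_swapMap (hd : 0 < d) {p q r : E d} (hp : p ∈ κ) (hq : q ∈ κ) (hr : r ∈ κ)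
    (hpq : p ≠ q) (hrp : r ≠ p) (hrq : r ≠ q) {S : Set (E d)} (hS : ∀ x ∈ S, bary κ r x = 0) :
    (μHE[d - 1] : Measure (E d)) (swapMap κ p q '' S) = (μHE[d - 1] : Measure (E d)) S := by
  set g := slope (bary κ r) with hg
  have hg0 : g ≠ 0 := h.slope_bary_ne_zero hd hr
  set U := (Submodule.span ℝ {g})ᗮ with hU
  have hrank : Module.finrank ℝ U = d - 1 := by
    have : Fact (Module.finrank ℝ (E d) = (d - 1) + 1) :=
      ⟨by rw [finrank_euclideanSpace_fin]; omega⟩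
    exact Submodule.finrank_orthogonal_span_singleton hg0
  have hmemU : ∀ u : E d, u ∈ U ↔ inner ℝ g u = 0 := fun u =>
    Submodule.mem_orthogonal_singleton_iff_inner_right
  have hqpU : q - p ∈ U := by
    rw [hmemU, hg, ← affine_sub, h.bary_ne hr hq hrq.symm, h.bary_ne hr hp hrp.symm, sub_zero]
  set ℓ : E d →ₗ[ℝ] ℝ := (bary κ p).linear - (bary κ q).linear with hℓ
  have hℓapply : ∀ u, ℓ u = inner ℝ (slope (bary κ p)) u - inner ℝ (slope (bary κ q)) u := by
    intro u; simp [hℓ, inner_slope]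
  have hℓqp : ℓ (q - p) = -2 := by
    rw [hℓapply, ← affine_sub, ← affine_sub, h.bary_self hp, h.bary_self hq,
      h.bary_ne hp hq hpq.symm, h.bary_ne hq hp hpq]
    norm_num
  -- `L` is the linear part of the exchange, restricted to the direction space of the hyperplane.
  let L : U →ₗ[ℝ] U := LinearMap.id + (ℓ.comp U.subtype).smulRight ⟨q - p, hqpU⟩
  have hL : ∀ u : U, ((L u : U) : E d) = u + ℓ u • (q - p) := fun u => rfl
  have hLL : L * L = 1 := by
    ext u : 1
    apply Subtype.ext
    rw [Module.End.mul_apply, hL, hL, map_add, map_smul, hℓqp, Module.End.one_apply]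
    module
  have hdet : |LinearMap.det L| = 1 := by
    have h1 : LinearMap.det L * LinearMap.det L = 1 := by rw [← map_mul, hLL, map_one]
    rcases mul_self_eq_one_iff.1 h1 with h2 | h2 <;> simp [h2]
  set s : Set U := (fun u : U => p + (u : E d)) ⁻¹' S with hs
  have hSs : S = (fun x => p + x) '' (U.subtypeₗᵢ '' s) := by
    ext x
    rw [Set.image_image]
    constructor
    · intro hx
      have : x - p ∈ U := by
        rw [hmemU, hg, ← affine_sub, hS x hx, h.bary_ne hr hp hrp.symm, sub_zero]
      exact ⟨⟨x - p, this⟩, by simpa [hs] using hx, by simp⟩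
    · rintro ⟨u, hu, rfl⟩
      exact hu
  have hAS : swapMap κ p q '' S = (fun x => q + x) '' (U.subtypeₗᵢ '' (L '' s)) := by
    conv_lhs => rw [hSs]
    simp only [Set.image_image]
    refine Set.image_congr fun u _ => ?_
    change swapMap κ p q (p + (u : E d)) = q + ((L u : U) : E d)
    rw [swapMap, hL, affine_add, affine_add, h.bary_self hp, h.bary_ne hq hp hpq, hℓapply]
    module
  rw [hAS, Set.image_add_left, measure_preimage_add,
    U.subtypeₗᵢ.isometry.euclideanHausdorffMeasure_image]
  conv_rhs => rw [hSs]
  rw [Set.image_add_left, measure_preimage_add,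
    U.subtypeₗᵢ.isometry.euclideanHausdorffMeasure_image, ← hrank,
    Measure.addHaar_image_linearMap, hdet]
  simp

/-- All barycentric coordinates that do not vanish on a face have the same mean over it, by the
symmetry of the face under exchanging two vertices. -/
theorem faceIntegral_bary_eq [DecidableEq (E d)] (hd : 0 < d) {p q r : E d} (hp : p ∈ κ)
    (hq : q ∈ κ) (hr : r ∈ κ) (hpq : p ≠ q) (hrp : r ≠ p) (hrq : r ≠ q) :
    faceIntegral (κ.erase r) (bary κ p) = faceIntegral (κ.erase r) (bary κ q) := by
  have hmem : ∀ x, swapMap κ p q x ∈ hull (κ.erase r) ↔ x ∈ hull (κ.erase r) := by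
    have himp : ∀ x, x ∈ hull (κ.erase r) → swapMap κ p q x ∈ hull (κ.erase r) := by
      intro x hx
      rw [h.mem_hull_erase hr] at hx ⊢
      rw [h.bary_swapMap_other hp hq hr hrp hrq]
      refine ⟨fun t ht => ?_, hx.2⟩
      by_cases htp : t = p
      · rw [htp, h.bary_swapMap_left hp hq hpq]; exact hx.1 q hq
      by_cases htq : t = q
      · rw [htq, h.bary_swapMap_right hp hq hpq]; exact hx.1 p hp
      rw [h.bary_swapMap_other hp hq ht htp htq]; exact hx.1 t ht
    intro x
    refine ⟨fun hx => ?_, himp x⟩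
    have := himp _ hx
    rwa [h.swapMap_swapMap hp hq hpq] at this
  have hinv : Function.LeftInverse (swapMap κ p q) (swapMap κ p q) := h.swapMap_swapMap hp hq hpq
  have hc := continuous_swapMap κ p q
  set μ := (μHE[d - 1] : Measure (E d)) with hμ
  have hmp : MeasurePreserving (swapMap κ p q) (μ.restrict (hull (κ.erase r)))
      (μ.restrict (hull (κ.erase r))) := by
    refine ⟨hc.measurable, ?_⟩
    ext B hB
    rw [Measure.map_apply hc.measurable hB, Measure.restrict_apply (hc.measurable hB),
      Measure.restrict_apply hB,
      ← h.measure_image_swapMap hd hp hq hr hpq hrp hrq (S := B ∩ hull (κ.erase r))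
        (fun x hx => ((h.mem_hull_erase hr).1 hx.2).2)]
    congr 1
    rw [Set.image_eq_preimage_of_inverse hinv hinv]
    ext x
    simp [hmem]
  have hemb : MeasurableEmbedding (swapMap κ p q) :=
    hc.measurableEmbedding hinv.injective
  have := hmp.integral_comp hemb (bary κ q)
  rw [faceIntegral, faceIntegral, ← hμ, ← this]
  exact integral_congr_ae (Filter.Eventually.of_forall fun x =>
    (h.bary_swapMap_right hp hq hpq x).symm)

theorem integrableOn_face [DecidableEq (E d)] (hd : 0 < d) {r : E d} (hr : r ∈ κ) {f : E d → ℝ}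
    (hf : Continuous f) : IntegrableOn f (hull (κ.erase r)) (μHE[d - 1] : Measure (E d)) :=
  integrableOn_of_measure_ne_top (isCompact_hull _) (h.measure_face_ne_top hd hr) hf

theorem faceIntegral_bary [DecidableEq (E d)] (hd : 0 < d) {p r : E d} (hr : r ∈ κ)
    (hp : p ∈ κ.erase r) : faceIntegral (κ.erase r) (bary κ p) = area (κ.erase r) / d := by
  have hcard : (κ.erase r).card = d := by rw [Finset.card_erase_of_mem hr, h.card]; rfl
  have h1 : ∑ q ∈ κ.erase r, faceIntegral (κ.erase r) (bary κ q) = area (κ.erase r) := by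
    unfold faceIntegral
    rw [← integral_finsetSum _ fun q _ => h.integrableOn_face hd hr (affine_continuous _)]
    rw [setIntegral_congr_fun (g := fun _ => (1 : ℝ)) (measurableSet_hull _)]
    · simp [area]
    · intro x hx
      have h2 := ((h.mem_hull_erase hr).1 hx).2
      have h3 := h.sum_bary x
      rw [← Finset.add_sum_erase _ _ hr, h2, zero_add] at h3
      exact h3
  have h2 : ∀ q ∈ κ.erase r, faceIntegral (κ.erase r) (bary κ q) =
      faceIntegral (κ.erase r) (bary κ p) := by
    intro q hq
    rw [Finset.mem_erase] at hq hp
    by_cases hqp : q = p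
    · rw [hqp]
    · exact h.faceIntegral_bary_eq hd hq.2 hp.2 hr hqp hq.1.symm hp.1.symm
  rw [Finset.sum_congr rfl h2, Finset.sum_const, hcard, nsmul_eq_mul] at h1
  have : (d : ℝ) ≠ 0 := by positivity
  field_simp
  linarith

/-- The mean of an affine function over a face is the mean of its values at the vertices. -/
theorem faceIntegral_affine [DecidableEq (E d)] (hd : 0 < d) {r : E d} (hr : r ∈ κ)
    (f : E d →ᵃ[ℝ] ℝ) :
    faceIntegral (κ.erase r) f = area (κ.erase r) / d * ∑ q ∈ κ.erase r, f q := by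
  have h1 : faceIntegral (κ.erase r) f =
      ∑ q ∈ κ.erase r, f q * faceIntegral (κ.erase r) (bary κ q) := by
    unfold faceIntegral
    simp_rw [← integral_const_mul]
    rw [← integral_finsetSum _ fun q _ =>
      h.integrableOn_face hd hr ((affine_continuous _).const_mul _)]
    refine setIntegral_congr_fun (measurableSet_hull _) fun x hx => ?_
    have h2 := ((h.mem_hull_erase hr).1 hx).2
    have h3 := h.affine_eq f x
    rw [← Finset.add_sum_erase _ _ hr, h2, zero_mul, zero_add] at h3
    rw [h3]
    exact Finset.sum_congr rfl fun q _ => mul_comm _ _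
  rw [h1, Finset.mul_sum]
  refine Finset.sum_congr rfl fun q hq => ?_
  rw [h.faceIntegral_bary hd hr hq, mul_comm]

/-- Green's formula on a simplex for affine functions; `-∇λ_r / ‖∇λ_r‖` is the outer normal on the
face opposite to `r`. -/
theorem green [DecidableEq (E d)] (hd : 0 < d) (a : E d) (f : E d →ᵃ[ℝ] ℝ) :
    ∑ r ∈ κ, inner ℝ a (-(‖slope (bary κ r)‖⁻¹ • slope (bary κ r))) *
      faceIntegral (κ.erase r) f = vol κ * inner ℝ a (slope f) := by
  have hd0 : (d : ℝ) ≠ 0 := by positivity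
  have h1 : ∀ r ∈ κ, inner ℝ a (-(‖slope (bary κ r)‖⁻¹ • slope (bary κ r))) *
      faceIntegral (κ.erase r) f =
      vol κ * (f r * inner ℝ a (slope (bary κ r)) -
        (∑ q ∈ κ, f q) * inner ℝ a (slope (bary κ r))) := by
    intro r hr
    have hn : ‖slope (bary κ r)‖ ≠ 0 := norm_ne_zero_iff.2 (h.slope_bary_ne_zero hd hr)
    rw [h.faceIntegral_affine hd hr, h.area_face hd hr, inner_neg_right, inner_smul_right,
      ← Finset.add_sum_erase κ f hr]
    field_simp
    ring
  rw [Finset.sum_congr rfl h1, ← Finset.mul_sum, Finset.sum_sub_distrib, ← Finset.mul_sum,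
    ← inner_sum, h.sum_slope_bary, h.slope_eq f, inner_sum]
  simp [inner_smul_right]

end IsSimplex

open scoped Classical

/-! ### Faces of a mesh of a convex domain -/

section Geometry

variable {Ω : Set (E d)}

theorem IsConvexPolytopalDomain.isOpen (hΩ : IsConvexPolytopalDomain Ω) : IsOpen Ω := by
  obtain ⟨-, s, rfl⟩ := hΩ
  exact isOpen_interior

theorem IsConvexPolytopalDomain.convex (hΩ : IsConvexPolytopalDomain Ω) : Convex ℝ Ω := by
  obtain ⟨-, s, rfl⟩ := hΩ
  exact (convex_convexHull ℝ _).interior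

theorem IsConvexPolytopalDomain.isBounded (hΩ : IsConvexPolytopalDomain Ω) :
    Bornology.IsBounded Ω := by
  obtain ⟨-, s, rfl⟩ := hΩ
  exact (isCompact_hull s).isBounded.subset interior_subset

theorem IsConvexPolytopalDomain.interior_closure (hΩ : IsConvexPolytopalDomain Ω) :
    interior (closure Ω) = Ω := by
  have h := hΩ.convex.interior_closure_eq_interior_of_nonempty_interior
    (by rw [hΩ.isOpen.interior_eq]; exact hΩ.1)
  rwa [hΩ.isOpen.interior_eq] at h

theorem IsConvexPolytopalDomain.openSegment_subset (hΩ : IsConvexPolytopalDomain Ω) {x y : E d}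
    (hx : x ∈ Ω) (hy : y ∈ closure Ω) : openSegment ℝ x y ⊆ Ω := by
  have h := hΩ.convex.openSegment_interior_closure_subset_interior
    (by rwa [hΩ.isOpen.interior_eq]) hy
  rwa [hΩ.isOpen.interior_eq] at h

end Geometry

/-- The faces of a simplex are obtained by removing one vertex. -/
theorem exists_eq_erase {κ F : Finset (E d)} (hκ : κ.card = d + 1) (hF : F.card = d) (hs : F ⊆ κ) :
    ∃ r ∈ κ, F = κ.erase r := by
  obtain ⟨r, hr, h⟩ := Finset.exists_eq_insert_iff.2 ⟨hs, by omega⟩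
  refine ⟨r, ?_, ?_⟩
  · rw [← h]; simp
  · rw [← h, Finset.erase_insert hr]

theorem eventually_bary_pos {κ F : Finset (E d)} {y : E d} (hy : ∀ p ∈ F, 0 < bary κ p y) :
    ∀ᶠ x in nhds y, ∀ p ∈ F, 0 < bary κ p x := by
  rw [Finset.eventually_all]
  intro p hp
  exact (affine_continuous (bary κ p)).continuousAt.eventually (lt_mem_nhds (hy p hp))

theorem tendsto_add_smul (y v : E d) :
    Filter.Tendsto (fun t : ℝ => y + t • v) (nhdsWithin 0 (Set.Ioi 0)) (nhds y) := by
  have : Continuous fun t : ℝ => y + t • v := by fun_prop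
  have h2 := this.tendsto 0
  simp only [zero_smul, add_zero] at h2
  exact h2.mono_left nhdsWithin_le_nhds

namespace IsSimplex

variable {κ : Finset (E d)} (h : IsSimplex κ)
include h

theorem mem_openHull_erase {r : E d} (hr : r ∈ κ) {x : E d} :
    x ∈ openHull (κ.erase r) ↔ (∀ p ∈ κ.erase r, 0 < bary κ p x) ∧ bary κ r x = 0 := by
  rw [h.mem_openHull_subset (Finset.erase_subset r κ)]
  refine and_congr_right fun _ => ⟨fun h1 => h1 r hr (by simp), fun h1 q hq hq' => ?_⟩
  have : q = r := by
    by_contra hne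
    exact hq' (Finset.mem_erase.2 ⟨hne, hq⟩)
  rw [this, h1]

/-- An affine function vanishing on a face is a multiple of the barycentric coordinate of the
opposite vertex. -/
theorem slope_of_vanish {r : E d} (hr : r ∈ κ) {f : E d →ᵃ[ℝ] ℝ} (hf : ∀ q ∈ κ.erase r, f q = 0) :
    slope f = f r • slope (bary κ r) := by
  rw [h.slope_eq f, ← Finset.add_sum_erase _ _ hr, Finset.sum_eq_zero, add_zero]
  intro q hq
  rw [hf q hq, zero_smul]

/-- The set where two barycentric coordinates vanish has vanishing area. -/
theorem measure_codim_two {p q : E d} (hd : 2 ≤ d) (hp : p ∈ κ) (hq : q ∈ κ) (hpq : p ≠ q) :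
    (μHE[d - 1] : Measure (E d)) {x | bary κ p x = 0 ∧ bary κ q x = 0} = 0 := by
  set U := (Submodule.span ℝ {slope (bary κ p)})ᗮ with hU
  set U' := (Submodule.span ℝ {slope (bary κ q)})ᗮ with hU'
  have hmem : ∀ u : E d, u ∈ U ↔ inner ℝ (slope (bary κ p)) u = 0 := fun u =>
    Submodule.mem_orthogonal_singleton_iff_inner_right
  have hmem' : ∀ u : E d, u ∈ U' ↔ inner ℝ (slope (bary κ q)) u = 0 := fun u =>
    Submodule.mem_orthogonal_singleton_iff_inner_right
  have hrank : Module.finrank ℝ U = d - 1 := by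
    have : Fact (Module.finrank ℝ (E d) = (d - 1) + 1) :=
      ⟨by rw [finrank_euclideanSpace_fin]; omega⟩
    exact Submodule.finrank_orthogonal_span_singleton (h.slope_bary_ne_zero (by omega) hp)
  obtain ⟨t, ht, htpq⟩ : ∃ t ∈ κ, t ∉ ({p, q} : Finset (E d)) := by
    refine Finset.exists_mem_notMem_of_card_lt_card ?_
    rw [h.card]
    exact Finset.card_le_two.trans_lt (by omega)
  simp only [Finset.mem_insert, Finset.mem_singleton, not_or] at htpq
  have hlt : U ⊓ U' < U := by
    refine lt_of_le_of_ne inf_le_left fun heq => ?_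
    have h1 : q - t ∈ U := by
      rw [hmem, ← affine_sub, h.bary_ne hp hq hpq.symm, h.bary_ne hp ht htpq.1, sub_zero]
    rw [← heq] at h1
    have h2 := (hmem' _).1 h1.2
    rw [← affine_sub, h.bary_self hq, h.bary_ne hq ht htpq.2] at h2
    norm_num at h2
  have hfin : (Module.finrank ℝ (U ⊓ U' : Submodule ℝ (E d)) : ℝ) < ((d - 1 : ℕ) : ℝ) := by
    have := Submodule.finrank_lt_finrank_of_lt hlt
    rw [hrank] at this
    exact_mod_cast this
  rcases Set.eq_empty_or_nonempty {x | bary κ p x = 0 ∧ bary κ q x = 0} with h0 | ⟨x0, hx0⟩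
  · rw [h0, measure_empty]
  have hsub : {x | bary κ p x = 0 ∧ bary κ q x = 0} ⊆
      (fun x => x0 + x) '' ((U ⊓ U').subtypeₗᵢ '' Set.univ) := by
    intro x hx
    refine ⟨x - x0, ⟨⟨x - x0, ?_, ?_⟩, trivial, rfl⟩, by simp⟩
    · change x - x0 ∈ U
      rw [hmem, ← affine_sub, hx.1, hx0.1, sub_zero]
    · change x - x0 ∈ U'
      rw [hmem', ← affine_sub, hx.2, hx0.2, sub_zero]
  refine measure_mono_null hsub ?_
  rw [Set.image_add_left, measure_preimage_add,
    (U ⊓ U').subtypeₗᵢ.isometry.euclideanHausdorffMeasure_image,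
    Measure.euclideanHausdorffMeasure_def, Real.hausdorffMeasure_of_finrank_lt hfin]
  simp

end IsSimplex

namespace Mesh

variable {Ω : Set (E d)} (T : Mesh d Ω)

theorem mem_faces {F : Finset (E d)} :
    F ∈ T.faces ↔ ∃ κ ∈ T.cells, ∃ r ∈ κ, F = κ.erase r := by
  simp only [faces, Finset.mem_biUnion, Finset.mem_powersetCard]
  constructor
  · rintro ⟨κ, hκ, hF, hc⟩
    exact ⟨κ, hκ, exists_eq_erase (T.card_eq κ hκ) hc hF⟩
  · rintro ⟨κ, hκ, r, hr, rfl⟩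
    refine ⟨κ, hκ, Finset.erase_subset _ _, ?_⟩
    rw [Finset.card_erase_of_mem hr, T.card_eq κ hκ]; rfl

theorem card_face {F : Finset (E d)} (hF : F ∈ T.faces) : F.card = d := by
  obtain ⟨κ, hκ, r, hr, rfl⟩ := T.mem_faces.1 hF
  rw [Finset.card_erase_of_mem hr, T.card_eq κ hκ]; rfl

theorem face_eq_erase {F κ : Finset (E d)} (hF : F ∈ T.faces) (hκ : κ ∈ T.cells) (hs : F ⊆ κ) :
    ∃ r ∈ κ, F = κ.erase r := exists_eq_erase (T.card_eq κ hκ) (T.card_face hF) hs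

theorem mem_cellsAt {F : Finset (E d)} {κ : T.cells} : κ ∈ T.cellsAt F ↔ F ⊆ κ.1 := by
  simp [cellsAt]

theorem boundaryFaces_subset : T.boundaryFaces ⊆ T.faces := Finset.filter_subset _ _

theorem interiorFaces_subset : T.interiorFaces ⊆ T.faces := Finset.filter_subset _ _

theorem facesIn_subset (Γ : Set (E d)) : T.facesIn Γ ⊆ T.boundaryFaces := Finset.filter_subset _ _

theorem mem_interior_or_boundary {F : Finset (E d)} (hF : F ∈ T.faces) :
    F ∈ T.interiorFaces ∨ F ∈ T.boundaryFaces := by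
  by_cases hb : hull F ⊆ frontier Ω
  · right; exact Finset.mem_filter.2 ⟨hF, hb⟩
  · left; exact Finset.mem_filter.2 ⟨hF, hb⟩

theorem not_mem_boundary_of_interior {F : Finset (E d)} (hF : F ∈ T.interiorFaces) :
    F ∉ T.boundaryFaces := fun h =>
  (Finset.mem_filter.1 hF).2 (Finset.mem_filter.1 h).2

theorem mem_closure_iff {x : E d} : x ∈ closure Ω ↔ ∃ κ ∈ T.cells, x ∈ hull κ := by
  rw [← T.cover]
  simp [hull]

theorem hull_subset_closure {κ : Finset (E d)} (hκ : κ ∈ T.cells) : hull κ ⊆ closure Ω :=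
  fun _ hx => T.mem_closure_iff.2 ⟨κ, hκ, hx⟩

theorem hull_face_subset_closure {F : Finset (E d)} (hF : F ∈ T.faces) : hull F ⊆ closure Ω := by
  obtain ⟨κ, hκ, r, -, rfl⟩ := T.mem_faces.1 hF
  exact (hull_mono (Finset.erase_subset r κ)).trans (T.hull_subset_closure hκ)

/-- A vertex of `κ` whose barycentric coordinate is positive at a point of `κ ∩ κ'` is a vertex of
`κ'`. -/
theorem mem_of_bary_pos {κ κ' : Finset (E d)} (hκ : κ ∈ T.cells) (hκ' : κ' ∈ T.cells) {x : E d}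
    (hx : x ∈ hull κ) (hx' : x ∈ hull κ') {p : E d} (hp : p ∈ κ) (hpos : 0 < bary κ p x) :
    p ∈ κ' := by
  have h1 : x ∈ hull (κ ∩ κ') := by
    have := T.conforming κ hκ κ' hκ'
    rw [hull, Finset.coe_inter, ← this]
    exact ⟨hx, hx'⟩
  have h2 := ((T.isSimplex hκ).mem_hull_subset Finset.inter_subset_left).1 h1
  by_contra hp'
  have := h2.2 p hp (fun h => hp' (Finset.mem_inter.1 h).2)
  linarith

theorem openHull_nonempty {F : Finset (E d)} (hd : 0 < d) (hF : F ∈ T.faces) :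
    (openHull F).Nonempty := by
  have hc := T.card_face hF
  refine ⟨_, fun _ => (d : ℝ)⁻¹, fun p _ => by positivity, ?_, rfl⟩
  rw [Finset.sum_const, hc, nsmul_eq_mul]
  exact mul_inv_cancel₀ (by positivity)

/-- The relative interior of an interior face lies in the domain. -/
theorem openHull_subset_of_interior (hΩ : IsConvexPolytopalDomain Ω) {F : Finset (E d)}
    (hF : F ∈ T.interiorFaces) : openHull F ⊆ Ω := by
  have hFf := T.interiorFaces_subset hF
  obtain ⟨y0, hy0, hy0'⟩ := Set.not_subset.1 (Finset.mem_filter.1 hF).2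
  have hy0Ω : y0 ∈ Ω := by
    by_contra hn
    apply hy0'
    rw [frontier, hΩ.isOpen.interior_eq]
    exact ⟨T.hull_face_subset_closure hFf hy0, hn⟩
  intro y hy
  obtain ⟨κ, hκ, r, hr, rfl⟩ := T.mem_faces.1 hFf
  have hs := T.isSimplex hκ
  have hy2 := (hs.mem_openHull_erase hr).1 hy
  have hy02 := (hs.mem_hull_erase hr).1 hy0
  -- Extend the segment from `y0` to `y` a little beyond `y` within the face; then `y` lies on an
  -- open segment from a point of `Ω` to one of its closure.
  obtain ⟨t, ht, ht0⟩ := (((tendsto_add_smul y (y - y0)).eventually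
    (eventually_bary_pos hy2.1)).and self_mem_nhdsWithin).exists
  have ht0' : (0 : ℝ) < t := ht0
  have hy1 : y + t • (y - y0) ∈ hull (κ.erase r) := by
    refine openHull_subset_hull _ ((hs.mem_openHull_erase hr).2 ⟨ht, ?_⟩)
    rw [affine_add, inner_smul_right, ← affine_sub, hy2.2, hy02.2]; ring
  refine hΩ.openSegment_subset hy0Ω (T.hull_face_subset_closure hFf hy1) ?_
  refine ⟨t / (1 + t), 1 / (1 + t), by positivity, by positivity, by field_simp; ring, ?_⟩
  have : (1 + t) ≠ 0 := by positivity
  match_scalars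
  · field_simp
    ring
  · field_simp

/-- A portion of the boundary of positive area to which the mesh is fitted contains a face. -/
theorem facesIn_nonempty (hd : 2 ≤ d) (hΩ : IsConvexPolytopalDomain Ω) {Γ : Set (E d)}
    (hΓ : Γ ⊆ frontier Ω) (hpos : 0 < (μHE[d - 1] : Measure (E d)) Γ) (hfit : T.IsFitted Γ) :
    (T.facesIn Γ).Nonempty := by
  by_contra hne
  rw [Finset.not_nonempty_iff_eq_empty] at hne
  have hdisj : ∀ F ∈ T.boundaryFaces, Disjoint (openHull F) Γ := by
    intro F hF
    refine (hfit F hF).resolve_left fun hsub => ?_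
    have : F ∈ T.facesIn Γ := Finset.mem_filter.2 ⟨hF, hsub⟩
    rw [hne] at this
    simp at this
  -- If `Γ` missed the relative interiors of all boundary faces, it would be contained in the
  -- union of the faces of codimension two.
  have hsub : Γ ⊆ ⋃ κ ∈ T.cells, ⋃ p ∈ κ, ⋃ q ∈ κ.erase p,
      {x | bary κ p x = 0 ∧ bary κ q x = 0} := by
    intro x hx
    have hxf := hΓ hx
    obtain ⟨κ, hκ, hxκ⟩ := T.mem_closure_iff.1 hxf.1
    have hs := T.isSimplex hκ
    have hxnot : x ∉ Ω := by rw [← hΩ.isOpen.interior_eq]; exact hxf.2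
    have h1 : ∃ p ∈ κ, bary κ p x = 0 := by
      by_contra hcon
      simp only [not_exists, not_and] at hcon
      apply hxnot
      rw [← hΩ.interior_closure]
      refine interior_mono (T.hull_subset_closure hκ) ?_
      rw [hs.interior_hull]
      exact fun p hp => lt_of_le_of_ne (hs.mem_hull.1 hxκ p hp) (Ne.symm (hcon p hp))
    obtain ⟨p, hp, hp0⟩ := h1
    by_cases h2 : ∃ q ∈ κ.erase p, bary κ q x = 0
    · obtain ⟨q, hq, hq0⟩ := h2
      simp only [Set.mem_iUnion]
      exact ⟨κ, hκ, p, hp, q, hq, hp0, hq0⟩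
    · exfalso
      simp only [not_exists, not_and] at h2
      have hxo : x ∈ openHull (κ.erase p) := by
        rw [hs.mem_openHull_erase hp]
        exact ⟨fun q hq => lt_of_le_of_ne (hs.mem_hull.1 hxκ q (Finset.mem_of_mem_erase hq))
          (Ne.symm (h2 q hq)), hp0⟩
      have hF : κ.erase p ∈ T.faces := T.mem_faces.2 ⟨κ, hκ, p, hp, rfl⟩
      rcases T.mem_interior_or_boundary hF with hi | hb
      · exact hxnot (T.openHull_subset_of_interior hΩ hi hxo)
      · exact Set.disjoint_left.1 (hdisj _ hb) hxo hx
  refine hpos.ne' (measure_mono_null hsub ?_)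
  refine (measure_biUnion_null_iff (Finset.countable_toSet _)).2 fun κ hκ => ?_
  refine (measure_biUnion_null_iff (Finset.countable_toSet _)).2 fun p hp => ?_
  refine (measure_biUnion_null_iff (Finset.countable_toSet _)).2 fun q hq => ?_
  rw [Finset.mem_coe, Finset.mem_erase] at hq
  exact (T.isSimplex hκ).measure_codim_two hd hp hq.2 hq.1.symm

end Mesh

/-! ### The elements adjacent to a face -/

section

variable {Ω : Set (E d)} (T : OrientedMesh d Ω)

theorem side_eq (F : Finset (E d)) (κ : T.cells) : side T F κ = 1 ∨ side T F κ = -1 := by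
  unfold side
  split_ifs <;> simp

theorem side_mul_self (F : Finset (E d)) (κ : T.cells) : side T F κ * side T F κ = 1 := by
  rcases side_eq T F κ with h | h <;> rw [h] <;> norm_num

/-- On a face opposite to the vertex `r` of `κ`, the outer unit normal of `κ`, which is
`-∇λ_r / ‖∇λ_r‖`, is `n_F` up to the sign `side`. -/
theorem outer_normal_eq (hd : 0 < d) (κ : T.cells) {r : E d} (hr : r ∈ κ.1) :
    -(‖slope (bary κ.1 r)‖⁻¹ • slope (bary κ.1 r)) =
      side T (κ.1.erase r) κ • T.normal (κ.1.erase r) := by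
  have hs := T.isSimplex κ.2
  set F := κ.1.erase r with hF
  have hFf : F ∈ T.faces := T.mem_faces.2 ⟨κ.1, κ.2, r, hr, rfl⟩
  set n := T.normal F with hn
  set g := slope (bary κ.1 r) with hg
  have hgn : 0 < ‖g‖ := norm_pos_iff.2 (hs.slope_bary_ne_zero hd hr)
  obtain ⟨q0, hq0, hq0r⟩ := hs.exists_ne hd r
  have hq0F : q0 ∈ F := Finset.mem_erase.2 ⟨hq0r, hq0⟩
  -- The affine function `x ↦ n · (x - q₀)` vanishes on the face.
  let f : E d →ᵃ[ℝ] ℝ := ((innerSL ℝ n).toLinearMap.toAffineMap) -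
    AffineMap.const ℝ (E d) (inner ℝ n q0)
  have hf : ∀ x, f x = inner ℝ n (x - q0) := by
    intro x; simp [f, inner_sub_right]
  have hfs : slope f = n := by
    refine ext_inner_right ℝ fun v => ?_
    have := affine_add f q0 v
    rw [hf, hf] at this
    simp at this
    exact this.symm
  have hnr : n = f r • g := by
    rw [← hfs, hg]
    refine hs.slope_of_vanish hr fun q hq => ?_
    rw [hf]
    exact T.normal_orth F hFf q hq q0 hq0F
  have hnorm : |f r| * ‖g‖ = 1 := by
    have := T.normal_norm F hFf
    rw [← hn, hnr, norm_smul] at this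
    exact this
  have hside : side T F κ = if f r ≤ 0 then 1 else -1 := by
    unfold side
    refine if_congr ?_ rfl rfl
    constructor
    · intro h1; rw [hf]; exact h1 r hr q0 hq0F
    · intro h1 p hp q hq
      by_cases hpr : p = r
      · have h2 : inner ℝ n (q - q0) = 0 := T.normal_orth F hFf q hq q0 hq0F
        rw [hpr, show r - q = (r - q0) - (q - q0) by abel, inner_sub_right, h2, ← hf]
        linarith
      · exact (T.normal_orth F hFf p (Finset.mem_erase.2 ⟨hpr, hp⟩) q hq).le
  rw [hside, hnr]
  split_ifs with h1
  · rw [abs_of_nonpos h1] at hnorm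
    have : f r = -‖g‖⁻¹ := by field_simp; linarith
    rw [this]; module
  · rw [abs_of_pos (not_le.1 h1)] at hnorm
    have : f r = ‖g‖⁻¹ := by field_simp; linarith
    rw [this]; module

theorem normal_eq (hd : 0 < d) (κ : T.cells) {r : E d} (hr : r ∈ κ.1) :
    T.normal (κ.1.erase r) =
      (-(side T (κ.1.erase r) κ * ‖slope (bary κ.1 r)‖⁻¹)) • slope (bary κ.1 r) := by
  have h := congrArg (fun v => side T (κ.1.erase r) κ • v) (outer_normal_eq T hd κ hr)
  simp only [smul_smul, side_mul_self, one_smul] at h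
  rw [← h]
  module

theorem inner_slope_normal (hd : 0 < d) (κ : T.cells) {r : E d} (hr : r ∈ κ.1) :
    inner ℝ (slope (bary κ.1 r)) (T.normal (κ.1.erase r)) =
      -(side T (κ.1.erase r) κ * ‖slope (bary κ.1 r)‖) := by
  have hgn : ‖slope (bary κ.1 r)‖ ≠ 0 :=
    norm_ne_zero_iff.2 ((T.isSimplex κ.2).slope_bary_ne_zero hd hr)
  rw [normal_eq T hd κ hr, inner_smul_right, real_inner_self_eq_norm_sq]
  field_simp

/-- There is at most one element on each side of a face. -/
theorem cell_unique (hd : 0 < d) {F : Finset (E d)} (hF : F ∈ T.faces) {κ κ' : T.cells}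
    (hκ : F ⊆ κ.1) (hκ' : F ⊆ κ'.1) (hside : side T F κ = side T F κ') : κ = κ' := by
  obtain ⟨y, hy⟩ := T.openHull_nonempty hd hF
  -- A point slightly off the relative interior of `F` lies in the interior of each element on
  -- that side.
  have key : ∀ κ : T.cells, F ⊆ κ.1 → ∀ᶠ t in nhdsWithin (0 : ℝ) (Set.Ioi 0),
      ∀ p ∈ κ.1, 0 < bary κ.1 p (y + t • (-(side T F κ) • T.normal F)) := by
    intro κ hκ
    have hs := T.isSimplex κ.2
    obtain ⟨r, hr, hFr⟩ := T.face_eq_erase hF κ.2 hκ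
    have hy' := hy
    rw [hFr] at hy'
    have hy2 := (hs.mem_openHull_erase hr).1 hy'
    have hgn : 0 < ‖slope (bary κ.1 r)‖ := norm_pos_iff.2 (hs.slope_bary_ne_zero hd hr)
    filter_upwards [(tendsto_add_smul y (-(side T F κ) • T.normal F)).eventually
      (eventually_bary_pos hy2.1), self_mem_nhdsWithin] with t ht ht0 p hp
    have ht0' : 0 < t := ht0
    by_cases hpr : p = r
    · rw [hpr, affine_add, hy2.2, inner_smul_right, inner_smul_right, hFr,
        inner_slope_normal T hd κ hr]
      have := side_mul_self T (κ.1.erase r) κ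
      have : t * (-side T (κ.1.erase r) κ * -(side T (κ.1.erase r) κ * ‖slope (bary κ.1 r)‖)) =
        t * ‖slope (bary κ.1 r)‖ := by
        linear_combination t * ‖slope (bary κ.1 r)‖ * this
      rw [this]; positivity
    · exact ht p (Finset.mem_erase.2 ⟨hpr, hp⟩)
  obtain ⟨t, ht, ht'⟩ := ((key κ hκ).and (key κ' hκ')).exists
  rw [← hside] at ht'
  have hx : _ ∈ hull κ.1 := (T.isSimplex κ.2).mem_hull.2 fun p hp => (ht p hp).le
  have hx' : _ ∈ hull κ'.1 := (T.isSimplex κ'.2).mem_hull.2 fun p hp => (ht' p hp).le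
  have hsub : κ.1 ⊆ κ'.1 := fun p hp => T.mem_of_bary_pos κ.2 κ'.2 hx hx' hp (ht p hp)
  exact Subtype.ext (Finset.eq_of_subset_of_card_le hsub
    (by rw [T.card_eq _ κ.2, T.card_eq _ κ'.2]))

theorem side_of_boundary {F : Finset (E d)} (hF : F ∈ T.boundaryFaces) {κ : T.cells}
    (hκ : F ⊆ κ.1) : side T F κ = 1 := by
  unfold side
  rw [if_pos]
  exact fun p hp q hq => T.normal_outward F hF κ.1 κ.2 hκ p hp q hq

theorem exists_cell {F : Finset (E d)} (hF : F ∈ T.faces) : ∃ κ : T.cells, F ⊆ κ.1 := by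
  obtain ⟨κ, hκ, r, hr, rfl⟩ := T.mem_faces.1 hF
  exact ⟨⟨κ, hκ⟩, Finset.erase_subset _ _⟩

theorem cellsAt_boundary (hd : 0 < d) {F : Finset (E d)} (hF : F ∈ T.boundaryFaces) :
    ∃ κ : T.cells, T.cellsAt F = {κ} ∧ side T F κ = 1 := by
  have hFf := T.boundaryFaces_subset hF
  obtain ⟨κ, hκ⟩ := exists_cell T hFf
  refine ⟨κ, ?_, side_of_boundary T hF hκ⟩
  ext κ'
  rw [T.mem_cellsAt, Finset.mem_singleton]
  constructor
  · intro h
    exact cell_unique T hd hFf h hκ (by rw [side_of_boundary T hF hκ, side_of_boundary T hF h])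
  · rintro rfl; exact hκ

/-- Elements lie on both sides of an interior face. -/
theorem exists_cell_side (hd : 0 < d) (hΩ : IsConvexPolytopalDomain Ω) {F : Finset (E d)}
    (hF : F ∈ T.interiorFaces) {s : ℝ} (hs : s = 1 ∨ s = -1) :
    ∃ κ : T.cells, F ⊆ κ.1 ∧ side T F κ = s := by
  have hFf := T.interiorFaces_subset hF
  obtain ⟨y, hy⟩ := T.openHull_nonempty hd hFf
  have hyΩ := T.openHull_subset_of_interior hΩ hF hy
  have htend := tendsto_add_smul y (-s • T.normal F)
  have h1 : ∀ᶠ t in nhdsWithin (0 : ℝ) (Set.Ioi 0), ∃ κ : T.cells,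
      y + t • (-s • T.normal F) ∈ hull κ.1 := by
    filter_upwards [htend.eventually (hΩ.isOpen.mem_nhds hyΩ)] with t ht
    obtain ⟨κ, hκ, h⟩ := T.mem_closure_iff.1 (subset_closure ht)
    exact ⟨⟨κ, hκ⟩, h⟩
  -- There are finitely many elements, so one of them contains points arbitrarily close to `y` on
  -- the required side.
  obtain ⟨κ, hκ⟩ := Filter.frequently_exists.1 h1.frequently
  have hyκ : y ∈ hull κ.1 :=
    (isCompact_hull κ.1).isClosed.mem_of_frequently_of_tendsto hκ htend
  obtain ⟨κ0, hκ0⟩ := exists_cell T hFf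
  obtain ⟨r0, hr0, hFr0⟩ := T.face_eq_erase hFf κ0.2 hκ0
  have hFκ : F ⊆ κ.1 := by
    intro p hp
    refine T.mem_of_bary_pos κ0.2 κ.2 (hull_mono hκ0 (openHull_subset_hull F hy)) hyκ (hκ0 hp) ?_
    exact (((T.isSimplex κ0.2).mem_openHull_subset hκ0).1 hy).1 p hp
  refine ⟨κ, hFκ, ?_⟩
  obtain ⟨r, hr, hFr⟩ := T.face_eq_erase hFf κ.2 hFκ
  obtain ⟨t, ht, ht0⟩ := (hκ.and_eventually self_mem_nhdsWithin).exists
  have ht0' : 0 < t := ht0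
  have h2 := (T.isSimplex κ.2).mem_hull.1 ht r hr
  have hy' := hy
  rw [hFr] at hy'
  have hgn : 0 < ‖slope (bary κ.1 r)‖ :=
    norm_pos_iff.2 ((T.isSimplex κ.2).slope_bary_ne_zero hd hr)
  rw [affine_add, (((T.isSimplex κ.2).mem_openHull_erase hr).1 hy').2, inner_smul_right,
    inner_smul_right, hFr, inner_slope_normal T hd κ hr, ← hFr] at h2
  have h3 : 0 ≤ s * side T F κ := by
    by_contra hneg
    have : t * ‖slope (bary κ.1 r)‖ * (s * side T F κ) < 0 :=
      mul_neg_of_pos_of_neg (by positivity) (not_le.1 hneg)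
    linarith
  rcases hs with rfl | rfl <;> rcases side_eq T F κ with h | h <;> rw [h] at h3 ⊢ <;> norm_num at h3

theorem cellsAt_interior (hd : 0 < d) (hΩ : IsConvexPolytopalDomain Ω) {F : Finset (E d)}
    (hF : F ∈ T.interiorFaces) :
    ∃ κ₁ κ₂ : T.cells, κ₁ ≠ κ₂ ∧ T.cellsAt F = {κ₁, κ₂} ∧ side T F κ₁ = 1 ∧ side T F κ₂ = -1 := by
  have hFf := T.interiorFaces_subset hF
  obtain ⟨κ₁, h₁, hs₁⟩ := exists_cell_side T hd hΩ hF (Or.inl rfl)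
  obtain ⟨κ₂, h₂, hs₂⟩ := exists_cell_side T hd hΩ hF (Or.inr rfl)
  refine ⟨κ₁, κ₂, ?_, ?_, hs₁, hs₂⟩
  · rintro rfl
    rw [hs₁] at hs₂
    norm_num at hs₂
  · ext κ
    rw [T.mem_cellsAt, Finset.mem_insert, Finset.mem_singleton]
    constructor
    · intro h
      rcases side_eq T F κ with h' | h'
      · exact Or.inl (cell_unique T hd hFf h h₁ (by rw [h', hs₁]))
      · exact Or.inr (cell_unique T hd hFf h h₂ (by rw [h', hs₂]))
    · rintro (rfl | rfl)
      exacts [h₁, h₂]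

end

/-! ### Piecewise constant functions along segments -/

section

section Line

variable {ι : Type*} (s : Finset ι)

/-- On the line with barycentric coordinates `a i + t * b i`, the unit segment `0 ≤ t ≤ 1` meets
the face opposite to the vertex `i`. -/
def LineCross (a b : ι → ℝ) (i : ι) : Prop :=
  ∃ t ∈ Set.Icc (0 : ℝ) 1, a i + t * b i = 0 ∧ ∀ j ∈ s, 0 ≤ a j + t * b j

/-- The part `0 ≤ t ≤ 1` of the line with barycentric coordinates `a i + t * b i` meets the
simplex. -/
def LineMeets (a b : ι → ℝ) : Prop :=
  ∃ t ∈ Set.Icc (0 : ℝ) 1, ∀ j ∈ s, 0 ≤ a j + t * b j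

variable {s}

/-- A segment in general position that meets a simplex without starting in it enters through
exactly one face. -/
theorem sum_line_enter {a b : ι → ℝ} (ha : ∀ i ∈ s, a i ≠ 0)
    (hgen : ∀ i ∈ s, ∀ j ∈ s, i ≠ j → ∀ t, ¬(a i + t * b i = 0 ∧ a j + t * b j = 0)) :
    ∑ i ∈ s, (if 0 < b i ∧ LineCross s a b i then (1 : ℝ) else 0) =
      (if LineMeets s a b then 1 else 0) - (if ∀ i ∈ s, 0 ≤ a i then 1 else 0) := by
  by_cases h0 : ∀ i ∈ s, 0 ≤ a i
  · have hm : LineMeets s a b := ⟨0, by simp, fun j hj => by simpa using h0 j hj⟩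
    rw [if_pos hm, if_pos h0, sub_self]
    refine Finset.sum_eq_zero fun i hi => if_neg ?_
    rintro ⟨hb, t, ht, h1, -⟩
    have := mul_nonneg ht.1 hb.le
    have h2 : 0 < a i := lt_of_le_of_ne (h0 i hi) (ha i hi).symm
    linarith
  · rw [if_neg h0, sub_zero]
    by_cases hm : LineMeets s a b
    · rw [if_pos hm]
      obtain ⟨t0, ht0, hm0⟩ := hm
      -- The entry point is the last root of the coordinates that are negative at the start.
      set N := s.filter fun i => a i < 0 with hN
      have hNne : N.Nonempty := by
        simp only [not_forall, not_le] at h0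
        obtain ⟨i, hi, hai⟩ := h0
        exact ⟨i, Finset.mem_filter.2 ⟨hi, hai⟩⟩
      have hbpos : ∀ i ∈ N, 0 < b i := by
        intro i hi
        obtain ⟨hi1, hi2⟩ := Finset.mem_filter.1 hi
        have h1 := hm0 i hi1
        by_contra hb
        have := mul_nonneg ht0.1 (sub_nonneg.2 (not_lt.1 hb))
        nlinarith
      obtain ⟨p, hpN, hpmax⟩ := N.exists_max_image (fun i => -a i / b i) hNne
      obtain ⟨hp, hap⟩ := Finset.mem_filter.1 hpN
      have hbp := hbpos p hpN
      set T := -a p / b p with hT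
      have hT0 : 0 < T := div_pos (by linarith) hbp
      have hTb : T * b p = -a p := div_mul_cancel₀ _ hbp.ne'
      have hTt0 : T ≤ t0 := by
        rw [hT, div_le_iff₀ hbp]
        have := hm0 p hp
        linarith
      have hcross : LineCross s a b p := by
        refine ⟨T, ⟨hT0.le, hTt0.trans ht0.2⟩, by linarith, fun j hj => ?_⟩
        by_cases haj : a j < 0
        · have hjN : j ∈ N := Finset.mem_filter.2 ⟨hj, haj⟩
          have h1 := hpmax j hjN
          rw [div_le_iff₀ (hbpos j hjN)] at h1
          linarith
        · have h1 := hm0 j hj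
          have h2 := not_lt.1 haj
          by_cases hbj : 0 ≤ b j
          · have := mul_nonneg hT0.le hbj
            linarith
          · have := mul_le_mul_of_nonpos_right hTt0 (not_le.1 hbj).le
            linarith
      rw [Finset.sum_eq_single p, if_pos ⟨hbp, hcross⟩]
      · intro q hq hqp
        refine if_neg ?_
        rintro ⟨hbq, t, ht, htq, htall⟩
        have h1 : T ≤ t := by
          have := htall p hp
          rw [hT, div_le_iff₀ hbp]; linarith
        obtain ⟨t', ht', htp', htall'⟩ := hcross
        have h2 : t' = T := by
          have : t' * b p = T * b p := by linarith
          exact mul_right_cancel₀ hbp.ne' this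
        have h3 := htall' q hq
        rw [h2] at h3
        have h4 : t ≤ T := by
          by_contra hlt
          have := mul_lt_mul_of_pos_right (not_le.1 hlt) hbq
          linarith
        have h5 : t = T := le_antisymm h4 h1
        exact hgen q hq p hp hqp T ⟨by rw [← h5]; exact htq, by linarith⟩
      · exact fun h => absurd hp h
    · rw [if_neg hm]
      refine Finset.sum_eq_zero fun i hi => if_neg ?_
      rintro ⟨-, t, ht, -, h2⟩
      exact hm ⟨t, ht, h2⟩

/-- The change of the indicator function of a simplex along a segment in general position is the
signed number of the faces that are crossed. -/
theorem sum_line_sign {a b : ι → ℝ} (ha : ∀ i ∈ s, a i ≠ 0) (hab : ∀ i ∈ s, a i + b i ≠ 0)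
    (hgen : ∀ i ∈ s, ∀ j ∈ s, i ≠ j → ∀ t, ¬(a i + t * b i = 0 ∧ a j + t * b j = 0)) :
    ((if ∀ i ∈ s, 0 ≤ a i + b i then (1 : ℝ) else 0) - if ∀ i ∈ s, 0 ≤ a i then 1 else 0) =
      ∑ i ∈ s, ((SignType.sign (b i) : SignType) : ℝ) * (if LineCross s a b i then 1 else 0) := by
  have h1 := sum_line_enter ha hgen
  -- The exits are the entries of the reversed segment.
  have h2 := sum_line_enter (s := s) (a := fun i => a i + b i) (b := fun i => -b i) hab (by
    intro i hi j hj hij t ht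
    exact hgen i hi j hj hij (1 - t) ⟨by linarith [ht.1], by linarith [ht.2]⟩)
  have hrev : ∀ t : ℝ, t ∈ Set.Icc (0 : ℝ) 1 ↔ 1 - t ∈ Set.Icc (0 : ℝ) 1 := by
    intro t
    simp only [Set.mem_Icc]
    constructor <;> rintro ⟨h, h'⟩ <;> constructor <;> linarith
  have hval : ∀ t i, a i + b i + t * -b i = a i + (1 - t) * b i := fun t i => by ring
  have hm : LineMeets s (fun i => a i + b i) (fun i => -b i) ↔ LineMeets s a b := by
    unfold LineMeets
    constructor
    · rintro ⟨t, ht, h⟩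
      exact ⟨1 - t, (hrev t).1 ht, fun j hj => by rw [← hval]; exact h j hj⟩
    · rintro ⟨t, ht, h⟩
      refine ⟨1 - t, (hrev t).1 ht, fun j hj => ?_⟩
      simp only [hval, sub_sub_cancel]; exact h j hj
  have hc : ∀ i, LineCross s (fun i => a i + b i) (fun i => -b i) i ↔ LineCross s a b i := by
    intro i
    unfold LineCross
    constructor
    · rintro ⟨t, ht, h0, h⟩
      exact ⟨1 - t, (hrev t).1 ht, by rw [← hval]; exact h0, fun j hj => by rw [← hval]; exact h j hj⟩
    · rintro ⟨t, ht, h0, h⟩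
      refine ⟨1 - t, (hrev t).1 ht, ?_, fun j hj => ?_⟩
      · simp only [hval, sub_sub_cancel]; exact h0
      · simp only [hval, sub_sub_cancel]; exact h j hj
  simp only [hm, hc] at h2
  have h3 : ∀ i ∈ s, ((SignType.sign (b i) : SignType) : ℝ) * (if LineCross s a b i then 1 else 0) =
      (if 0 < b i ∧ LineCross s a b i then (1 : ℝ) else 0) -
        (if 0 < -b i ∧ LineCross s a b i then (1 : ℝ) else 0) := by
    intro i _
    rcases lt_trichotomy (b i) 0 with hb | hb | hb
    · have : ¬ 0 < b i := by linarith
      have h' : 0 < -b i := by linarith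
      by_cases hcr : LineCross s a b i <;> simp [hcr, this, h', sign_neg hb]
    · simp [hb]
    · have : ¬ 0 < -b i := by linarith
      by_cases hcr : LineCross s a b i <;> simp [hcr, hb, sign_pos hb, this]
  rw [Finset.sum_congr rfl h3, Finset.sum_sub_distrib, h1, h2]
  ring

end Line

/-- The segment from `x` to `x + z` meets the face `F`. -/
def Crosses (F : Finset (E d)) (x z : E d) : Prop :=
  ∃ t ∈ Set.Icc (0 : ℝ) 1, x + t • z ∈ hull F

theorem volume_affine_zero {f : E d →ᵃ[ℝ] ℝ} {y : E d} (hy : f y ≠ 0) :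
    (volume : Measure (E d)) {x | f x = 0} = 0 := by
  have h : {x | f x = 0} = ((AffineSubspace.mk' (0 : ℝ) ⊥).comap f : Set (E d)) := by
    ext x
    simp [AffineSubspace.mem_mk']
  rw [h]
  refine Measure.addHaar_affineSubspace _ _ fun htop => ?_
  have : y ∈ (AffineSubspace.mk' (0 : ℝ) ⊥).comap f := by rw [htop]; trivial
  simp [AffineSubspace.mem_mk'] at this
  exact hy this

theorem ae_affine_ne_zero {f : E d →ᵃ[ℝ] ℝ} {y : E d} (hy : f y ≠ 0) :
    ∀ᵐ x : E d, f x ≠ 0 := by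
  rw [ae_iff]
  simpa using volume_affine_zero hy

theorem ae_affine_add_ne_zero {f : E d →ᵃ[ℝ] ℝ} {y : E d} (hy : f y ≠ 0) (z : E d) :
    ∀ᵐ x : E d, f (x + z) ≠ 0 :=
  (measurePreserving_add_right (volume : Measure (E d)) z).quasiMeasurePreserving.ae
    (ae_affine_ne_zero hy)

namespace IsSimplex

variable {κ : Finset (E d)} (h : IsSimplex κ)
include h

/-- For almost every `x`, the segment from `x` to `x + z` is in general position: its end points
lie on no face hyperplane, and it never meets two of these hyperplanes at once. -/
theorem ae_generic (z : E d) : ∀ᵐ x : E d, (∀ p ∈ κ, bary κ p x ≠ 0) ∧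
    (∀ p ∈ κ, bary κ p x + inner ℝ (slope (bary κ p)) z ≠ 0) ∧
    ∀ p ∈ κ, ∀ q ∈ κ, p ≠ q → ∀ t : ℝ, ¬(bary κ p x + t * inner ℝ (slope (bary κ p)) z = 0 ∧
      bary κ q x + t * inner ℝ (slope (bary κ q)) z = 0) := by
  have h1 : ∀ p ∈ κ, bary κ p p ≠ 0 := fun p hp => by rw [h.bary_self hp]; exact one_ne_zero
  have A1 : ∀ᵐ x : E d, ∀ p ∈ κ, bary κ p x ≠ 0 :=
    (Finset.eventually_all κ).2 fun p hp => ae_affine_ne_zero (h1 p hp)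
  have A2 : ∀ᵐ x : E d, ∀ p ∈ κ, bary κ p (x + z) ≠ 0 :=
    (Finset.eventually_all κ).2 fun p hp => ae_affine_add_ne_zero (h1 p hp) z
  have A3 : ∀ᵐ x : E d, ∀ p ∈ κ, ∀ q ∈ κ, p ≠ q →
      (inner ℝ (slope (bary κ p)) z ≠ 0 ∨ inner ℝ (slope (bary κ q)) z ≠ 0) →
      inner ℝ (slope (bary κ q)) z * bary κ p x - inner ℝ (slope (bary κ p)) z * bary κ q x ≠ 0 := by
    refine (Finset.eventually_all κ).2 fun p hp => (Finset.eventually_all κ).2 fun q hq => ?_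
    by_cases hpq : p ≠ q
    swap
    · exact Filter.Eventually.of_forall fun x hne => absurd hne hpq
    by_cases hor : inner ℝ (slope (bary κ p)) z ≠ 0 ∨ inner ℝ (slope (bary κ q)) z ≠ 0
    swap
    · exact Filter.Eventually.of_forall fun x _ hne => absurd hne hor
    set f : E d →ᵃ[ℝ] ℝ := (inner ℝ (slope (bary κ q)) z : ℝ) • bary κ p -
      (inner ℝ (slope (bary κ p)) z : ℝ) • bary κ q with hf
    have hfx : ∀ x, f x = inner ℝ (slope (bary κ q)) z * bary κ p x -
        inner ℝ (slope (bary κ p)) z * bary κ q x := fun x => by simp [hf]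
    have hex : ∃ y, f y ≠ 0 := by
      rcases hor with hor | hor
      · refine ⟨q, ?_⟩
        rw [hfx, h.bary_self hq, h.bary_ne hp hq hpq.symm]
        simpa using hor
      · refine ⟨p, ?_⟩
        rw [hfx, h.bary_self hp, h.bary_ne hq hp hpq]
        simpa using hor
    obtain ⟨y, hy⟩ := hex
    filter_upwards [ae_affine_ne_zero hy] with x hx _ _
    rwa [hfx] at hx
  filter_upwards [A1, A2, A3] with x hx1 hx2 hx3
  refine ⟨hx1, fun p hp => by rw [← affine_add]; exact hx2 p hp, fun p hp q hq hpq t ht => ?_⟩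
  by_cases hor : inner ℝ (slope (bary κ p)) z ≠ 0 ∨ inner ℝ (slope (bary κ q)) z ≠ 0
  · apply hx3 p hp q hq hpq hor
    linear_combination (inner ℝ (slope (bary κ q)) z : ℝ) * ht.1 -
      (inner ℝ (slope (bary κ p)) z : ℝ) * ht.2
  · simp only [not_or, not_not] at hor
    apply hx1 p hp
    have := ht.1
    rw [hor.1] at this
    linarith

theorem crosses_iff {r : E d} (hr : r ∈ κ) (x z : E d) :
    Crosses (κ.erase r) x z ↔ LineCross κ (fun p => bary κ p x)
      (fun p => inner ℝ (slope (bary κ p)) z) r := by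
  unfold Crosses LineCross
  refine exists_congr fun t => and_congr_right fun _ => ?_
  rw [h.mem_hull_erase hr, and_comm]
  simp only [affine_add, inner_smul_right]

/-- Signed crossing formula: the indicator function of a simplex changes along almost every
segment by the signed number of crossed faces. -/
theorem ae_indicator_sub (z : E d) : ∀ᵐ x : E d,
    (hull κ).indicator (fun _ => (1 : ℝ)) (x + z) - (hull κ).indicator (fun _ => (1 : ℝ)) x =
      ∑ p ∈ κ, ((SignType.sign (inner ℝ (slope (bary κ p)) z : ℝ) : SignType) : ℝ) *
        (if Crosses (κ.erase p) x z then 1 else 0) := by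
  filter_upwards [h.ae_generic z] with x hx
  have := sum_line_sign (s := κ) (a := fun p => bary κ p x)
    (b := fun p => inner ℝ (slope (bary κ p)) z) hx.1 hx.2.1 hx.2.2
  have h1 : ∀ y, (hull κ).indicator (fun _ => (1 : ℝ)) y =
      if ∀ p ∈ κ, 0 ≤ bary κ p y then 1 else 0 := by
    intro y
    rw [Set.indicator_apply]
    exact if_congr h.mem_hull rfl rfl
  rw [h1, h1]
  simp only [affine_add]
  rw [this]
  refine Finset.sum_congr rfl fun p hp => ?_
  rw [if_congr (h.crosses_iff hp x z) rfl rfl]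

end IsSimplex

variable {Ω : Set (E d)}

/-- Rearranges a sum over the faces of all elements into a sum over all faces. -/
theorem Mesh.sum_faces (T : Mesh d Ω) (φ : T.cells → Finset (E d) → ℝ) :
    ∑ κ : T.cells, ∑ r ∈ κ.1, φ κ (κ.1.erase r) = ∑ F ∈ T.faces, ∑ κ ∈ T.cellsAt F, φ κ F := by
  have h1 : ∀ κ : T.cells, ∑ r ∈ κ.1, φ κ (κ.1.erase r) =
      ∑ F ∈ T.faces.filter (fun F => F ⊆ κ.1), φ κ F := by
    intro κ
    refine Finset.sum_bij (fun r _ => κ.1.erase r) ?_ ?_ ?_ ?_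
    · intro r hr
      exact Finset.mem_filter.2 ⟨T.mem_faces.2 ⟨κ.1, κ.2, r, hr, rfl⟩, Finset.erase_subset _ _⟩
    · intro r hr r' hr' heq
      exact (Finset.erase_inj _ hr).1 heq
    · intro F hF
      obtain ⟨hF, hs⟩ := Finset.mem_filter.1 hF
      obtain ⟨r, hr, rfl⟩ := T.face_eq_erase hF κ.2 hs
      exact ⟨r, hr, rfl⟩
    · intros; rfl
  simp_rw [h1]
  refine Finset.sum_comm' fun κ F => ?_
  simp only [Finset.mem_univ, true_and, Finset.mem_filter, T.mem_cellsAt]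
  tauto

/-- The piecewise constant function with the value `g κ` on the element `κ`, extended by zero. -/
def pwConst (T : Mesh d Ω) (g : T.cells → ℝ) (x : E d) : ℝ :=
  ∑ κ : T.cells, g κ * (hull κ.1).indicator (fun _ => (1 : ℝ)) x

/-- The signed jump of a piecewise constant function across a face (its value on boundary faces).
-/
def jumpConst (T : OrientedMesh d Ω) (g : T.cells → ℝ) (F : Finset (E d)) : ℝ :=
  ∑ κ ∈ T.cellsAt F, side T F κ * g κ

/-- Along almost every segment, a piecewise constant function varies by at most the sum of its
jumps across the crossed faces. -/
theorem ae_pwConst_sub_le (hd : 0 < d) (T : OrientedMesh d Ω) (g : T.cells → ℝ) (z : E d) :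
    ∀ᵐ x : E d, |pwConst T.toMesh g (x + z) - pwConst T.toMesh g x| ≤
      ∑ F ∈ T.faces, if Crosses F x z then |jumpConst T g F| else 0 := by
  have hae : ∀ᵐ x : E d, ∀ κ : T.cells, (hull κ.1).indicator (fun _ => (1 : ℝ)) (x + z) -
      (hull κ.1).indicator (fun _ => (1 : ℝ)) x =
      ∑ p ∈ κ.1, ((SignType.sign (inner ℝ (slope (bary κ.1 p)) z : ℝ) : SignType) : ℝ) *
        (if Crosses (κ.1.erase p) x z then 1 else 0) :=
    Filter.eventually_all.2 fun κ => (T.isSimplex κ.2).ae_indicator_sub z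
  filter_upwards [hae] with x hx
  have hsign : ∀ κ : T.cells, ∀ p ∈ κ.1,
      ((SignType.sign (inner ℝ (slope (bary κ.1 p)) z : ℝ) : SignType) : ℝ) =
      -side T (κ.1.erase p) κ *
        ((SignType.sign (inner ℝ (T.normal (κ.1.erase p)) z : ℝ) : SignType) : ℝ) := by
    intro κ p hp
    have hg : 0 < ‖slope (bary κ.1 p)‖⁻¹ :=
      inv_pos.2 (norm_pos_iff.2 ((T.isSimplex κ.2).slope_bary_ne_zero hd hp))
    rw [normal_eq T hd κ hp, real_inner_smul_left, sign_mul]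
    rcases side_eq T (κ.1.erase p) κ with hs | hs <;> rw [hs] <;> simp [Left.sign_neg, sign_pos hg]
  have h1 : pwConst T.toMesh g (x + z) - pwConst T.toMesh g x =
      ∑ F ∈ T.faces, -((SignType.sign (inner ℝ (T.normal F) z : ℝ) : SignType) : ℝ) *
        (if Crosses F x z then 1 else 0) * jumpConst T g F := by
    unfold pwConst
    rw [← Finset.sum_sub_distrib]
    simp_rw [← mul_sub, hx, Finset.mul_sum]
    have h2 := T.sum_faces fun κ F => g κ * (-side T F κ *
        ((SignType.sign (inner ℝ (T.normal F) z : ℝ) : SignType) : ℝ) *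
        (if Crosses F x z then 1 else 0))
    rw [Finset.sum_congr rfl fun κ _ => Finset.sum_congr rfl fun p hp => by
      rw [hsign κ p hp], h2]
    refine Finset.sum_congr rfl fun F _ => ?_
    rw [jumpConst, Finset.mul_sum]
    refine Finset.sum_congr rfl fun κ _ => ?_
    ring
  rw [h1]
  refine (Finset.abs_sum_le_sum_abs _ _).trans (Finset.sum_le_sum fun F _ => ?_)
  split_ifs
  · rw [abs_mul, mul_one, abs_neg]
    refine mul_le_of_le_one_left (abs_nonneg _) ?_
    rcases SignType.sign (inner ℝ (T.normal F) z : ℝ) with _ | _ | _ <;> simp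
  · simp

end

/-! ### Translations out of the domain -/

section

variable {Ω : Set (E d)}

theorem Mesh.cells_nonempty (T : Mesh d Ω) (hΩ : IsConvexPolytopalDomain Ω) :
    Nonempty T.cells := by
  obtain ⟨x, hx⟩ := hΩ.1
  obtain ⟨κ, hκ, -⟩ := T.mem_closure_iff.1 (subset_closure hx)
  exact ⟨⟨κ, hκ⟩⟩

theorem Mesh.size_le_h (T : Mesh d Ω) (κ : T.cells) : size κ.1 ≤ T.h :=
  le_ciSup (f := fun κ : T.cells => size κ.1) (Set.finite_range _).bddAbove κ

theorem IsSimplex.size_pos {κ : Finset (E d)} (h : IsSimplex κ) (hd : 0 < d) : 0 < size κ := by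
  have : 1 < κ.card := by rw [h.card]; omega
  obtain ⟨p, hp, q, hq, hpq⟩ := Finset.one_lt_card.1 this
  exact (norm_pos_iff.2 (sub_ne_zero.2 hpq)).trans_le
    (norm_sub_le_size (subset_hull hp) (subset_hull hq))

theorem Mesh.h_pos (T : Mesh d Ω) (hd : 0 < d) (hΩ : IsConvexPolytopalDomain Ω) : 0 < T.h := by
  obtain ⟨κ⟩ := T.cells_nonempty hΩ
  exact ((T.isSimplex κ.2).size_pos hd).trans_le (T.size_le_h κ)

theorem Mesh.h_le_diam (T : Mesh d Ω) (hΩ : IsConvexPolytopalDomain Ω) :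
    T.h ≤ Metric.diam (closure Ω) := by
  have := T.cells_nonempty hΩ
  exact ciSup_le fun κ => Metric.diam_mono (T.hull_subset_closure κ.2) hΩ.isBounded.closure

theorem Mesh.size_face_le_h (T : Mesh d Ω) {F : Finset (E d)} (hF : F ∈ T.faces) :
    size F ≤ T.h := by
  obtain ⟨κ, hκ, r, -, rfl⟩ := T.mem_faces.1 hF
  exact (size_mono (Finset.erase_subset r κ)).trans (T.size_le_h ⟨κ, hκ⟩)

/-- The volume of the Euclidean unit ball. -/
def unitBallVol (d : ℕ) : ℝ := (volume : Measure (E d)).real (Metric.ball 0 1)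

theorem unitBallVol_pos : 0 < unitBallVol d :=
  ENNReal.toReal_pos (Metric.measure_ball_pos _ _ one_pos).ne' measure_ball_lt_top.ne

theorem volume_closedBall' (x : E d) {r : ℝ} (hr : 0 ≤ r) :
    (volume : Measure (E d)) (Metric.closedBall x r) = ENNReal.ofReal (r ^ d * unitBallVol d) := by
  rw [Measure.addHaar_closedBall _ _ hr, finrank_euclideanSpace_fin,
    ENNReal.ofReal_mul (by positivity), unitBallVol, Measure.real,
    ENNReal.ofReal_toReal measure_ball_lt_top.ne]

theorem isClosed_crosses (F : Finset (E d)) (z : E d) : IsClosed {x | Crosses F x z} := by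
  have : {x | Crosses F x z} =
      (fun y : E d × ℝ => y.1 - y.2 • z) '' (hull F ×ˢ Set.Icc (0 : ℝ) 1) := by
    ext x
    constructor
    · rintro ⟨t, ht, hx⟩
      exact ⟨(x + t • z, t), ⟨hx, ht⟩, by simp⟩
    · rintro ⟨⟨y, t⟩, ⟨hy, ht⟩, rfl⟩
      exact ⟨t, ht, by simpa using hy⟩
  rw [this]
  exact (((isCompact_hull F).prod isCompact_Icc).image (by fun_prop)).isClosed

/-- The volume of the set of starting points from which a translation by `z` crosses a given set of
diameter at most `h`: it is covered by balls of radius `2h` along a segment. -/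
theorem volume_crosses_le (hd : 0 < d) (F : Finset (E d)) (z : E d) {h : ℝ} (hh : 0 < h)
    (hF : size F ≤ h) :
    (volume : Measure (E d)) {x | Crosses F x z} ≤
      ENNReal.ofReal (2 ^ d * unitBallVol d * (‖z‖ + 3 * h) * h ^ (d - 1)) := by
  rcases (hull F).eq_empty_or_nonempty with h0 | ⟨y0, hy0⟩
  · have : {x | Crosses F x z} = ∅ := by
      ext x; simp [Crosses, h0]
    rw [this, measure_empty]; exact zero_le
  set N : ℕ := ⌈‖z‖ / h⌉₊ + 1 with hN
  have hN0 : (0 : ℝ) < N := by positivity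
  have hzN : ‖z‖ ≤ N * h := by
    have h1 : ‖z‖ / h ≤ N := (Nat.le_ceil _).trans (by rw [hN]; push_cast; linarith)
    rwa [div_le_iff₀ hh] at h1
  have hNle : (N : ℝ) + 1 ≤ ‖z‖ / h + 3 := by
    have := Nat.ceil_lt_add_one (show 0 ≤ ‖z‖ / h by positivity)
    rw [hN]; push_cast; linarith
  have hsub : {x | Crosses F x z} ⊆ ⋃ k ∈ Finset.range (N + 1),
      Metric.closedBall (y0 - ((k : ℝ) / N) • z) (2 * h) := by
    rintro x ⟨t, ht, hx⟩
    simp only [Set.mem_iUnion, Finset.mem_range]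
    have htN : 0 ≤ t * N := mul_nonneg ht.1 hN0.le
    refine ⟨⌊t * N⌋₊, ?_, ?_⟩
    · have h1 : (⌊t * N⌋₊ : ℝ) ≤ N := (Nat.floor_le htN).trans (by nlinarith [ht.2])
      have : ⌊t * N⌋₊ ≤ N := by exact_mod_cast h1
      omega
    · set k := ⌊t * N⌋₊
      have h1 := Nat.floor_le htN
      have h2 := Nat.lt_floor_add_one (t * N)
      rw [Metric.mem_closedBall, dist_eq_norm]
      have h3 : x - (y0 - ((k : ℝ) / N) • z) = (x + t • z - y0) - (t - (k : ℝ) / N) • z := by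
        module
      have h4 : |t - (k : ℝ) / N| ≤ 1 / N := by
        have : t - (k : ℝ) / N = (t * N - k) / N := by field_simp
        rw [this, abs_div, abs_of_pos hN0]
        refine div_le_div_of_nonneg_right ?_ hN0.le
        rw [abs_le]; constructor <;> linarith
      rw [h3]
      refine (norm_sub_le _ _).trans ?_
      have h5 : ‖x + t • z - y0‖ ≤ h := (norm_sub_le_size hx hy0).trans hF
      have h6 : ‖(t - (k : ℝ) / N) • z‖ ≤ h := by
        rw [norm_smul, Real.norm_eq_abs]
        refine (mul_le_mul h4 hzN (norm_nonneg _) (by positivity)).trans ?_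
        rw [← mul_assoc, one_div, inv_mul_cancel₀ hN0.ne', one_mul]
      linarith
  refine (measure_mono hsub).trans ((measure_biUnion_finset_le _ _).trans ?_)
  rw [Finset.sum_congr rfl fun (k : ℕ) _ => volume_closedBall' (y0 - ((k : ℝ) / N) • z)
    (by positivity : 0 ≤ 2 * h), Finset.sum_const, Finset.card_range, nsmul_eq_mul,
    ← ENNReal.ofReal_natCast, ← ENNReal.ofReal_mul (by positivity)]
  refine ENNReal.ofReal_le_ofReal ?_
  have hu := unitBallVol_pos (d := d)
  obtain ⟨n, rfl⟩ : ∃ n, d = n + 1 := ⟨d - 1, by omega⟩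
  have h7 : ((N + 1 : ℕ) : ℝ) * h ≤ ‖z‖ + 3 * h := by
    push_cast
    calc ((N : ℝ) + 1) * h ≤ (‖z‖ / h + 3) * h := mul_le_mul_of_nonneg_right hNle hh.le
      _ = ‖z‖ + 3 * h := by field_simp
  calc ((N + 1 : ℕ) : ℝ) * ((2 * h) ^ (n + 1) * unitBallVol (n + 1))
      = 2 ^ (n + 1) * unitBallVol (n + 1) * (((N + 1 : ℕ) : ℝ) * h) * h ^ n := by ring
    _ ≤ 2 ^ (n + 1) * unitBallVol (n + 1) * (‖z‖ + 3 * h) * h ^ n := by gcongr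
    _ = _ := by simp

/-- Near a boundary face in `Γ` there is a ball that is pushed out of the domain by a translation,
leaving it only through `Γ`. -/
theorem exists_window (hd : 0 < d) (hΩ : IsConvexPolytopalDomain Ω) {Γ : Set (E d)}
    (hΓ : Γ ⊆ frontier Ω) (T : Mesh d Ω) (hne : (T.facesIn Γ).Nonempty) :
    ∃ (c z : E d) (ρ : ℝ), 0 < ρ ∧ Metric.ball c ρ ⊆ Ω ∧ ∀ x ∈ Metric.ball c ρ, x + z ∉ closure Ω ∧
      ∀ t ∈ Set.Icc (0 : ℝ) 1, x + t • z ∈ frontier Ω → x + t • z ∈ Γ := by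
  obtain ⟨F, hF⟩ := hne
  obtain ⟨hFb, hFΓ⟩ := Finset.mem_filter.1 hF
  have hFf := T.boundaryFaces_subset hFb
  obtain ⟨y, hy⟩ := T.openHull_nonempty hd hFf
  obtain ⟨κ, hκ, r, hr, rfl⟩ := T.mem_faces.1 hFf
  have hs := T.isSimplex hκ
  obtain ⟨hy1, hy2⟩ := (hs.mem_openHull_erase hr).1 hy
  obtain ⟨ρ₀, hρ₀, hball⟩ := Metric.eventually_nhds_iff_ball.1 (eventually_bary_pos hy1)
  set g := slope (bary κ r) with hg
  have hgn : 0 < ‖g‖ := norm_pos_iff.2 (hs.slope_bary_ne_zero hd hr)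
  have hpos : ∀ x ∈ Metric.ball y ρ₀, 0 < bary κ r x → x ∈ Ω := by
    intro x hx hxr
    rw [← hΩ.interior_closure]
    refine interior_mono (T.hull_subset_closure hκ) ?_
    rw [hs.interior_hull]
    intro p hp
    by_cases hpr : p = r
    · rwa [hpr]
    · exact hball x hx p (Finset.mem_erase.2 ⟨hpr, hp⟩)
  have hzero : ∀ x ∈ Metric.ball y ρ₀, bary κ r x = 0 → x ∈ Γ := fun x hx hxr =>
    hFΓ ((hs.mem_openHull_erase hr).2 ⟨hball x hx, hxr⟩)
  set δ := ρ₀ / (2 * ‖g‖) with hδ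
  have hδ0 : 0 < δ := by positivity
  have hδg : δ * ‖g‖ = ρ₀ / 2 := by rw [hδ]; field_simp
  have hval : ∀ x t, bary κ r (x + t • (-(2 * δ)) • g) =
      δ * ‖g‖ ^ 2 * (1 - 2 * t) + inner ℝ g (x - (y + δ • g)) := by
    intro x t
    have h1 := affine_sub (bary κ r) (x + t • (-(2 * δ)) • g) y
    rw [hy2, sub_zero] at h1
    rw [h1, ← hg, show x + t • (-(2 * δ)) • g - y =
      (x - (y + δ • g)) + (δ * (1 - 2 * t)) • g by module, inner_add_right, inner_smul_right,
      real_inner_self_eq_norm_sq]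
    ring
  have hinner : ∀ x ∈ Metric.ball (y + δ • g) (ρ₀ / 2),
      |inner ℝ g (x - (y + δ • g))| < δ * ‖g‖ ^ 2 := by
    intro x hx
    rw [Metric.mem_ball, dist_eq_norm] at hx
    refine (abs_real_inner_le_norm _ _).trans_lt ?_
    calc ‖g‖ * ‖x - (y + δ • g)‖ < ‖g‖ * (ρ₀ / 2) := by gcongr
      _ = δ * ‖g‖ ^ 2 := by rw [← hδg]; ring
  have hmem : ∀ x ∈ Metric.ball (y + δ • g) (ρ₀ / 2), ∀ t ∈ Set.Icc (0 : ℝ) 1,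
      x + t • (-(2 * δ)) • g ∈ Metric.ball y ρ₀ := by
    intro x hx t ht
    rw [Metric.mem_ball, dist_eq_norm] at hx ⊢
    rw [show x + t • (-(2 * δ)) • g - y = (x - (y + δ • g)) + (δ * (1 - 2 * t)) • g by module]
    refine (norm_add_le _ _).trans_lt ?_
    have h1 : ‖(δ * (1 - 2 * t)) • g‖ ≤ ρ₀ / 2 := by
      rw [norm_smul, Real.norm_eq_abs, abs_mul, abs_of_pos hδ0, mul_right_comm, hδg]
      refine mul_le_of_le_one_right (by positivity) ?_
      rw [abs_le]; constructor <;> linarith [ht.1, ht.2]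
    linarith
  have hstart : ∀ x ∈ Metric.ball (y + δ • g) (ρ₀ / 2),
      x ∈ Metric.ball y ρ₀ ∧ 0 < bary κ r x := by
    intro x hx
    have h1 := hmem x hx 0 (by simp)
    have h2 := hval x 0
    have h3 := (abs_lt.1 (hinner x hx)).1
    simp only [zero_smul, add_zero] at h1 h2
    exact ⟨h1, by rw [h2]; linarith⟩
  have hneg : ∀ x ∈ Metric.ball y ρ₀, bary κ r x < 0 → x ∉ closure Ω := by
    intro x hx hxr hxΩ
    -- The segment from an inner point to `x` meets `Γ` although it should stay inside.
    obtain ⟨hc1, hc2⟩ := hstart (y + δ • g) (Metric.mem_ball_self (by positivity))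
    set c := y + δ • g
    have hcΩ := hpos c hc1 hc2
    set a := bary κ r c
    set b := bary κ r x
    have hab : 0 < a - b := by linarith
    have hw : AffineMap.homothety c (a / (a - b)) x ∈ openSegment ℝ c x := by
      refine ⟨-b / (a - b), a / (a - b), div_pos (by linarith) hab, div_pos hc2 hab,
        by field_simp; ring, ?_⟩
      have hcoef : -b / (a - b) = 1 - a / (a - b) := by field_simp; ring
      rw [AffineMap.homothety_apply, vsub_eq_sub, vadd_eq_add, hcoef]
      generalize a / (a - b) = s
      module
    have hw0 : bary κ r (AffineMap.homothety c (a / (a - b)) x) = 0 := by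
      rw [affine_homothety]; change a / (a - b) * b + (1 - a / (a - b)) * a = 0
      field_simp; ring
    have hwΩ := hΩ.openSegment_subset hcΩ hxΩ hw
    have hwball := (convex_ball y ρ₀).openSegment_subset hc1 hx hw
    have := hΓ (hzero _ hwball hw0)
    rw [frontier, hΩ.isOpen.interior_eq] at this
    exact this.2 hwΩ
  refine ⟨y + δ • g, (-(2 * δ)) • g, ρ₀ / 2, by positivity,
    fun x hx => hpos x (hstart x hx).1 (hstart x hx).2, fun x hx => ⟨?_, fun t ht hfr => ?_⟩⟩
  · have h1 := hmem x hx 1 (by simp)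
    have h2 := hval x 1
    have h3 := (abs_lt.1 (hinner x hx)).2
    rw [one_smul] at h1 h2
    exact hneg _ h1 (by rw [h2]; linarith)
  · have hm := hmem x hx t ht
    rcases lt_trichotomy (bary κ r (x + t • (-(2 * δ)) • g)) 0 with h1 | h1 | h1
    · exact absurd hfr.1 (hneg _ hm h1)
    · exact hzero _ hm h1
    · rw [frontier, hΩ.isOpen.interior_eq] at hfr
      exact absurd (hpos _ hm h1) hfr.2

end

/-! ### A Poincaré inequality in `L¹` -/

section

variable {Ω : Set (E d)}

theorem vol_nonneg (κ : Finset (E d)) : 0 ≤ vol κ := measureReal_nonneg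

theorem area_nonneg (F : Finset (E d)) : 0 ≤ area F := measureReal_nonneg

/-- Almost every segment that crosses a face does so in its relative interior. -/
theorem ae_crosses_openHull (T : Mesh d Ω) (z : E d) :
    ∀ᵐ x : E d, ∀ F ∈ T.faces, Crosses F x z → ∃ t ∈ Set.Icc (0 : ℝ) 1, x + t • z ∈ openHull F := by
  have hae := (Filter.eventually_all (ι := T.cells)).2
    fun κ : T.cells => (T.isSimplex κ.2).ae_generic z
  filter_upwards [hae] with x hx F hF hc
  obtain ⟨κ, hκ, r, hr, rfl⟩ := T.mem_faces.1 hF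
  have hs := T.isSimplex hκ
  obtain ⟨t, ht, hxt⟩ := hc
  refine ⟨t, ht, ?_⟩
  rw [hs.mem_hull_erase hr] at hxt
  rw [hs.mem_openHull_erase hr]
  refine ⟨fun p hp => ?_, hxt.2⟩
  obtain ⟨hpr, hp⟩ := Finset.mem_erase.1 hp
  refine lt_of_le_of_ne (hxt.1 p hp) fun h0 => ?_
  refine (hx ⟨κ, hκ⟩).2.2 p hp r hr hpr t ⟨?_, ?_⟩
  · rw [← inner_smul_right, ← affine_add]; exact h0.symm
  · rw [← inner_smul_right, ← affine_add]; exact hxt.2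

theorem measurable_pwConst (T : Mesh d Ω) (g : T.cells → ℝ) : Measurable (pwConst T g) := by
  unfold pwConst
  refine Finset.measurable_sum _ fun κ _ => ?_
  exact (measurable_const.indicator (measurableSet_hull κ.1)).const_mul _

theorem pwConst_nonneg (T : Mesh d Ω) {g : T.cells → ℝ} (hg : ∀ κ, 0 ≤ g κ) (x : E d) :
    0 ≤ pwConst T g x :=
  Finset.sum_nonneg fun κ _ => mul_nonneg (hg κ) (Set.indicator_nonneg (fun _ _ => zero_le_one) _)

theorem pwConst_eq_zero (T : Mesh d Ω) (g : T.cells → ℝ) {x : E d} (hx : x ∉ closure Ω) :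
    pwConst T g x = 0 := by
  refine Finset.sum_eq_zero fun κ _ => ?_
  rw [Set.indicator_of_notMem, mul_zero]
  exact fun h => hx (T.hull_subset_closure κ.2 h)

theorem lintegral_pwConst (hΩ : IsConvexPolytopalDomain Ω) (T : Mesh d Ω) {g : T.cells → ℝ}
    (hg : ∀ κ, 0 ≤ g κ) :
    ∫⁻ x in Ω, ENNReal.ofReal (pwConst T g x) = ENNReal.ofReal (∑ κ : T.cells, vol κ.1 * g κ) := by
  have h1 : Ω =ᵐ[volume] closure Ω := by
    refine (ae_eq_of_subset_of_measure_ge subset_closure ?_ hΩ.isOpen.measurableSet.nullMeasurableSet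
      hΩ.isBounded.closure.measure_lt_top.ne)
    rw [closure_eq_interior_union_frontier, hΩ.isOpen.interior_eq]
    refine (measure_union_le _ _).trans ?_
    rw [hΩ.convex.addHaar_frontier volume, add_zero]
  rw [setLIntegral_congr h1]
  have h2 : ∀ x, ENNReal.ofReal (pwConst T g x) =
      ∑ κ : T.cells, (hull κ.1).indicator (fun _ => ENNReal.ofReal (g κ)) x := by
    intro x
    rw [pwConst, ENNReal.ofReal_sum_of_nonneg fun κ _ =>
      mul_nonneg (hg κ) (Set.indicator_nonneg (fun _ _ => zero_le_one) _)]
    refine Finset.sum_congr rfl fun κ _ => ?_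
    by_cases hx : x ∈ hull κ.1 <;> simp [hx]
  simp_rw [h2]
  rw [lintegral_finsetSum _ fun κ _ => measurable_const.indicator (measurableSet_hull κ.1),
    ENNReal.ofReal_sum_of_nonneg fun (κ : T.cells) _ =>
      mul_nonneg (vol_nonneg κ.1) (hg κ)]
  refine Finset.sum_congr rfl fun κ _ => ?_
  rw [lintegral_indicator (measurableSet_hull κ.1), setLIntegral_const,
    Measure.restrict_apply (measurableSet_hull κ.1),
    Set.inter_eq_left.2 (T.hull_subset_closure κ.2), ENNReal.ofReal_mul (vol_nonneg _),
    vol, Measure.real, ENNReal.ofReal_toReal (isCompact_hull κ.1).measure_lt_top.ne, mul_comm]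

/-- The mean variation of a piecewise constant function under a translation is bounded by its
jumps. -/
theorem lintegral_translate_sub_le (hd : 0 < d) (hΩ : IsConvexPolytopalDomain Ω)
    (T : OrientedMesh d Ω) {Γ : Set (E d)} (hfit : T.IsFitted Γ) (g : T.cells → ℝ) (A : Set (E d))
    (z : E d) (hseg : ∀ x ∈ A, ∀ t ∈ Set.Icc (0 : ℝ) 1, x + t • z ∈ frontier Ω → x + t • z ∈ Γ) :
    ∫⁻ x in A, ENNReal.ofReal |pwConst T.toMesh g (x + z) - pwConst T.toMesh g x| ≤
      ENNReal.ofReal (2 ^ d * unitBallVol d * (‖z‖ + 3 * T.h) *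
        ∑ F ∈ T.interiorFaces ∪ T.facesIn Γ, T.h ^ (d - 1) * |jumpConst T g F|) := by
  set S := T.interiorFaces ∪ T.facesIn Γ with hS
  have hh := T.h_pos hd hΩ
  have hu := unitBallVol_pos (d := d)
  have hSf : S ⊆ T.faces := Finset.union_subset T.interiorFaces_subset
    ((T.facesIn_subset Γ).trans T.boundaryFaces_subset)
  have hpt : ∀ᵐ x : E d, x ∈ A →
      ENNReal.ofReal |pwConst T.toMesh g (x + z) - pwConst T.toMesh g x| ≤
      ∑ F ∈ S, {x | Crosses F x z}.indicator (fun _ => ENNReal.ofReal |jumpConst T g F|) x := by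
    filter_upwards [ae_pwConst_sub_le hd T g z, ae_crosses_openHull T.toMesh z] with x hx hx2 hxA
    refine (ENNReal.ofReal_le_ofReal hx).trans ?_
    have h1 : ∑ F ∈ T.faces, (if Crosses F x z then |jumpConst T g F| else 0) =
        ∑ F ∈ S, (if Crosses F x z then |jumpConst T g F| else 0) := by
      refine (Finset.sum_subset hSf fun F hF hFS => if_neg fun hc => ?_).symm
      obtain ⟨t, ht, hxt⟩ := hx2 F hF hc
      rw [hS, Finset.mem_union, not_or] at hFS
      have hb := (T.mem_interior_or_boundary hF).resolve_left hFS.1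
      have hfr := (Finset.mem_filter.1 hb).2 (openHull_subset_hull F hxt)
      have hxΓ := hseg x hxA t ht hfr
      rcases hfit F hb with hsub | hdis
      · exact hFS.2 (Finset.mem_filter.2 ⟨hb, hsub⟩)
      · exact Set.disjoint_left.1 hdis hxt hxΓ
    rw [h1, ENNReal.ofReal_sum_of_nonneg fun F _ => by split_ifs <;> positivity]
    refine Finset.sum_le_sum fun F _ => ?_
    by_cases hc : Crosses F x z <;> simp [hc]
  calc ∫⁻ x in A, ENNReal.ofReal |pwConst T.toMesh g (x + z) - pwConst T.toMesh g x|
      ≤ ∫⁻ x in A, ∑ F ∈ S,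
        {x | Crosses F x z}.indicator (fun _ => ENNReal.ofReal |jumpConst T g F|) x := by
        refine lintegral_mono_ae ?_
        have hmeas : MeasurableSet {x | ENNReal.ofReal
            |pwConst T.toMesh g (x + z) - pwConst T.toMesh g x| ≤
            ∑ F ∈ S, {x | Crosses F x z}.indicator
              (fun _ => ENNReal.ofReal |jumpConst T g F|) x} := by
          have hm := measurable_pwConst T.toMesh g
          refine measurableSet_le ?_ ?_
          · exact ENNReal.measurable_ofReal.comp
              (continuous_abs.measurable.comp
                ((hm.comp (measurable_id.add_const z)).sub hm))
          · exact Finset.measurable_sum _ fun F _ =>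
              measurable_const.indicator (isClosed_crosses F z).measurableSet
        exact (ae_restrict_iff hmeas).2 hpt
    _ ≤ ∫⁻ x, ∑ F ∈ S,
        {x | Crosses F x z}.indicator (fun _ => ENNReal.ofReal |jumpConst T g F|) x :=
        setLIntegral_le_lintegral _ _
    _ = ∑ F ∈ S, ENNReal.ofReal |jumpConst T g F| * volume {x | Crosses F x z} := by
        rw [lintegral_finsetSum _ fun F _ =>
          measurable_const.indicator (isClosed_crosses F z).measurableSet]
        refine Finset.sum_congr rfl fun F _ => ?_
        rw [lintegral_indicator (isClosed_crosses F z).measurableSet, setLIntegral_const]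
    _ ≤ ∑ F ∈ S, ENNReal.ofReal |jumpConst T g F| *
        ENNReal.ofReal (2 ^ d * unitBallVol d * (‖z‖ + 3 * T.h) * T.h ^ (d - 1)) := by
        refine Finset.sum_le_sum fun F hF => ?_
        gcongr
        exact volume_crosses_le hd F z hh (T.size_face_le_h (hSf hF))
    _ = _ := by
        rw [Finset.mul_sum, ENNReal.ofReal_sum_of_nonneg fun F _ => by positivity]
        refine Finset.sum_congr rfl fun F _ => ?_
        rw [← ENNReal.ofReal_mul (abs_nonneg _)]
        congr 1
        ring

/-- A Poincaré inequality in `L¹` for piecewise constant functions: the integral is controlled by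
the jumps across interior faces and the values on the faces in `Γ`, uniformly in the mesh. The
mesh `T₀` only serves to provide a flat piece of `Γ`. -/
theorem exists_poincare_L1 (hd : 0 < d) (hΩ : IsConvexPolytopalDomain Ω) {Γ : Set (E d)}
    (hΓ : Γ ⊆ frontier Ω) (T₀ : Mesh d Ω) (hne : (T₀.facesIn Γ).Nonempty) :
    ∃ C > 0, ∀ T : OrientedMesh d Ω, T.IsFitted Γ → ∀ g : T.cells → ℝ, (∀ κ, 0 ≤ g κ) →
      ∑ κ : T.cells, vol κ.1 * g κ ≤
        C * ∑ F ∈ T.interiorFaces ∪ T.facesIn Γ, T.h ^ (d - 1) * |jumpConst T g F| := by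
  obtain ⟨c, z₀, ρ, hρ, hBΩ, hB⟩ := exists_window hd hΩ hΓ T₀ hne
  set B := Metric.ball c ρ with hBdef
  set D := Metric.diam (closure Ω) with hD
  set K := 2 ^ d * unitBallVol d with hK
  have hu := unitBallVol_pos (d := d)
  have hK0 : 0 < K := by positivity
  have hD0 : 0 ≤ D := Metric.diam_nonneg
  set vB := (volume : Measure (E d)).real B with hvB
  have hvB0 : 0 < vB := ENNReal.toReal_pos (Metric.measure_ball_pos _ _ hρ).ne' measure_ball_lt_top.ne
  have hvBeq : volume B = ENNReal.ofReal vB := (ENNReal.ofReal_toReal measure_ball_lt_top.ne).symm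
  set vΩ := (volume : Measure (E d)).real Ω with hvΩ
  have hvΩeq : volume Ω = ENNReal.ofReal vΩ :=
    (ENNReal.ofReal_toReal hΩ.isBounded.measure_lt_top.ne).symm
  have hvΩ0 : 0 ≤ vΩ := measureReal_nonneg
  set C₁ := K * (‖z₀‖ + 3 * D) with hC₁
  set C₂ := D ^ d * unitBallVol d * (K * (D + 3 * D)) with hC₂
  have hC₁0 : 0 ≤ C₁ := by positivity
  have hC₂0 : 0 ≤ C₂ := by positivity
  refine ⟨vB⁻¹ * (vΩ * C₁ + C₂) + 1, by positivity, fun T hfit g hg => ?_⟩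
  set J := ∑ F ∈ T.interiorFaces ∪ T.facesIn Γ, T.h ^ (d - 1) * |jumpConst T g F| with hJ
  have hh := T.h_pos hd hΩ
  have hhD := T.h_le_diam hΩ
  have hJ0 : 0 ≤ J := Finset.sum_nonneg fun F _ => by positivity
  set q := pwConst T.toMesh g with hq
  have hqm : Measurable q := measurable_pwConst T.toMesh g
  have hq0 : ∀ x, 0 ≤ q x := pwConst_nonneg T.toMesh hg
  -- On the ball, the translation by `z₀` leads to the exterior, where `q` vanishes.
  have h1 : ∫⁻ x in B, ENNReal.ofReal (q x) ≤ ENNReal.ofReal (C₁ * J) := by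
    have h2 := lintegral_translate_sub_le hd hΩ T hfit g B z₀ fun x hx => (hB x hx).2
    have h3 : ∫⁻ x in B, ENNReal.ofReal (q x) =
        ∫⁻ x in B, ENNReal.ofReal |q (x + z₀) - q x| := by
      refine setLIntegral_congr_fun measurableSet_ball fun x hx => ?_
      have : q (x + z₀) = 0 := pwConst_eq_zero T.toMesh g (hB x hx).1
      simp only [this]
      rw [zero_sub, abs_neg, abs_of_nonneg (hq0 x)]
    rw [h3]
    refine h2.trans (ENNReal.ofReal_le_ofReal ?_)
    rw [hC₁]
    gcongr
  -- Comparison of all pairs of points of `Ω × B`, ordered by the translation.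
  have h4 : ∫⁻ x in Ω, ∫⁻ y in B, ENNReal.ofReal |q y - q x| ≤ ENNReal.ofReal (C₂ * J) := by
    have hΩm := hΩ.isOpen.measurableSet
    set f : E d → E d → ENNReal := fun x z =>
      Ω.indicator (fun _ => (1 : ENNReal)) x * (B.indicator (fun _ => (1 : ENNReal)) (x + z) *
        ENNReal.ofReal |q (x + z) - q x|) with hf
    have h5 : ∫⁻ x in Ω, ∫⁻ y in B, ENNReal.ofReal |q y - q x| = ∫⁻ x, ∫⁻ z, f x z := by
      rw [← lintegral_indicator hΩm]
      refine lintegral_congr fun x => ?_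
      by_cases hx : x ∈ Ω
      · rw [Set.indicator_of_mem hx, ← lintegral_indicator measurableSet_ball,
          ← lintegral_add_left_eq_self _ x]
        refine lintegral_congr fun z => ?_
        by_cases hz : x + z ∈ Metric.ball c ρ <;> simp [hf, hx, hz, hBdef]
      · simp [hf, hx]
    have hfm : AEMeasurable (Function.uncurry f) ((volume : Measure (E d)).prod volume) := by
      refine Measurable.aemeasurable ?_
      have m1 : Measurable fun p : E d × E d => p.1 + p.2 := measurable_fst.add measurable_snd
      refine ((measurable_const.indicator hΩm).comp measurable_fst).mul
        (((measurable_const.indicator measurableSet_ball).comp m1).mul ?_)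
      exact ENNReal.measurable_ofReal.comp (continuous_abs.measurable.comp
        ((hqm.comp m1).sub (hqm.comp measurable_fst)))
    rw [h5, lintegral_lintegral_swap hfm]
    have h6 : ∀ z, ∫⁻ x, f x z ≤ (Metric.closedBall (0 : E d) D).indicator
        (fun _ => ENNReal.ofReal (K * (D + 3 * D) * J)) z := by
      intro z
      set A := {x | x ∈ Ω ∧ x + z ∈ B} with hA
      have hAm : MeasurableSet A :=
        hΩm.inter (measurableSet_ball.preimage (measurable_id.add_const z))
      have h7 : ∫⁻ x, f x z = ∫⁻ x in A, ENNReal.ofReal |q (x + z) - q x| := by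
        rw [← lintegral_indicator hAm]
        refine lintegral_congr fun x => ?_
        by_cases hx : x ∈ Ω <;> by_cases hz : x + z ∈ B <;> simp [hf, hA, hx, hz]
      by_cases hz : ‖z‖ ≤ D
      · rw [Set.indicator_of_mem (by simpa using hz), h7]
        refine (lintegral_translate_sub_le hd hΩ T hfit g A z fun x hx t ht hfr => ?_).trans
          (ENNReal.ofReal_le_ofReal ?_)
        · exfalso
          have hmem : x + t • z ∈ Ω := by
            have := hΩ.convex.add_smul_sub_mem hx.1 (hBΩ hx.2) ht
            simpa using this
          rw [frontier, hΩ.isOpen.interior_eq] at hfr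
          exact hfr.2 hmem
        · gcongr
      · have hAe : A = ∅ := by
          ext x
          simp only [hA, Set.mem_ofPred_eq, Set.mem_empty_iff_false, iff_false, not_and]
          intro hx hxz
          apply hz
          have := Metric.dist_le_diam_of_mem hΩ.isBounded.closure (subset_closure (hBΩ hxz))
            (subset_closure hx)
          rwa [dist_eq_norm, add_sub_cancel_left] at this
        rw [h7, hAe]
        simp
    refine (lintegral_mono h6).trans ?_
    rw [lintegral_indicator Metric.isClosed_closedBall.measurableSet, setLIntegral_const,
      volume_closedBall' _ hD0, ← ENNReal.ofReal_mul (by positivity)]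
    refine ENNReal.ofReal_le_ofReal (le_of_eq ?_)
    rw [hC₂]; ring
  have h8 : ENNReal.ofReal vB * ∫⁻ x in Ω, ENNReal.ofReal (q x) ≤
      ENNReal.ofReal ((vΩ * C₁ + C₂) * J) := by
    calc ENNReal.ofReal vB * ∫⁻ x in Ω, ENNReal.ofReal (q x)
        = ∫⁻ x in Ω, ∫⁻ y in B, ENNReal.ofReal (q x) := by
          have hm : Measurable fun x => ENNReal.ofReal (q x) := ENNReal.measurable_ofReal.comp hqm
          rw [← lintegral_const_mul _ hm]
          refine lintegral_congr fun x => ?_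
          rw [setLIntegral_const, hvBeq, mul_comm]
      _ ≤ ∫⁻ x in Ω, ∫⁻ y in B, (ENNReal.ofReal (q y) + ENNReal.ofReal |q y - q x|) := by
          refine lintegral_mono fun x => lintegral_mono fun y => ?_
          rw [← ENNReal.ofReal_add (hq0 y) (abs_nonneg _)]
          refine ENNReal.ofReal_le_ofReal ?_
          have := neg_abs_le (q y - q x)
          linarith
      _ = ∫⁻ x in Ω, ((∫⁻ y in B, ENNReal.ofReal (q y)) +
            ∫⁻ y in B, ENNReal.ofReal |q y - q x|) := by
          refine lintegral_congr fun x => ?_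
          exact lintegral_add_left (ENNReal.measurable_ofReal.comp hqm) _
      _ = (∫⁻ y in B, ENNReal.ofReal (q y)) * volume Ω +
            ∫⁻ x in Ω, ∫⁻ y in B, ENNReal.ofReal |q y - q x| := by
          rw [lintegral_add_left measurable_const, setLIntegral_const]
      _ ≤ ENNReal.ofReal (C₁ * J) * ENNReal.ofReal vΩ + ENNReal.ofReal (C₂ * J) := by
          rw [hvΩeq]
          gcongr
      _ = _ := by
          rw [← ENNReal.ofReal_mul (by positivity), ← ENNReal.ofReal_add (by positivity)
            (by positivity)]
          congr 1
          ring
  rw [hq, lintegral_pwConst hΩ T.toMesh hg, ← ENNReal.ofReal_mul hvB0.le,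
    ENNReal.ofReal_le_ofReal_iff (by positivity)] at h8
  calc ∑ κ : T.cells, vol κ.1 * g κ = vB⁻¹ * (vB * ∑ κ : T.cells, vol κ.1 * g κ) := by
        rw [← mul_assoc, inv_mul_cancel₀ hvB0.ne', one_mul]
    _ ≤ vB⁻¹ * ((vΩ * C₁ + C₂) * J) := by gcongr
    _ ≤ (vB⁻¹ * (vΩ * C₁ + C₂) + 1) * J := by linarith

end

/-! ### Regular meshes and the discrete Poincaré inequality for gradients -/

section

variable {Ω : Set (E d)}

/-- Every element of the mesh contains a ball of radius `ρ h`, where `h` is the global mesh size.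
This combines shape regularity and quasi-uniformity. -/
def Mesh.Regular (T : Mesh d Ω) (ρ : ℝ) : Prop :=
  ∀ κ ∈ T.cells, ∃ x, Metric.ball x (ρ * T.h) ⊆ hull κ

section Regular

variable {T : Mesh d Ω} {ρ : ℝ}

/-- A barycentric coordinate varies by at most one over the inscribed ball. -/
theorem Mesh.Regular.norm_slope_bary_le (hT : T.Regular ρ) (hρ : 0 < ρ) (hh : 0 < T.h)
    {κ : Finset (E d)} (hκ : κ ∈ T.cells) {p : E d} (hp : p ∈ κ) :
    ‖slope (bary κ p)‖ ≤ 2 / (ρ * T.h) := by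
  obtain ⟨x, hx⟩ := hT κ hκ
  have hs := T.isSimplex hκ
  set g := slope (bary κ p) with hg
  rcases eq_or_ne g 0 with h0 | h0
  · rw [h0, norm_zero]; positivity
  have hgn : 0 < ‖g‖ := norm_pos_iff.2 h0
  have hr : 0 < ρ * T.h := by positivity
  have hx0 : x ∈ hull κ := hx (Metric.mem_ball_self hr)
  have hy : x + ((ρ * T.h / 2) * ‖g‖⁻¹) • g ∈ hull κ := by
    apply hx
    rw [Metric.mem_ball, dist_eq_norm, add_sub_cancel_left, norm_smul, Real.norm_eq_abs,
      abs_of_nonneg (by positivity), mul_assoc, inv_mul_cancel₀ hgn.ne']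
    linarith
  have h1 := hs.mem_hull.1 hx0
  have h2 := hs.mem_hull.1 hy
  have h3 : bary κ p (x + ((ρ * T.h / 2) * ‖g‖⁻¹) • g) ≤ 1 := by
    rw [← hs.sum_bary (x + ((ρ * T.h / 2) * ‖g‖⁻¹) • g)]
    exact Finset.single_le_sum (f := fun q => bary κ q (x + ((ρ * T.h / 2) * ‖g‖⁻¹) • g))
      (fun q hq => h2 q hq) hp
  rw [affine_add, inner_smul_right, ← hg, real_inner_self_eq_norm_sq] at h3
  have h4 : ρ * T.h / 2 * ‖g‖⁻¹ * ‖g‖ ^ 2 = ρ * T.h / 2 * ‖g‖ := by field_simp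
  rw [h4] at h3
  have h5 := h1 p hp
  rw [le_div_iff₀ hr]
  linarith

theorem one_le_norm_slope_mul {κ : Finset (E d)} (hs : IsSimplex κ) {p q : E d} (hp : p ∈ κ)
    (hq : q ∈ κ) (hpq : q ≠ p) : 1 ≤ ‖slope (bary κ p)‖ * ‖p - q‖ := by
  have h1 := affine_sub (bary κ p) p q
  rw [hs.bary_self hp, hs.bary_ne hp hq hpq, sub_zero] at h1
  rw [h1]
  exact real_inner_le_norm _ _

theorem Mesh.one_le_norm_slope_mul_h (hd : 0 < d) {κ : Finset (E d)} (hκ : κ ∈ T.cells) {p : E d}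
    (hp : p ∈ κ) : 1 ≤ ‖slope (bary κ p)‖ * T.h := by
  obtain ⟨q, hq, hqp⟩ := (T.isSimplex hκ).exists_ne hd p
  refine (one_le_norm_slope_mul (T.isSimplex hκ) hp hq hqp).trans ?_
  gcongr
  exact (norm_sub_le_size (subset_hull hp) (subset_hull hq)).trans (T.size_le_h ⟨κ, hκ⟩)

theorem Mesh.Regular.le_size (hT : T.Regular ρ) (hρ : 0 < ρ) (hh : 0 < T.h)
    {κ s : Finset (E d)} (hκ : κ ∈ T.cells) (hs : s ⊆ κ) (hcard : 1 < s.card) :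
    ρ * T.h / 2 ≤ size s := by
  obtain ⟨p, hp, q, hq, hpq⟩ := Finset.one_lt_card.1 hcard
  have h1 := one_le_norm_slope_mul (T.isSimplex hκ) (hs hp) (hs hq) hpq.symm
  have h2 := hT.norm_slope_bary_le hρ hh hκ (hs hp)
  have h3 : 1 ≤ 2 / (ρ * T.h) * ‖p - q‖ := h1.trans (by gcongr)
  have hr : 0 < ρ * T.h := by positivity
  have h4 : ‖p - q‖ ≤ size s := norm_sub_le_size (subset_hull hp) (subset_hull hq)
  rw [div_mul_eq_mul_div, le_div_iff₀ hr] at h3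
  linarith

theorem Mesh.Regular.le_size_cell (hT : T.Regular ρ) (hd : 0 < d) (hρ : 0 < ρ) (hh : 0 < T.h)
    {κ : Finset (E d)} (hκ : κ ∈ T.cells) : ρ * T.h / 2 ≤ size κ :=
  hT.le_size hρ hh hκ (Finset.Subset.refl κ) (by rw [T.card_eq κ hκ]; omega)

theorem Mesh.Regular.le_size_face (hT : T.Regular ρ) (hd : 2 ≤ d) (hρ : 0 < ρ) (hh : 0 < T.h)
    {F : Finset (E d)} (hF : F ∈ T.faces) : ρ * T.h / 2 ≤ size F := by
  have hc := T.card_face hF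
  obtain ⟨κ, hκ, r, hr, rfl⟩ := T.mem_faces.1 hF
  exact hT.le_size hρ hh hκ (Finset.erase_subset _ _) (by omega)

theorem Mesh.Regular.le_vol (hT : T.Regular ρ) (hρ : 0 < ρ) (hh : 0 < T.h)
    {κ : Finset (E d)} (hκ : κ ∈ T.cells) : unitBallVol d * (ρ * T.h) ^ d ≤ vol κ := by
  obtain ⟨x, hx⟩ := hT κ hκ
  have h1 : (volume : Measure (E d)).real (Metric.ball x (ρ * T.h)) =
      unitBallVol d * (ρ * T.h) ^ d := by
    rw [Measure.real, Measure.addHaar_ball_of_pos _ _ (by positivity), finrank_euclideanSpace_fin,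
      ENNReal.toReal_mul, ENNReal.toReal_ofReal (by positivity), unitBallVol, Measure.real, mul_comm]
  rw [← h1]
  exact measureReal_mono hx (isCompact_hull κ).measure_lt_top.ne

theorem Mesh.vol_le_h_mul_area (hd : 0 < d) {κ : Finset (E d)} (hκ : κ ∈ T.cells) {r : E d}
    (hr : r ∈ κ) : vol κ ≤ T.h * area (κ.erase r) := by
  have h1 := T.one_le_norm_slope_mul_h hd hκ hr
  have hd1 : (1 : ℝ) ≤ d := by exact_mod_cast hd
  have hv := (T.isSimplex hκ).vol_pos
  rw [(T.isSimplex hκ).area_face hd hr]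
  calc vol κ = 1 * vol κ * 1 := by ring
    _ ≤ d * vol κ * (‖slope (bary κ r)‖ * T.h) := by gcongr
    _ = _ := by ring

theorem Mesh.Regular.area_mul_h_le (hT : T.Regular ρ) (hd : 0 < d) (hρ : 0 < ρ) (hh : 0 < T.h)
    {κ : Finset (E d)} (hκ : κ ∈ T.cells) {r : E d} (hr : r ∈ κ) :
    area (κ.erase r) * T.h ≤ 2 * d / ρ * vol κ := by
  have h1 := hT.norm_slope_bary_le hρ hh hκ hr
  have hv := (T.isSimplex hκ).vol_pos
  rw [(T.isSimplex hκ).area_face hd hr]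
  calc d * vol κ * ‖slope (bary κ r)‖ * T.h ≤ d * vol κ * (2 / (ρ * T.h)) * T.h := by gcongr
    _ = _ := by field_simp

theorem Mesh.area_pos (T : Mesh d Ω) (hd : 0 < d) {F : Finset (E d)} (hF : F ∈ T.faces) :
    0 < area F := by
  obtain ⟨κ, hκ, r, hr, rfl⟩ := T.mem_faces.1 hF
  exact (T.isSimplex hκ).area_pos hd hr

theorem Mesh.Regular.pow_le_area (hT : T.Regular ρ) (hd : 0 < d) (hρ : 0 < ρ) (hh : 0 < T.h)
    {F : Finset (E d)} (hF : F ∈ T.faces) :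
    unitBallVol d * ρ ^ d * T.h ^ (d - 1) ≤ area F := by
  obtain ⟨κ, hκ, r, hr, rfl⟩ := T.mem_faces.1 hF
  have h1 := (hT.le_vol hρ hh hκ).trans (T.vol_le_h_mul_area hd hκ hr)
  have h2 : unitBallVol d * (ρ * T.h) ^ d = T.h * (unitBallVol d * ρ ^ d * T.h ^ (d - 1)) := by
    obtain ⟨n, rfl⟩ : ∃ n, d = n + 1 := ⟨d - 1, by omega⟩
    simp only [Nat.add_sub_cancel]
    ring
  rw [h2] at h1
  exact le_of_mul_le_mul_left h1 hh

end Regular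

variable (T : OrientedMesh d Ω)

/-- The jump of a piecewise affine function across a face, as an affine function on the whole
space. -/
def jumpAff (v : Broken T) (F : Finset (E d)) : E d →ᵃ[ℝ] ℝ :=
  ∑ κ ∈ T.cellsAt F, side T F κ • v κ

theorem affine_sum_apply {ι : Type*} (s : Finset ι) (f : ι → (E d →ᵃ[ℝ] ℝ)) (x : E d) :
    (∑ i ∈ s, f i) x = ∑ i ∈ s, f i x := by
  induction s using Finset.induction_on with
  | empty => simp
  | insert a s ha ih => simp [Finset.sum_insert ha, ih]

theorem jump_eq (v : Broken T) (F : Finset (E d)) (x : E d) : jump T v F x = jumpAff T v F x := by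
  rw [jump, jumpAff, affine_sum_apply]
  rfl

theorem jump_eq' (v : Broken T) (F : Finset (E d)) : jump T v F = jumpAff T v F :=
  funext (jump_eq T v F)

theorem slope_jumpAff (v : Broken T) (F : Finset (E d)) :
    slope (jumpAff T v F) = ∑ κ ∈ T.cellsAt F, side T F κ • slope (v κ) := by
  rw [jumpAff, map_sum]
  simp

theorem jumpNormalDeriv_eq (v : Broken T) (F : Finset (E d)) (x : E d) :
    jumpNormalDeriv T v F x = inner ℝ (T.normal F) (slope (jumpAff T v F)) := by
  rw [jumpNormalDeriv, slope_jumpAff, inner_sum]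
  exact Finset.sum_congr rfl fun κ _ => by rw [grad_eq, inner_smul_right]

theorem card_cellsAt_le (hd : 0 < d) (hΩ : IsConvexPolytopalDomain Ω) {F : Finset (E d)}
    (hF : F ∈ T.faces) : (T.cellsAt F).card ≤ 2 := by
  rcases T.mem_interior_or_boundary hF with h | h
  · obtain ⟨κ₁, κ₂, -, h1, -, -⟩ := cellsAt_interior T hd hΩ h
    rw [h1]; exact Finset.card_le_two
  · obtain ⟨κ, h1, -⟩ := cellsAt_boundary T hd h
    rw [h1]; simp

/-- The jump of the squared gradient is controlled by the jump of the gradient, since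
`|a|² - |b|² = (|a| - |b|) (|a| + |b|)`. -/
theorem abs_jumpConst_sq_le (hd : 0 < d) (hΩ : IsConvexPolytopalDomain Ω) {F : Finset (E d)}
    (hF : F ∈ T.faces) (v : Broken T) :
    |jumpConst T (fun κ => ‖slope (v κ)‖ ^ 2) F| ≤
      ‖slope (jumpAff T v F)‖ * ∑ κ ∈ T.cellsAt F, ‖slope (v κ)‖ := by
  rw [jumpConst, slope_jumpAff]
  rcases T.mem_interior_or_boundary hF with h | h
  · obtain ⟨κ₁, κ₂, hne, h1, h2, h3⟩ := cellsAt_interior T hd hΩ h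
    rw [h1, Finset.sum_pair hne, Finset.sum_pair hne, Finset.sum_pair hne, h2, h3]
    simp only [one_smul, neg_smul, one_mul, neg_mul, ← sub_eq_add_neg]
    have : ‖slope (v κ₁)‖ ^ 2 - ‖slope (v κ₂)‖ ^ 2 =
      (‖slope (v κ₁)‖ - ‖slope (v κ₂)‖) * (‖slope (v κ₁)‖ + ‖slope (v κ₂)‖) := by ring
    rw [this, abs_mul, abs_of_nonneg (by positivity : 0 ≤ ‖slope (v κ₁)‖ + ‖slope (v κ₂)‖)]
    gcongr
    exact abs_norm_sub_norm_le _ _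
  · obtain ⟨κ, h1, h2⟩ := cellsAt_boundary T hd h
    rw [h1, Finset.sum_singleton, Finset.sum_singleton, Finset.sum_singleton, h2, one_smul, one_mul,
      abs_of_nonneg (by positivity), sq]

/-- Discrete Poincaré inequality in `L²` for the piecewise constant gradient: it is controlled by
its jumps across the interior faces and its values on the faces in `Γ`. -/
theorem exists_poincare_slope (hd : 0 < d) (hΩ : IsConvexPolytopalDomain Ω) {Γ : Set (E d)}
    (hΓ : Γ ⊆ frontier Ω) (T₀ : Mesh d Ω) (hne : (T₀.facesIn Γ).Nonempty) {ρ : ℝ} (hρ : 0 < ρ) :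
    ∃ C > 0, ∀ T : OrientedMesh d Ω, T.IsFitted Γ → T.Regular ρ → ∀ v : Broken T,
      T.h ^ 2 * ∑ κ : T.cells, vol κ.1 * ‖slope (v κ)‖ ^ 2 ≤
        C * ∑ F ∈ T.interiorFaces ∪ T.facesIn Γ,
          T.h * area F * ‖slope (jumpAff T v F)‖ ^ 2 := by
  obtain ⟨C, hC, hpoin⟩ := exists_poincare_L1 hd hΩ hΓ T₀ hne
  set ω := unitBallVol d with hω
  have hω0 : 0 < ω := unitBallVol_pos
  set c := ω * ρ ^ d with hc
  have hc0 : 0 < c := by positivity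
  refine ⟨C ^ 2 * (2 * (d + 1) / c) / c, by positivity, fun T hfit hreg v => ?_⟩
  set S := T.interiorFaces ∪ T.facesIn Γ with hS
  have hSf : S ⊆ T.faces := Finset.union_subset T.interiorFaces_subset
    ((T.facesIn_subset Γ).trans T.boundaryFaces_subset)
  have hh := T.h_pos hd hΩ
  set h := T.h with hhdef
  set G := ∑ κ : T.cells, vol κ.1 * ‖slope (v κ)‖ ^ 2 with hG
  have hG0 : 0 ≤ G := Finset.sum_nonneg fun κ _ => mul_nonneg (vol_nonneg _) (sq_nonneg _)
  set J := fun F => ‖slope (jumpAff T v F)‖ with hJ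
  set s := fun F => ∑ κ ∈ T.cellsAt F, ‖slope (v κ)‖ with hs
  -- The `L¹` inequality for the squared gradient; after the Cauchy–Schwarz inequality, one factor
  -- `G` cancels.
  have h1 : G ≤ C * ∑ F ∈ S, h ^ (d - 1) * (J F * s F) := by
    refine (hpoin T hfit (fun κ => ‖slope (v κ)‖ ^ 2) fun κ => sq_nonneg _).trans ?_
    gcongr with F hF
    exact abs_jumpConst_sq_le T hd hΩ (hSf hF) v
  have h2 : (∑ F ∈ S, h ^ (d - 1) * (J F * s F)) ^ 2 ≤
      (∑ F ∈ S, h ^ (d - 1) * J F ^ 2) * ∑ F ∈ S, h ^ (d - 1) * s F ^ 2 := by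
    refine Finset.sum_sq_le_sum_mul_sum_of_sq_le_mul S (fun F _ => by positivity)
      (fun F _ => by positivity) fun F _ => (by ring : _ = _).le
  have h3 : h * ∑ F ∈ S, h ^ (d - 1) * s F ^ 2 ≤ 2 * (d + 1) / c * G := by
    have h4 : ∀ F ∈ T.faces, s F ^ 2 ≤ 2 * ∑ κ ∈ T.cellsAt F, ‖slope (v κ)‖ ^ 2 := by
      intro F hF
      refine (sq_sum_le_card_mul_sum_sq).trans ?_
      gcongr
      exact_mod_cast card_cellsAt_le T hd hΩ hF
    have h5 : ∑ F ∈ S, s F ^ 2 ≤ 2 * (d + 1) * ∑ κ : T.cells, ‖slope (v κ)‖ ^ 2 := by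
      calc ∑ F ∈ S, s F ^ 2 ≤ ∑ F ∈ T.faces, s F ^ 2 :=
            Finset.sum_le_sum_of_subset_of_nonneg hSf fun F _ _ => sq_nonneg _
        _ ≤ ∑ F ∈ T.faces, 2 * ∑ κ ∈ T.cellsAt F, ‖slope (v κ)‖ ^ 2 := Finset.sum_le_sum h4
        _ = 2 * ∑ κ : T.cells, ∑ r ∈ κ.1, ‖slope (v κ)‖ ^ 2 := by
            rw [← Finset.mul_sum, ← T.sum_faces fun κ _ => ‖slope (v κ)‖ ^ 2]
        _ = _ := by
            rw [mul_assoc, Finset.mul_sum (a := (d + 1 : ℝ))]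
            congr 1
            refine Finset.sum_congr rfl fun κ _ => ?_
            rw [Finset.sum_const, T.card_eq κ.1 κ.2, nsmul_eq_mul]
            push_cast; ring
    have h6 : c * h ^ d * ∑ κ : T.cells, ‖slope (v κ)‖ ^ 2 ≤ G := by
      rw [Finset.mul_sum]
      refine Finset.sum_le_sum fun κ _ => mul_le_mul_of_nonneg_right ?_ (sq_nonneg _)
      have := hreg.le_vol hρ hh κ.2
      rw [mul_pow, ← mul_assoc] at this
      exact this
    have hpow : h * h ^ (d - 1) = h ^ d := by rw [← pow_succ', Nat.sub_add_cancel hd]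
    calc h * ∑ F ∈ S, h ^ (d - 1) * s F ^ 2 = h ^ d * ∑ F ∈ S, s F ^ 2 := by
          rw [← Finset.mul_sum, ← mul_assoc, hpow]
      _ ≤ h ^ d * (2 * (d + 1) * ∑ κ : T.cells, ‖slope (v κ)‖ ^ 2) := by gcongr
      _ = 2 * (d + 1) / c * (c * h ^ d * ∑ κ : T.cells, ‖slope (v κ)‖ ^ 2) := by field_simp
      _ ≤ _ := by gcongr
  set P := ∑ F ∈ S, h ^ (d - 1) * J F ^ 2 with hP
  have hP0 : 0 ≤ P := Finset.sum_nonneg fun F _ => by positivity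
  have h7 : h * G ≤ C ^ 2 * (2 * (d + 1) / c) * P := by
    rcases hG0.eq_or_lt with h0 | h0
    · rw [← h0, mul_zero]; positivity
    have h8 : G ^ 2 ≤ C ^ 2 * (P * ∑ F ∈ S, h ^ (d - 1) * s F ^ 2) := by
      calc G ^ 2 ≤ (C * ∑ F ∈ S, h ^ (d - 1) * (J F * s F)) ^ 2 := by gcongr
        _ ≤ _ := by rw [mul_pow]; gcongr
    have h9 : (h * G) * G ≤ (C ^ 2 * (2 * (d + 1) / c) * P) * G := by
      calc (h * G) * G = h * G ^ 2 := by ring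
        _ ≤ h * (C ^ 2 * (P * ∑ F ∈ S, h ^ (d - 1) * s F ^ 2)) := by gcongr
        _ = C ^ 2 * P * (h * ∑ F ∈ S, h ^ (d - 1) * s F ^ 2) := by ring
        _ ≤ C ^ 2 * P * (2 * (d + 1) / c * G) := by gcongr
        _ = _ := by ring
    exact le_of_mul_le_mul_right h9 h0
  have h10 : c * P ≤ ∑ F ∈ S, area F * J F ^ 2 := by
    rw [hP, Finset.mul_sum]
    refine Finset.sum_le_sum fun F hF => ?_
    rw [← mul_assoc]
    exact mul_le_mul_of_nonneg_right (hreg.pow_le_area hd hρ hh (hSf hF)) (sq_nonneg _)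
  calc h ^ 2 * G = h * (h * G) := by ring
    _ ≤ h * (C ^ 2 * (2 * (d + 1) / c) * P) := by gcongr
    _ = C ^ 2 * (2 * (d + 1) / c) / c * (h * (c * P)) := by field_simp
    _ ≤ C ^ 2 * (2 * (d + 1) / c) / c * (h * ∑ F ∈ S, area F * J F ^ 2) := by gcongr
    _ = _ := by
        congr 1
        rw [Finset.mul_sum]
        exact Finset.sum_congr rfl fun F _ => by ring

/-- The full gradient of an affine function is controlled by its normal derivative on a face and
its mean square over that face (an inverse inequality for the tangential part). -/
theorem Mesh.Regular.slope_sq_le {T : OrientedMesh d Ω} {ρ : ℝ} (hT : T.Regular ρ) (hd : 0 < d)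
    (hρ : 0 < ρ) (hh : 0 < T.h) {F : Finset (E d)} (hF : F ∈ T.faces) (f : E d →ᵃ[ℝ] ℝ) :
    T.h * area F * ‖slope f‖ ^ 2 ≤ 2 * (T.h * area F * inner ℝ (T.normal F) (slope f) ^ 2) +
      32 * d ^ 2 * (8 * 2 ^ (d - 1) + 2) / ρ ^ 2 * (T.h⁻¹ * faceIntegral F fun x => f x ^ 2) := by
  obtain ⟨κ, hκ, r, hr, rfl⟩ := T.mem_faces.1 hF
  have hs := T.isSimplex hκ
  set F := κ.erase r with hFdef
  set n := T.normal F with hn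
  have hn1 : ‖n‖ = 1 := T.normal_norm F hF
  have hA := T.area_pos hd hF
  set w := ∑ q ∈ F, f q • slope (bary κ q) with hw
  -- On the face only the values at its vertices matter, and the remaining vertex contributes a
  -- multiple of the normal.
  obtain ⟨α, hα⟩ : ∃ α : ℝ, slope f = α • n + w := by
    have hg : ‖slope (bary κ r)‖ ≠ 0 := norm_ne_zero_iff.2 (hs.slope_bary_ne_zero hd hr)
    refine ⟨-(f r * (side T F ⟨κ, hκ⟩ * ‖slope (bary κ r)‖)), ?_⟩
    have h1 := normal_eq T hd ⟨κ, hκ⟩ hr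
    rw [hs.slope_eq f, ← Finset.add_sum_erase _ _ hr, ← hFdef, ← hw]
    congr 1
    rw [hn, h1, smul_smul]
    congr 1
    have h2 := side_mul_self T F ⟨κ, hκ⟩
    have h3 : ‖slope (bary κ r)‖ * ‖slope (bary κ r)‖⁻¹ = 1 := mul_inv_cancel₀ hg
    linear_combination (-f r) * h2 - f r * (side T F ⟨κ, hκ⟩) ^ 2 * h3
  have hnorm : ‖slope f‖ ≤ |inner ℝ n (slope f)| + 2 * ‖w‖ := by
    have h1 : inner ℝ n (slope f) = α + inner ℝ n w := by
      rw [hα, inner_add_right, inner_smul_right, real_inner_self_eq_norm_sq, hn1]; ring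
    have h2 : |inner ℝ n w| ≤ ‖w‖ := by
      have := abs_real_inner_le_norm n w
      rwa [hn1, one_mul] at this
    have h3 : |α| ≤ |inner ℝ n (slope f)| + ‖w‖ := by
      have : α = inner ℝ n (slope f) - inner ℝ n w := by linarith
      rw [this]
      exact (abs_sub _ _).trans (by linarith)
    have h4 : ‖slope f‖ ≤ |α| + ‖w‖ := by
      conv_lhs => rw [hα]
      refine (norm_add_le _ _).trans ?_
      rw [norm_smul, hn1, mul_one, Real.norm_eq_abs]
    linarith
  have hcard : (F.card : ℝ) = d := by rw [T.card_face hF]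
  have hq : ∀ q ∈ F, area F * f q ^ 2 ≤
      (8 * 2 ^ (d - 1) + 2) * faceIntegral F fun x => f x ^ 2 := fun q hq =>
    sq_le_integral_sq (d - 1) (isCompact_hull F) (hull_convex F) (hs.measure_face_ne_top hd hr)
      (subset_hull hq) f
  set Q := (8 * 2 ^ (d - 1) + 2) * faceIntegral F fun x => f x ^ 2 with hQ
  have hwn : area F * ‖w‖ ^ 2 ≤ (2 / (ρ * T.h)) ^ 2 * (d ^ 2 * Q) := by
    have h1 : ‖w‖ ≤ 2 / (ρ * T.h) * ∑ q ∈ F, |f q| := by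
      rw [hw, Finset.mul_sum]
      refine (norm_sum_le _ _).trans (Finset.sum_le_sum fun q hq => ?_)
      rw [norm_smul, Real.norm_eq_abs, mul_comm]
      gcongr
      exact hT.norm_slope_bary_le hρ hh hκ (Finset.mem_of_mem_erase hq)
    have h2 : (∑ q ∈ F, |f q|) ^ 2 ≤ d * ∑ q ∈ F, f q ^ 2 := by
      have := sq_sum_le_card_mul_sum_sq (s := F) (f := fun q => |f q|)
      simpa [sq_abs, hcard] using this
    have h3 : area F * ∑ q ∈ F, f q ^ 2 ≤ d * Q := by
      rw [Finset.mul_sum, ← hcard, ← nsmul_eq_mul]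
      exact Finset.sum_le_card_nsmul _ _ _ hq
    calc area F * ‖w‖ ^ 2 ≤ area F * (2 / (ρ * T.h) * ∑ q ∈ F, |f q|) ^ 2 := by gcongr
      _ = (2 / (ρ * T.h)) ^ 2 * (area F * (∑ q ∈ F, |f q|) ^ 2) := by ring
      _ ≤ (2 / (ρ * T.h)) ^ 2 * (area F * (d * ∑ q ∈ F, f q ^ 2)) := by gcongr
      _ = (2 / (ρ * T.h)) ^ 2 * (d * (area F * ∑ q ∈ F, f q ^ 2)) := by ring
      _ ≤ (2 / (ρ * T.h)) ^ 2 * (d * (d * Q)) := by gcongr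
      _ = _ := by ring
  have hsq : ‖slope f‖ ^ 2 ≤ 2 * inner ℝ n (slope f) ^ 2 + 8 * ‖w‖ ^ 2 := by
    calc ‖slope f‖ ^ 2 ≤ (|inner ℝ n (slope f)| + 2 * ‖w‖) ^ 2 := by gcongr
      _ ≤ 2 * |inner ℝ n (slope f)| ^ 2 + 8 * ‖w‖ ^ 2 := by
        nlinarith [sq_nonneg (|inner ℝ n (slope f)| - 2 * ‖w‖)]
      _ = _ := by rw [sq_abs]
  calc T.h * area F * ‖slope f‖ ^ 2
      ≤ T.h * area F * (2 * inner ℝ n (slope f) ^ 2 + 8 * ‖w‖ ^ 2) := by gcongr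
    _ = 2 * (T.h * area F * inner ℝ n (slope f) ^ 2) + 8 * T.h * (area F * ‖w‖ ^ 2) := by ring
    _ ≤ 2 * (T.h * area F * inner ℝ n (slope f) ^ 2) +
        8 * T.h * ((2 / (ρ * T.h)) ^ 2 * (d ^ 2 * Q)) := by gcongr
    _ = _ := by
        rw [hQ]
        field_simp
        ring

end

/-! ### Inverse inequalities and Crouzeix–Raviart functions -/

section

variable {Ω : Set (E d)}

/-- A shape regular and quasi-uniform family is regular with a common constant. -/
theorem exists_regular {ι : Type*}
    {T : ι → OrientedMesh d Ω} (hreg : ShapeRegular T) (hqu : QuasiUniform T) :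
    ∃ ρ > 0, ∀ i, (T i).Regular ρ := by
  obtain ⟨σ, hσ, h1⟩ := hreg
  obtain ⟨τ, hτ, h2⟩ := hqu
  refine ⟨σ * τ, by positivity, fun i κ hκ => ?_⟩
  obtain ⟨x, hx⟩ := h1 i κ hκ
  refine ⟨x, (Metric.ball_subset_ball ?_).trans hx⟩
  rw [mul_assoc]
  exact mul_le_mul_of_nonneg_left (h2 i κ hκ) hσ.le

theorem le_sqrt_mul {a K N : ℝ} (hK : 0 ≤ K) (hN : 0 ≤ N) (h : a ^ 2 ≤ K * N ^ 2) :
    a ≤ √K * N := by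
  have := Real.le_sqrt_of_sq_le h
  rwa [Real.sqrt_mul hK, Real.sqrt_sq hN] at this

section

variable (T : OrientedMesh d Ω)

theorem normCell_sq (v : Broken T) (κ : T.cells) :
    normCell T v κ ^ 2 = ∫ x in hull κ.1, v κ x ^ 2 :=
  Real.sq_sqrt (integral_nonneg fun _ => sq_nonneg _)

theorem normGradCell_sq (v : Broken T) (κ : T.cells) :
    normGradCell T v κ ^ 2 = vol κ.1 * ‖slope (v κ)‖ ^ 2 := by
  rw [normGradCell, Real.sq_sqrt (integral_nonneg fun _ => sq_nonneg _)]
  simp_rw [grad_eq]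
  rw [setIntegral_const, smul_eq_mul, vol]

theorem faceIntegral_const (F : Finset (E d)) (c : ℝ) :
    (faceIntegral F fun _ => c) = area F * c := by
  rw [faceIntegral, setIntegral_const, smul_eq_mul, area]

theorem faceIntegral_sq_nonneg (F : Finset (E d)) (f : E d → ℝ) :
    0 ≤ faceIntegral F fun x => f x ^ 2 :=
  integral_nonneg fun _ => sq_nonneg _

theorem faces_of_cell {κ : Finset (E d)} (hκ : IsSimplex κ) (φ : Finset (E d) → ℝ) :
    ∑ F ∈ κ.powersetCard d, φ F = ∑ r ∈ κ, φ (κ.erase r) := by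
  symm
  refine Finset.sum_bij (fun r _ => κ.erase r) ?_ ?_ ?_ ?_
  · intro r hr
    refine Finset.mem_powersetCard.2 ⟨Finset.erase_subset _ _, ?_⟩
    rw [Finset.card_erase_of_mem hr, hκ.card]; rfl
  · intro r hr r' hr' heq
    exact (Finset.erase_inj _ hr).1 heq
  · intro F hF
    obtain ⟨hs, hc⟩ := Finset.mem_powersetCard.1 hF
    obtain ⟨r, hr, rfl⟩ := exists_eq_erase hκ.card hc hs
    exact ⟨r, hr, rfl⟩
  · intros; rfl

theorem normBdryCell_sq (v : Broken T) (κ : T.cells) :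
    normBdryCell T v κ ^ 2 = ∑ r ∈ κ.1, faceIntegral (κ.1.erase r) fun x => v κ x ^ 2 := by
  rw [normBdryCell, Real.sq_sqrt (Finset.sum_nonneg fun _ _ => faceIntegral_sq_nonneg _ _)]
  convert faces_of_cell (T.isSimplex κ.2) (fun F => faceIntegral F fun x => v κ x ^ 2)

theorem normCell_nonneg (v : Broken T) (κ : T.cells) : 0 ≤ normCell T v κ := Real.sqrt_nonneg _

theorem normGradCell_nonneg (v : Broken T) (κ : T.cells) : 0 ≤ normGradCell T v κ :=
  Real.sqrt_nonneg _

theorem normBdryCell_nonneg (v : Broken T) (κ : T.cells) : 0 ≤ normBdryCell T v κ :=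
  Real.sqrt_nonneg _

theorem normL2_sq (v : Broken T) : normL2 T v ^ 2 = ∑ κ, normCell T v κ ^ 2 :=
  Real.sq_sqrt (Finset.sum_nonneg fun _ _ => sq_nonneg _)

theorem normGrad_sq (v : Broken T) :
    normGrad T v ^ 2 = ∑ κ : T.cells, vol κ.1 * ‖slope (v κ)‖ ^ 2 := by
  rw [normGrad, Real.sq_sqrt (Finset.sum_nonneg fun _ _ => sq_nonneg _)]
  exact Finset.sum_congr rfl fun κ _ => normGradCell_sq T v κ

end

theorem vol_mul_sq_le {κ : Finset (E d)} {p : E d} (hp : p ∈ κ) (f : E d →ᵃ[ℝ] ℝ) :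
    vol κ * f p ^ 2 ≤ (8 * 2 ^ d + 2) * ∫ x in hull κ, f x ^ 2 := by
  have h1 := sq_le_integral_sq d (isCompact_hull κ) (hull_convex κ)
    (by rw [EuclideanSpace.euclideanHausdorffMeasure_eq_volume]
        exact (isCompact_hull κ).measure_lt_top.ne) (subset_hull hp) f
  rwa [EuclideanSpace.euclideanHausdorffMeasure_eq_volume] at h1

namespace IsSimplex

variable {κ : Finset (E d)} (h : IsSimplex κ)
include h

theorem abs_le_of_vertices {f : E d →ᵃ[ℝ] ℝ} {M : ℝ} (hM : ∀ p ∈ κ, |f p| ≤ M) {x : E d}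
    (hx : x ∈ hull κ) : |f x| ≤ M := by
  rw [h.mem_hull] at hx
  rw [h.affine_eq f x]
  calc |∑ p ∈ κ, bary κ p x * f p| ≤ ∑ p ∈ κ, bary κ p x * M := by
        refine (Finset.abs_sum_le_sum_abs _ _).trans (Finset.sum_le_sum fun p hp => ?_)
        rw [abs_mul, abs_of_nonneg (hx p hp)]
        exact mul_le_mul_of_nonneg_left (hM p hp) (hx p hp)
    _ = M := by rw [← Finset.sum_mul, h.sum_bary, one_mul]

theorem vol_mul_sum_abs_sq_le (f : E d →ᵃ[ℝ] ℝ) :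
    vol κ * (∑ p ∈ κ, |f p|) ^ 2 ≤
      (d + 1) ^ 2 * (8 * 2 ^ d + 2) * ∫ x in hull κ, f x ^ 2 := by
  have hc : (κ.card : ℝ) = d + 1 := by rw [h.card]; push_cast; rfl
  have h1 : (∑ p ∈ κ, |f p|) ^ 2 ≤ (d + 1) * ∑ p ∈ κ, f p ^ 2 := by
    have := sq_sum_le_card_mul_sum_sq (s := κ) (f := fun q => |f q|)
    simpa [sq_abs, hc] using this
  have h2 : vol κ * ∑ p ∈ κ, f p ^ 2 ≤
      (d + 1) * ((8 * 2 ^ d + 2) * ∫ x in hull κ, f x ^ 2) := by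
    rw [Finset.mul_sum, ← hc, ← nsmul_eq_mul]
    exact Finset.sum_le_card_nsmul _ _ _ fun p hp => vol_mul_sq_le hp f
  have hv := h.vol_pos
  calc vol κ * (∑ p ∈ κ, |f p|) ^ 2 ≤ vol κ * ((d + 1) * ∑ p ∈ κ, f p ^ 2) := by gcongr
    _ = (d + 1) * (vol κ * ∑ p ∈ κ, f p ^ 2) := by ring
    _ ≤ (d + 1) * ((d + 1) * ((8 * 2 ^ d + 2) * ∫ x in hull κ, f x ^ 2)) := by gcongr
    _ = _ := by ring

end IsSimplex

/-- The inverse inequality holds with a constant that depends on the regularity only. -/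
theorem exists_inverseConst (hd : 0 < d) (hΩ : IsConvexPolytopalDomain Ω) {ρ : ℝ} (hρ : 0 < ρ) :
    ∃ C > 0, ∀ T : OrientedMesh d Ω, T.Regular ρ → ∀ S : Set (Broken T), IsInverseConst T S C := by
  set c : ℝ := (d + 1) ^ 2 * (8 * 2 ^ d + 2) with hc
  have hc0 : 0 < c := by positivity
  refine ⟨√((2 / ρ) ^ 2 * c) + √((d + 1) * (2 * d / ρ) * c), by positivity, ?_⟩
  intro T hT S v _ κ
  have hh := T.h_pos hd hΩ
  have hs := T.isSimplex κ.2
  have hv := hs.vol_pos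
  set f := v κ with hf
  set N := normCell T v κ with hN
  have hN0 : 0 ≤ N := normCell_nonneg T v κ
  set M := ∑ p ∈ κ.1, |f p| with hM
  have hM0 : 0 ≤ M := Finset.sum_nonneg fun _ _ => abs_nonneg _
  have h1 : vol κ.1 * M ^ 2 ≤ c * N ^ 2 := by
    rw [hN, normCell_sq]
    exact hs.vol_mul_sum_abs_sq_le f
  have hsize := T.size_le_h κ
  have hsize0 := size_nonneg κ.1
  have hgrad : size κ.1 * normGradCell T v κ ≤ √((2 / ρ) ^ 2 * c) * N := by
    refine le_sqrt_mul (by positivity) hN0 ?_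
    have h2 : ‖slope f‖ ≤ 2 / (ρ * T.h) * M := by
      rw [hs.slope_eq f, hM, Finset.mul_sum]
      refine (norm_sum_le _ _).trans (Finset.sum_le_sum fun q hq => ?_)
      rw [norm_smul, Real.norm_eq_abs, mul_comm]
      gcongr
      exact hT.norm_slope_bary_le hρ hh κ.2 hq
    rw [mul_pow, normGradCell_sq]
    calc size κ.1 ^ 2 * (vol κ.1 * ‖slope f‖ ^ 2)
        ≤ T.h ^ 2 * (vol κ.1 * (2 / (ρ * T.h) * M) ^ 2) := by gcongr
      _ = (2 / ρ) ^ 2 * (vol κ.1 * M ^ 2) := by field_simp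
      _ ≤ (2 / ρ) ^ 2 * (c * N ^ 2) := by gcongr
      _ = _ := by ring
  have hbdry : √(size κ.1) * normBdryCell T v κ ≤ √((d + 1) * (2 * d / ρ) * c) * N := by
    refine le_sqrt_mul (by positivity) hN0 ?_
    rw [mul_pow, Real.sq_sqrt hsize0, normBdryCell_sq]
    have h3 : ∀ r ∈ κ.1, (faceIntegral (κ.1.erase r) fun x => v κ x ^ 2) ≤
        area (κ.1.erase r) * M ^ 2 := by
      intro r hr
      rw [← faceIntegral_const]
      refine setIntegral_mono_on
        (hs.integrableOn_face hd hr ((affine_continuous _).pow 2))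
        (hs.integrableOn_face hd hr continuous_const) (measurableSet_hull _) fun x hx => ?_
      rw [← sq_abs]
      have h4 : |v κ x| ≤ M := hs.abs_le_of_vertices
        (fun p hp => Finset.single_le_sum (f := fun p => |f p|) (fun _ _ => abs_nonneg _) hp)
        (hull_mono (Finset.erase_subset _ _) hx)
      gcongr
    have h5 : ∀ r ∈ κ.1, T.h * (faceIntegral (κ.1.erase r) fun x => v κ x ^ 2) ≤
        2 * d / ρ * c * N ^ 2 := by
      intro r hr
      calc T.h * (faceIntegral (κ.1.erase r) fun x => v κ x ^ 2)
          ≤ T.h * (area (κ.1.erase r) * M ^ 2) := by gcongr; exact h3 r hr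
        _ = area (κ.1.erase r) * T.h * M ^ 2 := by ring
        _ ≤ 2 * d / ρ * vol κ.1 * M ^ 2 := 
            mul_le_mul_of_nonneg_right (hT.area_mul_h_le hd hρ hh κ.2 hr) (sq_nonneg M)
        _ = 2 * d / ρ * (vol κ.1 * M ^ 2) := by ring
        _ ≤ 2 * d / ρ * (c * N ^ 2) := by gcongr
        _ = _ := by ring
    have hS0 : 0 ≤ ∑ r ∈ κ.1, faceIntegral (κ.1.erase r) fun x => v κ x ^ 2 :=
      Finset.sum_nonneg fun _ _ => faceIntegral_sq_nonneg _ _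
    calc size κ.1 * ∑ r ∈ κ.1, (faceIntegral (κ.1.erase r) fun x => v κ x ^ 2)
        ≤ T.h * ∑ r ∈ κ.1, (faceIntegral (κ.1.erase r) fun x => v κ x ^ 2) := by gcongr
      _ ≤ κ.1.card • (2 * d / ρ * c * N ^ 2) := by
          rw [Finset.mul_sum]; exact Finset.sum_le_card_nsmul _ _ _ h5
      _ = _ := by rw [T.card_eq κ.1 κ.2, nsmul_eq_mul]; push_cast; ring
  rw [add_mul]
  exact add_le_add hgrad hbdry

section FaceMeans

variable (T : OrientedMesh d Ω)

theorem faceIntegral_sum (hd : 0 < d) {F : Finset (E d)} (hF : F ∈ T.faces) {ι : Type*}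
    (s : Finset ι) (c : ι → ℝ) (f : ι → (E d →ᵃ[ℝ] ℝ)) :
    (faceIntegral F fun x => ∑ i ∈ s, c i * f i x) = ∑ i ∈ s, c i * faceIntegral F (f i) := by
  obtain ⟨κ, hκ, r, hr, rfl⟩ := T.mem_faces.1 hF
  unfold faceIntegral
  rw [integral_finsetSum _ fun i _ =>
    (T.isSimplex hκ).integrableOn_face hd hr ((affine_continuous _).const_mul _)]
  exact Finset.sum_congr rfl fun i _ => integral_const_mul _ _

theorem faceIntegral_jump (hd : 0 < d) {F : Finset (E d)} (hF : F ∈ T.faces) (v : Broken T) :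
    faceIntegral F (jump T v F) = ∑ κ ∈ T.cellsAt F, side T F κ * faceIntegral F (v κ) :=
  faceIntegral_sum T hd hF _ _ _

theorem meanAverage_eq (hd : 0 < d) {F : Finset (E d)} (hF : F ∈ T.faces) (v : Broken T) :
    meanAverage T v F = (area F)⁻¹ *
      (((T.cellsAt F).card : ℝ)⁻¹ * ∑ κ ∈ T.cellsAt F, faceIntegral F (v κ)) := by
  rw [meanAverage, faceIntegral_const, mul_one]
  congr 1
  have := faceIntegral_sum T hd hF (T.cellsAt F) (fun _ => ((T.cellsAt F).card : ℝ)⁻¹) v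
  rw [← Finset.mul_sum] at this
  rw [← this]
  unfold average
  simp_rw [Finset.mul_sum]

/-- For functions with vanishing mean jumps, the mean of the average over a face is the mean of
either trace. -/
theorem meanAverage_eq_of_mem (hd : 0 < d) (hΩ : IsConvexPolytopalDomain Ω) {Γ : Set (E d)}
    {v : Broken T} (hv : v ∈ X T Γ) {F : Finset (E d)} (hF : F ∈ T.faces) {κ : T.cells}
    (hκ : κ ∈ T.cellsAt F) : meanAverage T v F = (area F)⁻¹ * faceIntegral F (v κ) := by
  rw [meanAverage_eq T hd hF]
  congr 1
  rcases T.mem_interior_or_boundary hF with h | h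
  · obtain ⟨κ₁, κ₂, hne, h1, h2, h3⟩ := cellsAt_interior T hd hΩ h
    have h4 := hv F (Finset.mem_union_left _ h)
    rw [faceIntegral_jump T hd hF, h1, Finset.sum_pair hne, h2, h3] at h4
    rw [h1, Finset.sum_pair hne, Finset.card_pair hne]
    have h5 : faceIntegral F (v κ₁) = faceIntegral F (v κ₂) := by linarith
    rw [h1, Finset.mem_insert, Finset.mem_singleton] at hκ
    rcases hκ with rfl | rfl
    · rw [← h5]; push_cast; ring
    · rw [h5]; push_cast; ring
  · obtain ⟨κ', h1, -⟩ := cellsAt_boundary T hd h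
    rw [h1, Finset.mem_singleton] at hκ
    rw [h1, hκ]; simp

end FaceMeans

/-- The bound of the `L²` norm by face means holds with a constant that depends on the dimension
only: the vertex values of an affine function are linear combinations of its means over the faces.
-/
theorem exists_faceMeanConst (hd : 2 ≤ d) (hΩ : IsConvexPolytopalDomain Ω) {ρ : ℝ} (hρ : 0 < ρ) :
    ∃ C > 0, ∀ T : OrientedMesh d Ω, T.Regular ρ → ∀ Γ : Set (E d),
      IsFaceMeanConst T (X T Γ) C := by
  have hd0 : 0 < d := by omega
  have hdR : (d : ℝ) ≠ 0 := by positivity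
  refine ⟨√(2 * (d + 1) ^ 3), by positivity, fun T hT Γ v hv => ?_⟩
  have hh := T.h_pos hd0 hΩ
  set m := meanAverage T v with hm
  have hterm : ∀ F ∈ T.faces, T.h⁻¹ * (area F * m F ^ 2) ≤
      (size F)⁻¹ * faceIntegral F fun _ => m F ^ 2 := by
    intro F hF
    have h1 := hT.le_size_face hd hρ hh hF
    have h2 : 0 < size F := lt_of_lt_of_le (by positivity) h1
    have h3 := T.size_face_le_h hF
    have h4 := area_nonneg F
    rw [faceIntegral_const]
    gcongr
  set R := ∑ F ∈ T.faces, (size F)⁻¹ * faceIntegral F fun _ => m F ^ 2 with hR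
  have hR1 : T.h⁻¹ * ∑ F ∈ T.faces, area F * m F ^ 2 ≤ R := by
    rw [Finset.mul_sum]; exact Finset.sum_le_sum hterm
  have hA0 : 0 ≤ ∑ F ∈ T.faces, area F * m F ^ 2 :=
    Finset.sum_nonneg fun F _ => mul_nonneg (area_nonneg F) (sq_nonneg _)
  have hR0 : 0 ≤ R := le_trans (by positivity) hR1
  refine le_sqrt_mul (by positivity) (Real.sqrt_nonneg _) ?_
  rw [Real.sq_sqrt hR0, mul_pow, normL2_sq]
  have hcell : ∀ κ : T.cells, normCell T v κ ^ 2 ≤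
      (d + 1) ^ 3 * T.h * ∑ r ∈ κ.1, area (κ.1.erase r) * m (κ.1.erase r) ^ 2 := by
    intro κ
    have hs := T.isSimplex κ.2
    have hc : (κ.1.card : ℝ) = d + 1 := by rw [hs.card]; push_cast; rfl
    set f := v κ with hf
    have hmr : ∀ r ∈ κ.1, d * m (κ.1.erase r) = (∑ q ∈ κ.1, f q) - f r := by
      intro r hr
      have hFf : κ.1.erase r ∈ T.faces := T.mem_faces.2 ⟨κ.1, κ.2, r, hr, rfl⟩
      have hA := T.area_pos hd0 hFf
      rw [hm, meanAverage_eq_of_mem T hd0 hΩ hv hFf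
        (T.mem_cellsAt.2 (Finset.erase_subset r κ.1)), hs.faceIntegral_affine hd0 hr,
        ← Finset.add_sum_erase κ.1 f hr]
      field_simp
      ring
    have hsum : ∑ r ∈ κ.1, m (κ.1.erase r) = ∑ q ∈ κ.1, f q := by
      have h1 : d * ∑ r ∈ κ.1, m (κ.1.erase r) = d * ∑ q ∈ κ.1, f q := by
        rw [Finset.mul_sum, Finset.sum_congr rfl hmr, Finset.sum_sub_distrib, Finset.sum_const,
          nsmul_eq_mul, hc]
        ring
      exact mul_left_cancel₀ hdR h1
    set M := ∑ r ∈ κ.1, |m (κ.1.erase r)| with hM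
    have hM0 : 0 ≤ M := Finset.sum_nonneg fun _ _ => abs_nonneg _
    have hvert : ∀ p ∈ κ.1, |f p| ≤ (d + 1) * M := by
      intro p hp
      have h1 : f p = ∑ r ∈ κ.1, m (κ.1.erase r) - d * m (κ.1.erase p) := by
        rw [hsum, hmr p hp]; ring
      have h2 : |m (κ.1.erase p)| ≤ M :=
        Finset.single_le_sum (f := fun r => |m (κ.1.erase r)|) (fun _ _ => abs_nonneg _) hp
      have h3 : |∑ r ∈ κ.1, m (κ.1.erase r)| ≤ M := Finset.abs_sum_le_sum_abs _ _
      rw [h1]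
      refine (abs_sub _ _).trans ?_
      rw [abs_mul, Nat.abs_cast]
      nlinarith [mul_le_mul_of_nonneg_left h2 (Nat.cast_nonneg (α := ℝ) d)]
    have hMsq : M ^ 2 ≤ (d + 1) * ∑ r ∈ κ.1, m (κ.1.erase r) ^ 2 := by
      have := sq_sum_le_card_mul_sum_sq (s := κ.1) (f := fun r => |m (κ.1.erase r)|)
      simpa [sq_abs, hc] using this
    rw [normCell_sq]
    calc ∫ x in hull κ.1, f x ^ 2 ≤ ∫ x in hull κ.1, ((d + 1) * M) ^ 2 := by
          refine setIntegral_mono_on ?_ ?_ (measurableSet_hull _) fun x hx => ?_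
          · exact integrableOn_of_measure_ne_top (isCompact_hull _)
              (isCompact_hull κ.1).measure_lt_top.ne ((affine_continuous _).pow 2)
          · exact integrableOn_of_measure_ne_top (isCompact_hull _)
              (isCompact_hull κ.1).measure_lt_top.ne continuous_const
          · rw [← sq_abs]
            have := hs.abs_le_of_vertices hvert hx
            gcongr
      _ = vol κ.1 * ((d + 1) * M) ^ 2 := by rw [setIntegral_const, smul_eq_mul, vol]
      _ = (d + 1) ^ 2 * (vol κ.1 * M ^ 2) := by ring
      _ ≤ (d + 1) ^ 2 * (vol κ.1 * ((d + 1) * ∑ r ∈ κ.1, m (κ.1.erase r) ^ 2)) := by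
          have := hs.vol_pos
          gcongr
      _ = (d + 1) ^ 3 * ∑ r ∈ κ.1, vol κ.1 * m (κ.1.erase r) ^ 2 := by
          rw [← Finset.mul_sum]; ring
      _ ≤ (d + 1) ^ 3 * ∑ r ∈ κ.1, T.h * area (κ.1.erase r) * m (κ.1.erase r) ^ 2 := by
          gcongr with r hr
          exact T.vol_le_h_mul_area hd0 κ.2 hr
      _ = _ := by
          simp_rw [mul_assoc]
          rw [← Finset.mul_sum]
  have htot : ∑ κ : T.cells, normCell T v κ ^ 2 ≤
      (d + 1) ^ 3 * T.h * (2 * ∑ F ∈ T.faces, area F * m F ^ 2) := by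
    calc ∑ κ : T.cells, normCell T v κ ^ 2
        ≤ ∑ κ : T.cells, (d + 1) ^ 3 * T.h *
          ∑ r ∈ κ.1, area (κ.1.erase r) * m (κ.1.erase r) ^ 2 :=
          Finset.sum_le_sum fun κ _ => hcell κ
      _ = (d + 1) ^ 3 * T.h * ∑ F ∈ T.faces, ∑ κ ∈ T.cellsAt F, area F * m F ^ 2 := by
          rw [← Finset.mul_sum, T.sum_faces fun _ F => area F * m F ^ 2]
      _ ≤ _ := by
          have h1 : ∑ F ∈ T.faces, ∑ κ ∈ T.cellsAt F, area F * m F ^ 2 ≤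
              2 * ∑ F ∈ T.faces, area F * m F ^ 2 := by
            rw [Finset.mul_sum]
            refine Finset.sum_le_sum fun F hF => ?_
            rw [Finset.sum_const, nsmul_eq_mul]
            have := area_nonneg F
            gcongr
            exact_mod_cast card_cellsAt_le T hd0 hΩ hF
          gcongr
  calc T.h⁻¹ ^ 2 * ∑ κ : T.cells, normCell T v κ ^ 2
      ≤ T.h⁻¹ ^ 2 * ((d + 1) ^ 3 * T.h * (2 * ∑ F ∈ T.faces, area F * m F ^ 2)) := by gcongr
    _ = 2 * (d + 1) ^ 3 * (T.h⁻¹ * ∑ F ∈ T.faces, area F * m F ^ 2) := by field_simp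
    _ ≤ 2 * (d + 1) ^ 3 * R := by gcongr

section CrouzeixRaviart

variable (T : OrientedMesh d Ω)

/-- The Crouzeix–Raviart function with the mean `m F` over each face `F`. The local basis function
`1 - d λ_p` has mean one over the face opposite to the vertex `p` and mean zero over the other
faces. -/
def crFun (m : Finset (E d) → ℝ) : Broken T := fun κ =>
  ∑ p ∈ κ.1, m (κ.1.erase p) • (AffineMap.const ℝ (E d) (1 : ℝ) - (d : ℝ) • bary κ.1 p)

theorem crFun_vertex (m : Finset (E d) → ℝ) (κ : T.cells) {q : E d} (hq : q ∈ κ.1) :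
    crFun T m κ q = ∑ p ∈ κ.1, m (κ.1.erase p) - d * m (κ.1.erase q) := by
  rw [crFun, affine_sum_apply]
  have h1 : ∀ p ∈ κ.1, (m (κ.1.erase p) • (AffineMap.const ℝ (E d) (1 : ℝ) -
      (d : ℝ) • bary κ.1 p)) q = m (κ.1.erase p) - m (κ.1.erase p) * d * bary κ.1 p q := by
    intro p _; simp; ring
  rw [Finset.sum_congr rfl h1, Finset.sum_sub_distrib]
  congr 1
  rw [Finset.sum_eq_single q]
  · rw [(T.isSimplex κ.2).bary_self hq]; ring
  · intro p hp hpq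
    rw [(T.isSimplex κ.2).bary_ne hp hq hpq.symm, mul_zero]
  · exact fun h => absurd hq h

theorem faceIntegral_crFun (hd : 0 < d) (m : Finset (E d) → ℝ) {F : Finset (E d)}
    (hF : F ∈ T.faces) {κ : T.cells} (hκ : κ ∈ T.cellsAt F) :
    faceIntegral F (crFun T m κ) = area F * m F := by
  obtain ⟨r, hr, rfl⟩ := T.face_eq_erase hF κ.2 (T.mem_cellsAt.1 hκ)
  have hdR : (d : ℝ) ≠ 0 := by positivity
  have hc : ((κ.1.erase r).card : ℝ) = d := by rw [T.card_face hF]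
  rw [(T.isSimplex κ.2).faceIntegral_affine hd hr,
    Finset.sum_congr rfl fun q hq => crFun_vertex T m κ (Finset.mem_of_mem_erase hq),
    Finset.sum_sub_distrib, Finset.sum_const, nsmul_eq_mul, hc, ← Finset.mul_sum,
    ← Finset.add_sum_erase κ.1 _ hr]
  field_simp
  ring

theorem crFun_mem (hd : 0 < d) (hΩ : IsConvexPolytopalDomain Ω) {Γ : Set (E d)}
    {m : Finset (E d) → ℝ} (hm : ∀ F ∈ T.facesIn Γ, m F = 0) : crFun T m ∈ X T Γ := by
  intro F hF
  have hFf : F ∈ T.faces := Finset.union_subset T.interiorFaces_subset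
    ((T.facesIn_subset Γ).trans T.boundaryFaces_subset) hF
  rw [faceIntegral_jump T hd hFf,
    Finset.sum_congr rfl fun κ hκ => by rw [faceIntegral_crFun T hd m hFf hκ]]
  rcases Finset.mem_union.1 hF with h | h
  · obtain ⟨κ₁, κ₂, hne, h1, h2, h3⟩ := cellsAt_interior T hd hΩ h
    rw [h1, Finset.sum_pair hne, h2, h3]; ring
  · simp [hm F h]

theorem meanAverage_crFun (hd : 0 < d) (m : Finset (E d) → ℝ) {F : Finset (E d)}
    (hF : F ∈ T.faces) : meanAverage T (crFun T m) F = m F := by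
  have hA := T.area_pos hd hF
  have hcard : (T.cellsAt F).card ≠ 0 := by
    obtain ⟨κ, hκ⟩ := exists_cell T hF
    exact Finset.card_ne_zero_of_mem (T.mem_cellsAt.2 hκ)
  rw [meanAverage_eq T hd hF,
    Finset.sum_congr rfl fun κ hκ => faceIntegral_crFun T hd m hF hκ, Finset.sum_const,
    nsmul_eq_mul]
  field_simp

theorem aForm_eq (u w : Broken T) :
    aForm T u w = ∑ κ : T.cells, vol κ.1 * inner ℝ (slope (u κ)) (slope (w κ)) := by
  unfold aForm
  refine Finset.sum_congr rfl fun κ _ => ?_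
  simp_rw [grad_eq]
  rw [setIntegral_const, smul_eq_mul, vol]

/-- Integration by parts against a Crouzeix–Raviart function: only its face means enter, because
the normal derivatives of `u` are constant on faces. -/
theorem aForm_crFun (hd : 0 < d) (u : Broken T) (m : Finset (E d) → ℝ) :
    aForm T u (crFun T m) =
      ∑ F ∈ T.faces, area F * m F * inner ℝ (T.normal F) (slope (jumpAff T u F)) := by
  rw [aForm_eq]
  have h1 : ∀ κ : T.cells, vol κ.1 * inner ℝ (slope (u κ)) (slope (crFun T m κ)) =
      ∑ r ∈ κ.1, (side T (κ.1.erase r) κ * inner ℝ (slope (u κ)) (T.normal (κ.1.erase r))) *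
        faceIntegral (κ.1.erase r) (crFun T m κ) := by
    intro κ
    rw [← (T.isSimplex κ.2).green hd]
    refine Finset.sum_congr rfl fun r hr => ?_
    rw [outer_normal_eq T hd κ hr, inner_smul_right]
  rw [Finset.sum_congr rfl fun κ _ => h1 κ, T.sum_faces fun κ F =>
    (side T F κ * inner ℝ (slope (u κ)) (T.normal F)) * faceIntegral F (crFun T m κ)]
  refine Finset.sum_congr rfl fun F hF => ?_
  rw [slope_jumpAff, inner_sum, Finset.mul_sum]
  refine Finset.sum_congr rfl fun κ hκ => ?_
  rw [faceIntegral_crFun T hd m hF hκ, inner_smul_right, real_inner_comm]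
  ring

end CrouzeixRaviart

end

/-! ### The bilinear forms and the dual test function -/

section

variable {Ω : Set (E d)}

section Bilinear

variable (T : OrientedMesh d Ω)

theorem Mesh.union_facesIn_subset (T : Mesh d Ω) (Γ : Set (E d)) :
    T.interiorFaces ∪ T.facesIn Γ ⊆ T.faces :=
  Finset.union_subset T.interiorFaces_subset ((T.facesIn_subset Γ).trans T.boundaryFaces_subset)

theorem jumpAff_add (v w : Broken T) (F : Finset (E d)) :
    jumpAff T (v + w) F = jumpAff T v F + jumpAff T w F := by
  simp [jumpAff, Finset.sum_add_distrib]

theorem jumpAff_smul (c : ℝ) (v : Broken T) (F : Finset (E d)) :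
    jumpAff T (c • v) F = c • jumpAff T v F := by
  simp only [jumpAff, Pi.smul_apply, Finset.smul_sum]
  exact Finset.sum_congr rfl fun κ _ => smul_comm _ _ _

theorem integrableOn_of_mem_faces (T : Mesh d Ω) (hd : 0 < d) {F : Finset (E d)} (hF : F ∈ T.faces)
    {f : E d → ℝ} (hf : Continuous f) : IntegrableOn f (hull F) (μHE[d - 1] : Measure (E d)) := by
  obtain ⟨κ, hκ, r, hr, rfl⟩ := T.mem_faces.1 hF
  exact (T.isSimplex hκ).integrableOn_face hd hr hf

theorem isLinearMap_faceIntegral_jump (hd : 0 < d) {F : Finset (E d)} (hF : F ∈ T.faces) :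
    IsLinearMap ℝ fun v : Broken T => faceIntegral F (jump T v F) := by
  constructor
  · intro v w
    simp only [jump_eq', jumpAff_add]
    exact integral_add (integrableOn_of_mem_faces T.toMesh hd hF (affine_continuous _))
      (integrableOn_of_mem_faces T.toMesh hd hF (affine_continuous _))
  · intro c v
    simp only [jump_eq', jumpAff_smul]
    exact integral_const_mul _ _

theorem smul_sub_mem_X (hd : 0 < d) {Γ : Set (E d)} {v w : Broken T} (hv : v ∈ X T Γ)
    (hw : w ∈ X T Γ) (c : ℝ) : c • v - w ∈ X T Γ := by
  intro F hF
  have hl := isLinearMap_faceIntegral_jump T hd (T.union_facesIn_subset Γ hF)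
  have h1 := hl.map_sub (c • v) w
  have h2 := hl.map_smul c v
  rw [h1, h2, hv F hF, hw F hF]
  simp

theorem zero_mem_X (hd : 0 < d) (Γ : Set (E d)) : (0 : Broken T) ∈ X T Γ := fun _ hF =>
  (isLinearMap_faceIntegral_jump T hd (T.union_facesIn_subset Γ hF)).map_zero

theorem isLinearMap_aForm (u : Broken T) : IsLinearMap ℝ (aForm T u) := by
  constructor
  · intro v w
    simp only [aForm_eq, Pi.add_apply, map_add, inner_add_right, mul_add, Finset.sum_add_distrib]
  · intro c v
    simp only [aForm_eq, Pi.smul_apply, map_smul, inner_smul_right, smul_eq_mul, Finset.mul_sum]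
    exact Finset.sum_congr rfl fun κ _ => by ring

theorem aForm_comm (u w : Broken T) : aForm T u w = aForm T w u := by
  simp only [aForm_eq]
  exact Finset.sum_congr rfl fun κ _ => by rw [real_inner_comm]

/-- The sum over a set of faces of the scaled `L²` products of the jumps, which is the common
shape of both jump stabilizations. -/
def jumpForm (S : Finset (Finset (E d))) (γ : ℝ) (u v : Broken T) : ℝ :=
  ∑ F ∈ S, γ * (size F)⁻¹ * faceIntegral F fun x => jumpAff T u F x * jumpAff T v F x

theorem jumpForm_eq (S : Finset (Finset (E d))) (γ : ℝ) (u v : Broken T) :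
    (∑ F ∈ S, faceIntegral F fun x => γ * (size F)⁻¹ * jump T u F x * jump T v F x) =
      jumpForm T S γ u v := by
  refine Finset.sum_congr rfl fun F _ => ?_
  unfold faceIntegral
  rw [← integral_const_mul]
  simp only [jump_eq, mul_assoc]

theorem isLinearMap_jumpForm (hd : 0 < d) {S : Finset (Finset (E d))} (hS : S ⊆ T.faces) (γ : ℝ)
    (u : Broken T) : IsLinearMap ℝ (jumpForm T S γ u) := by
  constructor
  · intro v w
    unfold jumpForm
    rw [← Finset.sum_add_distrib]
    refine Finset.sum_congr rfl fun F hF => ?_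
    have hi : ∀ f g : E d →ᵃ[ℝ] ℝ, IntegrableOn (fun x => f x * g x) (hull F)
        (μHE[d - 1] : Measure (E d)) := fun f g =>
      integrableOn_of_mem_faces T.toMesh hd (hS hF) ((affine_continuous f).mul (affine_continuous g))
    rw [← mul_add]
    congr 1
    unfold faceIntegral
    rw [← integral_add (hi _ _) (hi _ _)]
    simp only [jumpAff_add, AffineMap.coe_add, Pi.add_apply, mul_add]
  · intro c v
    unfold jumpForm
    rw [smul_eq_mul, Finset.mul_sum]
    refine Finset.sum_congr rfl fun F _ => ?_
    have : (faceIntegral F fun x => jumpAff T u F x * jumpAff T (c • v) F x) =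
        c * faceIntegral F fun x => jumpAff T u F x * jumpAff T v F x := by
      unfold faceIntegral
      rw [← integral_const_mul]
      refine integral_congr_ae (Filter.Eventually.of_forall fun x => ?_)
      simp only [jumpAff_smul, AffineMap.coe_smul, Pi.smul_apply, smul_eq_mul]
      ring
    rw [this]; ring

theorem jumpForm_comm (S : Finset (Finset (E d))) (γ : ℝ) (u v : Broken T) :
    jumpForm T S γ u v = jumpForm T S γ v u := by
  unfold jumpForm
  simp only [mul_comm]

theorem jumpForm_self (S : Finset (Finset (E d))) (γ : ℝ) (u : Broken T) :
    jumpForm T S γ u u =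
      γ * ∑ F ∈ S, (size F)⁻¹ * faceIntegral F fun x => jumpAff T u F x ^ 2 := by
  unfold jumpForm
  simp only [← sq, Finset.mul_sum, mul_assoc]

theorem jumpForm_self_nonneg (S : Finset (Finset (E d))) {γ : ℝ} (hγ : 0 ≤ γ) (u : Broken T) :
    0 ≤ jumpForm T S γ u u := by
  rw [jumpForm_self]
  exact mul_nonneg hγ (Finset.sum_nonneg fun F _ =>
    mul_nonneg (inv_nonneg.2 (size_nonneg F)) (faceIntegral_sq_nonneg F _))

theorem sV_eq (ΓD : Set (E d)) (γV : ℝ) (u v : Broken T) :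
    sV T ΓD γV u v = jumpForm T (T.interiorFaces ∪ T.facesIn ΓD) γV u v :=
  jumpForm_eq T _ γV u v

theorem sW_jump_eq (ΓC : Set (E d)) (γW : ℝ) (z w : Broken T) :
    sW T .jump ΓC γW z w =
      jumpForm T (T.interiorFaces ∪ T.facesIn (frontier Ω \ ΓC)) γW z w :=
  jumpForm_eq T _ γW z w

theorem sW_gradient_eq (ΓC : Set (E d)) (γW : ℝ) (z w : Broken T) :
    sW T .gradient ΓC γW z w = γW * aForm T z w := by
  simp only [sW, aForm, integral_const_mul, Finset.mul_sum]

variable (m : AdjointStab) (ΓC : Set (E d))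

theorem isLinearMap_sW (hd : 0 < d) (γW : ℝ) (z : Broken T) :
    IsLinearMap ℝ (sW T m ΓC γW z) := by
  cases m with
  | gradient =>
    constructor
    · intro v w
      rw [sW_gradient_eq, sW_gradient_eq, sW_gradient_eq, (isLinearMap_aForm T z).map_add, mul_add]
    · intro c v
      rw [sW_gradient_eq, sW_gradient_eq, (isLinearMap_aForm T z).map_smul, smul_eq_mul,
        smul_eq_mul]
      ring
  | jump =>
    have := isLinearMap_jumpForm T hd (T.union_facesIn_subset (frontier Ω \ ΓC)) γW z
    constructor
    · intro v w
      rw [sW_jump_eq, sW_jump_eq, sW_jump_eq, this.map_add]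
    · intro c v
      rw [sW_jump_eq, sW_jump_eq, this.map_smul]

theorem sW_comm (γW : ℝ) (z w : Broken T) : sW T m ΓC γW z w = sW T m ΓC γW w z := by
  cases m with
  | gradient => rw [sW_gradient_eq, sW_gradient_eq, aForm_comm]
  | jump => rw [sW_jump_eq, sW_jump_eq, jumpForm_comm]

theorem sW_self_nonneg {γW : ℝ} (hγ : 0 ≤ γW) (z : Broken T) : 0 ≤ sW T m ΓC γW z z := by
  cases m with
  | gradient =>
    rw [sW_gradient_eq, aForm_eq]
    refine mul_nonneg hγ (Finset.sum_nonneg fun κ _ => mul_nonneg (vol_nonneg _) ?_)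
    exact real_inner_self_nonneg
  | jump => rw [sW_jump_eq]; exact jumpForm_self_nonneg T _ hγ z

/-- The square expansion of the adjoint stabilization; its sign gives the Cauchy–Schwarz
inequality. -/
theorem sW_smul_sub_self (hd : 0 < d) (γW α : ℝ) (y w : Broken T) :
    sW T m ΓC γW (α • w - y) (α • w - y) =
      α ^ 2 * sW T m ΓC γW w w - 2 * α * sW T m ΓC γW y w + sW T m ΓC γW y y := by
  have hl := isLinearMap_sW T m ΓC hd γW
  rw [(hl _).map_sub, (hl _).map_smul, sW_comm T m ΓC γW _ w, sW_comm T m ΓC γW _ y,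
    (hl _).map_sub, (hl _).map_smul, (hl _).map_sub, (hl _).map_smul, sW_comm T m ΓC γW w y]
  simp only [smul_eq_mul]
  ring

end Bilinear

section Primal

variable (T : OrientedMesh d Ω)

/-- The square of the part of `|||v|||_V` that measures jumps of normal derivatives. -/
def normalJumpSq (ΓC : Set (E d)) (γV : ℝ) (v : Broken T) : ℝ :=
  γV * ∑ F ∈ T.interiorFaces ∪ T.facesIn ΓC,
    size F * (area F * inner ℝ (T.normal F) (slope (jumpAff T v F)) ^ 2)

theorem normalJumpSq_nonneg (ΓC : Set (E d)) {γV : ℝ} (hγ : 0 ≤ γV) (v : Broken T) :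
    0 ≤ normalJumpSq T ΓC γV v :=
  mul_nonneg hγ (Finset.sum_nonneg fun F _ =>
    mul_nonneg (size_nonneg F) (mul_nonneg (area_nonneg F) (sq_nonneg _)))

theorem tripleV_eq (ΓC ΓD : Set (E d)) {γV : ℝ} (hγ : 0 ≤ γV) (v : Broken T) :
    tripleV T ΓC ΓD γV v = √γV * (T.h * normGrad T v) + √(normalJumpSq T ΓC γV v) +
      √(sV T ΓD γV v v) := by
  rw [tripleV, normalJumpSq, Real.sqrt_mul hγ]
  congr 4
  refine Finset.sum_congr rfl fun F _ => ?_
  simp_rw [jumpNormalDeriv_eq]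
  rw [faceIntegral_const]

/-- The scaled gradient is controlled by the jumps of the normal derivatives and the primal
stabilization: this is where the Cauchy data, which vanish on `ΓC` if these quantities do,
determine the function. -/
theorem exists_gradient_bound (hd : 2 ≤ d) (hΩ : IsConvexPolytopalDomain Ω) {ΓC ΓD : Set (E d)}
    (hCD : ΓC ⊆ ΓD) (hC : ΓC ⊆ frontier Ω) (T₀ : Mesh d Ω) (hne : (T₀.facesIn ΓC).Nonempty) {ρ : ℝ}
    (hρ : 0 < ρ) :
    ∃ C > 0, ∀ T : OrientedMesh d Ω, T.IsFitted ΓC → T.Regular ρ → ∀ γV : ℝ, 0 ≤ γV →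
      ∀ v : Broken T, γV * (T.h * normGrad T v) ^ 2 ≤
        C * (normalJumpSq T ΓC γV v + sV T ΓD γV v v) := by
  have hd0 : 0 < d := by omega
  obtain ⟨C, hC0, hpoin⟩ := exists_poincare_slope hd0 hΩ hC T₀ hne hρ
  set K : ℝ := 32 * d ^ 2 * (8 * 2 ^ (d - 1) + 2) / ρ ^ 2 with hK
  have hK0 : 0 < K := by positivity
  refine ⟨C * (4 / ρ + K), by positivity, fun T hfit hreg γV hγ v => ?_⟩
  have hh := T.h_pos hd0 hΩ
  set S := T.interiorFaces ∪ T.facesIn ΓC with hS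
  set S' := T.interiorFaces ∪ T.facesIn ΓD with hS'
  have hSS' : S ⊆ S' := by
    refine Finset.union_subset_union_right fun F hF => ?_
    obtain ⟨h1, h2⟩ := Finset.mem_filter.1 hF
    exact Finset.mem_filter.2 ⟨h1, h2.trans hCD⟩
  have hSf : S ⊆ T.faces := T.union_facesIn_subset ΓC
  set P := ∑ F ∈ S, size F * (area F * inner ℝ (T.normal F) (slope (jumpAff T v F)) ^ 2) with hP
  set Q := ∑ F ∈ S', (size F)⁻¹ * faceIntegral F fun x => jumpAff T v F x ^ 2 with hQ
  have hP0 : 0 ≤ P := Finset.sum_nonneg fun F _ =>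
    mul_nonneg (size_nonneg F) (mul_nonneg (area_nonneg F) (sq_nonneg _))
  have hQ0 : 0 ≤ Q := Finset.sum_nonneg fun F _ =>
    mul_nonneg (inv_nonneg.2 (size_nonneg F)) (faceIntegral_sq_nonneg F _)
  have h1 : ∑ F ∈ S, T.h * area F * ‖slope (jumpAff T v F)‖ ^ 2 ≤ 4 / ρ * P + K * Q := by
    have h2 : ∑ F ∈ S, T.h * area F * ‖slope (jumpAff T v F)‖ ^ 2 ≤ ∑ F ∈ S,
        (4 / ρ * (size F * (area F * inner ℝ (T.normal F) (slope (jumpAff T v F)) ^ 2)) +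
          K * ((size F)⁻¹ * faceIntegral F fun x => jumpAff T v F x ^ 2)) := by
      refine Finset.sum_le_sum fun F hF => ?_
      refine (hreg.slope_sq_le hd0 hρ hh (hSf hF) (jumpAff T v F)).trans (add_le_add ?_ ?_)
      · have h3 := hreg.le_size_face hd hρ hh (hSf hF)
        have h4 : T.h ≤ 2 / ρ * size F := by
          rw [div_mul_eq_mul_div, le_div_iff₀ hρ]; linarith
        have h5 := area_nonneg F
        calc 2 * (T.h * area F * inner ℝ (T.normal F) (slope (jumpAff T v F)) ^ 2)
            ≤ 2 * (2 / ρ * size F * area F * inner ℝ (T.normal F) (slope (jumpAff T v F)) ^ 2) := by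
              gcongr
          _ = _ := by ring
      · have h3 := hreg.le_size_face hd hρ hh (hSf hF)
        have h4 : 0 < size F := lt_of_lt_of_le (by positivity) h3
        have h5 := faceIntegral_sq_nonneg F (jumpAff T v F)
        have h6 := T.size_face_le_h (hSf hF)
        gcongr
    refine h2.trans ?_
    rw [Finset.sum_add_distrib, ← Finset.mul_sum, ← Finset.mul_sum]
    gcongr
    exact Finset.sum_le_sum_of_subset_of_nonneg hSS' fun F _ _ =>
      mul_nonneg (inv_nonneg.2 (size_nonneg F)) (faceIntegral_sq_nonneg F _)
  have h7 : T.h ^ 2 * normGrad T v ^ 2 ≤ C * ((4 / ρ + K) * (P + Q)) := by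
    rw [normGrad_sq]
    refine (hpoin T hfit hreg v).trans ?_
    gcongr
    refine h1.trans ?_
    have : 0 < 4 / ρ := by positivity
    nlinarith [mul_nonneg this.le hQ0, mul_nonneg hK0.le hP0]
  rw [sV_eq, jumpForm_self, normalJumpSq, mul_pow]
  calc γV * (T.h ^ 2 * normGrad T v ^ 2) ≤ γV * (C * ((4 / ρ + K) * (P + Q))) := by gcongr
    _ = _ := by ring

end Primal

section Dual

variable (T : OrientedMesh d Ω)

/-- For a function in the dual space, the adjoint stabilization is bounded by the face means if the
product of the stabilization parameters is small enough. -/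
theorem sW_self_le (hd : 2 ≤ d) (hΩ : IsConvexPolytopalDomain Ω) {ρ : ℝ} (hρ : 0 < ρ)
    (hreg : T.Regular ρ) (m : AdjointStab) {ΓC : Set (E d)} {Ci cT γW : ℝ} (hγW : 0 ≤ γW)
    (hCi : IsInverseConst T (W T ΓC) Ci) (hcT : IsFaceMeanConst T (W T ΓC) cT)
    {w : Broken T} (hw : w ∈ W T ΓC) :
    sW T m ΓC γW w w ≤ 8 / ρ ^ 2 * (γW * (Ci * cT) ^ 2 *
      ∑ F ∈ T.faces, (size F)⁻¹ * faceIntegral F fun _ => meanAverage T w F ^ 2) := by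
  have hd0 : 0 < d := by omega
  have hh := T.h_pos hd0 hΩ
  set R := ∑ F ∈ T.faces, (size F)⁻¹ * faceIntegral F fun _ => meanAverage T w F ^ 2 with hR
  have hR0 : 0 ≤ R := Finset.sum_nonneg fun F _ =>
    mul_nonneg (inv_nonneg.2 (size_nonneg F)) (faceIntegral_sq_nonneg F _)
  have hL2 : T.h⁻¹ ^ 2 * normL2 T w ^ 2 ≤ cT ^ 2 * R := by
    have h1 := hcT w hw
    have h0 : 0 ≤ T.h⁻¹ * normL2 T w := mul_nonneg (by positivity) (Real.sqrt_nonneg _)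
    calc T.h⁻¹ ^ 2 * normL2 T w ^ 2 = (T.h⁻¹ * normL2 T w) ^ 2 := by ring
      _ ≤ (cT * √R) ^ 2 := by gcongr
      _ = cT ^ 2 * R := by rw [mul_pow, Real.sq_sqrt hR0]
  have hsize : ∀ κ : T.cells, ρ * T.h / 2 ≤ size κ.1 := fun κ =>
    hreg.le_size_cell hd0 hρ hh κ.2
  have hgrad : ∀ κ : T.cells, (ρ * T.h / 2) ^ 2 * normGradCell T w κ ^ 2 ≤
      Ci ^ 2 * normCell T w κ ^ 2 := by
    intro κ
    have h1 := hCi w hw κ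
    have h2 : 0 ≤ √(size κ.1) * normBdryCell T w κ :=
      mul_nonneg (Real.sqrt_nonneg _) (normBdryCell_nonneg T w κ)
    have h3 : 0 ≤ ρ * T.h / 2 * normGradCell T w κ :=
      mul_nonneg (by positivity) (normGradCell_nonneg T w κ)
    have h4 : ρ * T.h / 2 * normGradCell T w κ ≤ Ci * normCell T w κ := by
      have := mul_le_mul_of_nonneg_right (hsize κ) (normGradCell_nonneg T w κ)
      linarith
    have h5 := pow_le_pow_left₀ h3 h4 2
    rwa [mul_pow, mul_pow] at h5
  have hbdry : ∀ κ : T.cells, ρ * T.h / 2 * normBdryCell T w κ ^ 2 ≤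
      Ci ^ 2 * normCell T w κ ^ 2 := by
    intro κ
    have h1 := hCi w hw κ
    have h2 : 0 ≤ size κ.1 * normGradCell T w κ :=
      mul_nonneg (size_nonneg _) (normGradCell_nonneg T w κ)
    have h3 : 0 ≤ √(size κ.1) * normBdryCell T w κ :=
      mul_nonneg (Real.sqrt_nonneg _) (normBdryCell_nonneg T w κ)
    have h4 : √(size κ.1) * normBdryCell T w κ ≤ Ci * normCell T w κ := by linarith
    have h5 := pow_le_pow_left₀ h3 h4 2
    rw [mul_pow, mul_pow, Real.sq_sqrt (size_nonneg _)] at h5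
    exact (mul_le_mul_of_nonneg_right (hsize κ) (sq_nonneg _)).trans h5
  have hfin : ∀ M : ℝ, (ρ * T.h / 2) ^ 2 * M ≤ Ci ^ 2 * normL2 T w ^ 2 →
      γW * M ≤ 4 / ρ ^ 2 * (γW * (Ci * cT) ^ 2 * R) := by
    intro M hM
    calc γW * M = γW * (4 / ρ ^ 2 * (T.h⁻¹ ^ 2 * ((ρ * T.h / 2) ^ 2 * M))) := by
          field_simp
          ring
      _ ≤ γW * (4 / ρ ^ 2 * (T.h⁻¹ ^ 2 * (Ci ^ 2 * normL2 T w ^ 2))) := by gcongr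
      _ = γW * (4 / ρ ^ 2 * (Ci ^ 2 * (T.h⁻¹ ^ 2 * normL2 T w ^ 2))) := by ring
      _ ≤ γW * (4 / ρ ^ 2 * (Ci ^ 2 * (cT ^ 2 * R))) := by gcongr
      _ = _ := by ring
  have hY0 : 0 ≤ γW * (Ci * cT) ^ 2 * R := by positivity
  cases m with
  | gradient =>
    rw [sW_gradient_eq, aForm_eq]
    have h1 : ∑ κ : T.cells, vol κ.1 * inner ℝ (slope (w κ)) (slope (w κ)) =
        ∑ κ : T.cells, normGradCell T w κ ^ 2 :=
      Finset.sum_congr rfl fun κ _ => by rw [normGradCell_sq, real_inner_self_eq_norm_sq]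
    rw [h1]
    refine (hfin _ ?_).trans ?_
    · rw [normL2_sq, Finset.mul_sum, Finset.mul_sum]
      exact Finset.sum_le_sum fun κ _ => hgrad κ
    · gcongr; norm_num
  | jump =>
    rw [sW_jump_eq, jumpForm_self]
    have hjump : ∀ F ∈ T.faces, (faceIntegral F fun x => jumpAff T w F x ^ 2) ≤
        2 * ∑ κ ∈ T.cellsAt F, faceIntegral F fun x => w κ x ^ 2 := by
      intro F hF
      have hi : ∀ κ : T.cells, IntegrableOn (fun x => w κ x ^ 2) (hull F)
          (μHE[d - 1] : Measure (E d)) := fun κ =>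
        integrableOn_of_mem_faces T.toMesh hd0 hF ((affine_continuous _).pow 2)
      unfold faceIntegral
      rw [← integral_finsetSum _ fun κ _ => hi κ, ← integral_const_mul]
      refine integral_mono
        (integrableOn_of_mem_faces T.toMesh hd0 hF ((affine_continuous _).pow 2))
        ((integrable_finsetSum _ fun κ _ => hi κ).const_mul 2) fun x => ?_
      simp only
      rw [← jump_eq, jump]
      refine sq_sum_le_card_mul_sum_sq.trans ?_
      have h1 : ∑ κ ∈ T.cellsAt F, (side T F κ * w κ x) ^ 2 = ∑ κ ∈ T.cellsAt F, w κ x ^ 2 :=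
        Finset.sum_congr rfl fun κ _ => by rw [mul_pow, sq (side T F κ), side_mul_self, one_mul]
      rw [h1]
      refine mul_le_mul_of_nonneg_right ?_ (Finset.sum_nonneg fun _ _ => sq_nonneg _)
      exact_mod_cast card_cellsAt_le T hd0 hΩ hF
    have hsum : ∑ F ∈ T.interiorFaces ∪ T.facesIn (frontier Ω \ ΓC),
        (size F)⁻¹ * (faceIntegral F fun x => jumpAff T w F x ^ 2) ≤
        2 / (ρ * T.h) * (2 * ∑ κ : T.cells, normBdryCell T w κ ^ 2) := by
      calc ∑ F ∈ T.interiorFaces ∪ T.facesIn (frontier Ω \ ΓC),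
            (size F)⁻¹ * (faceIntegral F fun x => jumpAff T w F x ^ 2)
          ≤ ∑ F ∈ T.faces, (size F)⁻¹ * (faceIntegral F fun x => jumpAff T w F x ^ 2) :=
            Finset.sum_le_sum_of_subset_of_nonneg (T.union_facesIn_subset _) fun F _ _ =>
              mul_nonneg (inv_nonneg.2 (size_nonneg F)) (faceIntegral_sq_nonneg F _)
        _ ≤ ∑ F ∈ T.faces, 2 / (ρ * T.h) *
            (2 * ∑ κ ∈ T.cellsAt F, faceIntegral F fun x => w κ x ^ 2) := by
            refine Finset.sum_le_sum fun F hF => ?_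
            have h3 := hreg.le_size_face hd hρ hh hF
            have h5 : (size F)⁻¹ ≤ 2 / (ρ * T.h) := by
              rw [inv_le_comm₀ (lt_of_lt_of_le (by positivity) h3) (by positivity), inv_div]
              exact h3
            exact mul_le_mul h5 (hjump F hF) (faceIntegral_sq_nonneg F _) (by positivity)
        _ = 2 / (ρ * T.h) * (2 * ∑ κ : T.cells, normBdryCell T w κ ^ 2) := by
            rw [← Finset.mul_sum, ← Finset.mul_sum]
            congr 2
            simp_rw [normBdryCell_sq]
            rw [T.sum_faces fun κ F => faceIntegral F fun x => w κ x ^ 2]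
    refine (mul_le_mul_of_nonneg_left hsum hγW).trans ?_
    have h6 := hfin (2 / (ρ * T.h) * ∑ κ : T.cells, normBdryCell T w κ ^ 2) (by
      rw [normL2_sq, Finset.mul_sum (a := Ci ^ 2)]
      calc (ρ * T.h / 2) ^ 2 * (2 / (ρ * T.h) * ∑ κ : T.cells, normBdryCell T w κ ^ 2)
          = ∑ κ : T.cells, ρ * T.h / 2 * normBdryCell T w κ ^ 2 := by
            rw [← Finset.mul_sum]; field_simp
        _ ≤ _ := Finset.sum_le_sum fun κ _ => hbdry κ)
    calc γW * (2 / (ρ * T.h) * (2 * ∑ κ : T.cells, normBdryCell T w κ ^ 2))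
        = 2 * (γW * (2 / (ρ * T.h) * ∑ κ : T.cells, normBdryCell T w κ ^ 2)) := by ring
      _ ≤ 2 * (4 / ρ ^ 2 * (γW * (Ci * cT) ^ 2 * R)) := by gcongr
      _ = _ := by ring

/-- The test function in the dual space that recovers the jumps of the normal derivatives of `x`.
-/
theorem exists_dual_test (hd : 2 ≤ d) (hΩ : IsConvexPolytopalDomain Ω) {ρ : ℝ} (hρ : 0 < ρ)
    (hreg : T.Regular ρ) (m : AdjointStab) {ΓC : Set (E d)} {Ci cT γV γW : ℝ}
    (hγV : 0 < γV) (hγW : 0 < γW) (hγ : γV * γW ≤ ((Ci * cT) ^ 2)⁻¹)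
    (hCi : IsInverseConst T (W T ΓC) Ci) (hcT : IsFaceMeanConst T (W T ΓC) cT) (x : Broken T) :
    ∃ w ∈ W T ΓC, aForm T x w = normalJumpSq T ΓC γV x ∧
      sW T m ΓC γW w w ≤ 8 / ρ ^ 2 * normalJumpSq T ΓC γV x := by
  have hd0 : 0 < d := by omega
  have hh := T.h_pos hd0 hΩ
  set S := T.interiorFaces ∪ T.facesIn ΓC with hS
  have hSf : S ⊆ T.faces := T.union_facesIn_subset ΓC
  set D := fun F => (inner ℝ (T.normal F) (slope (jumpAff T x F)) : ℝ) with hD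
  -- The face means are the scaled jumps of the normal derivative, so that integration by parts
  -- reproduces the squared jumps.
  set μ : Finset (E d) → ℝ := fun F => if F ∈ S then γV * size F * D F else 0 with hμ
  have hμ0 : ∀ F ∉ S, μ F = 0 := fun F hF => if_neg hF
  have hμ1 : ∀ F ∈ S, μ F = γV * size F * D F := fun F hF => if_pos hF
  have hwW : crFun T μ ∈ W T ΓC := by
    refine crFun_mem T hd0 hΩ fun F hF => hμ0 F fun hFS => ?_
    obtain ⟨hFb, hF1⟩ := Finset.mem_filter.1 hF
    rcases Finset.mem_union.1 hFS with h | h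
    · exact T.not_mem_boundary_of_interior h hFb
    · obtain ⟨y, hy⟩ := T.openHull_nonempty hd0 (T.boundaryFaces_subset hFb)
      exact (hF1 hy).2 ((Finset.mem_filter.1 h).2 hy)
  have ha : aForm T x (crFun T μ) = normalJumpSq T ΓC γV x := by
    rw [aForm_crFun T hd0, normalJumpSq, Finset.mul_sum, ← hS]
    rw [← Finset.sum_subset hSf fun F _ hF => by rw [hμ0 F hF]; ring]
    refine Finset.sum_congr rfl fun F hF => ?_
    rw [hμ1 F hF]; ring
  have hR : ∑ F ∈ T.faces, (size F)⁻¹ *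
      (faceIntegral F fun _ => meanAverage T (crFun T μ) F ^ 2) =
      γV * normalJumpSq T ΓC γV x := by
    rw [normalJumpSq, Finset.mul_sum, Finset.mul_sum, ← hS]
    rw [← Finset.sum_subset hSf fun F hFf hF => by
      rw [meanAverage_crFun T hd0 μ hFf, hμ0 F hF, faceIntegral_const]; ring]
    refine Finset.sum_congr rfl fun F hF => ?_
    have hs : size F ≠ 0 :=
      (lt_of_lt_of_le (by positivity) (hreg.le_size_face hd hρ hh (hSf hF))).ne'
    rw [meanAverage_crFun T hd0 μ (hSf hF), hμ1 F hF, faceIntegral_const]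
    field_simp
    ring
  refine ⟨crFun T μ, hwW, ha, ?_⟩
  have h1 := sW_self_le T hd hΩ hρ hreg m hγW.le hCi hcT hwW
  rw [hR] at h1
  refine h1.trans ?_
  have hJ := normalJumpSq_nonneg T ΓC hγV.le x
  have hle : γV * γW * (Ci * cT) ^ 2 ≤ 1 := by
    rcases (sq_nonneg (Ci * cT)).eq_or_lt with h0 | h0
    -- Here `γ` is contradictory, with the convention `0⁻¹ = 0`, but the bound is trivial anyway.
    · rw [← h0]; simp
    · calc γV * γW * (Ci * cT) ^ 2 ≤ ((Ci * cT) ^ 2)⁻¹ * (Ci * cT) ^ 2 := by gcongr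
        _ = 1 := inv_mul_cancel₀ h0.ne'
  gcongr
  calc γW * (Ci * cT) ^ 2 * (γV * normalJumpSq T ΓC γV x)
      = γV * γW * (Ci * cT) ^ 2 * normalJumpSq T ΓC γV x := by ring
    _ ≤ 1 * normalJumpSq T ΓC γV x := by gcongr
    _ = _ := one_mul _

end Dual

end

/-! ### The inf-sup condition -/

section

variable {Ω : Set (E d)}

section Stability

variable (T : OrientedMesh d Ω) (m : AdjointStab) (ΓC ΓD : Set (E d))

theorem sV_self_nonneg {γV : ℝ} (hγ : 0 ≤ γV) (v : Broken T) : 0 ≤ sV T ΓD γV v v := by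
  rw [sV_eq]; exact jumpForm_self_nonneg T _ hγ v

theorem h_mul_normGrad_nonneg (hd : 0 < d) (hΩ : IsConvexPolytopalDomain Ω) (v : Broken T) :
    0 ≤ T.h * normGrad T v :=
  mul_nonneg (T.h_pos hd hΩ).le (Real.sqrt_nonneg _)

theorem triple_nonneg (hd : 0 < d) (hΩ : IsConvexPolytopalDomain Ω) {γV : ℝ} (hγ : 0 ≤ γV)
    (γW : ℝ) (v w : Broken T) : 0 ≤ triple T m ΓC ΓD γV γW v w := by
  rw [triple, tripleV_eq T ΓC ΓD hγ]
  have := h_mul_normGrad_nonneg T hd hΩ v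
  positivity

theorem triple_pos_of_slope_ne_zero (hd : 0 < d) (hΩ : IsConvexPolytopalDomain Ω) {γV : ℝ}
    (hγ : 0 < γV) (γW : ℝ) {v : Broken T} {κ : T.cells} (hv : slope (v κ) ≠ 0) (w : Broken T) :
    0 < triple T m ΓC ΓD γV γW v w := by
  have h1 : 0 < normGrad T v ^ 2 := by
    rw [normGrad_sq]
    refine Finset.sum_pos' (fun κ _ => mul_nonneg (vol_nonneg _) (sq_nonneg _))
      ⟨κ, Finset.mem_univ _, mul_pos (T.isSimplex κ.2).vol_pos ?_⟩
    have := norm_pos_iff.2 hv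
    positivity
  have h2 : 0 < normGrad T v :=
    (Real.sqrt_nonneg _).lt_of_ne' fun h => h1.ne' (by rw [show normGrad T v = 0 from h]; simp)
  have h3 := T.h_pos hd hΩ
  rw [triple, tripleV_eq T ΓC ΓD hγ.le]
  positivity

theorem Mesh.IsFitted.diff {T : Mesh d Ω} {Γ : Set (E d)} (hT : T.IsFitted Γ) :
    T.IsFitted (frontier Ω \ Γ) := by
  intro F hF
  rcases hT F hF with h | h
  · exact Or.inr (Set.disjoint_left.2 fun x hx hx' => hx'.2 (h hx))
  · refine Or.inl fun x hx => ⟨?_, Set.disjoint_left.1 h hx⟩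
    exact (Finset.mem_filter.1 hF).2 (openHull_subset_hull F hx)

/-- The primal space contains functions that are not piecewise constant, since there is a face on
which no condition is imposed. -/
theorem exists_mem_V_slope_ne_zero (hd : 2 ≤ d) (hΩ : IsConvexPolytopalDomain Ω)
    (hpos : 0 < (μHE[d - 1] : Measure (E d)) (frontier Ω \ ΓD)) (hfit : T.IsFitted ΓD) :
    ∃ v ∈ V T ΓD, ∃ κ, slope (v κ) ≠ 0 := by
  have hd0 : 0 < d := by omega
  obtain ⟨F, hF⟩ := T.facesIn_nonempty hd hΩ Set.sdiff_subset hpos hfit.diff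
  obtain ⟨hFb, hFD⟩ := Finset.mem_filter.1 hF
  obtain ⟨κ, hκ, r, hr, rfl⟩ := T.mem_faces.1 (T.boundaryFaces_subset hFb)
  set μ : Finset (E d) → ℝ := fun G => if G = κ.erase r then 1 else 0 with hμ
  refine ⟨crFun T μ, crFun_mem T hd0 hΩ fun G hG => if_neg ?_, ⟨κ, hκ⟩, fun h0 => ?_⟩
  · rintro rfl
    obtain ⟨y, hy⟩ := T.openHull_nonempty hd0 (T.boundaryFaces_subset hFb)
    exact (hFD hy).2 ((Finset.mem_filter.1 hG).2 hy)
  · have hcard := T.card_eq κ hκ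
    obtain ⟨q, hq⟩ : (κ.erase r).Nonempty := by
      rw [← Finset.card_pos, Finset.card_erase_of_mem hr]; omega
    obtain ⟨hqr, hqκ⟩ := Finset.mem_erase.1 hq
    have h1 := affine_sub (crFun T μ ⟨κ, hκ⟩) q r
    have hne : κ.erase q ≠ κ.erase r := fun h => by
      rw [← h] at hq; exact Finset.notMem_erase _ _ hq
    rw [h0, inner_zero_left, crFun_vertex T μ ⟨κ, hκ⟩ hqκ, crFun_vertex T μ ⟨κ, hκ⟩ hr,
      show μ (κ.erase q) = 0 from if_neg hne, show μ (κ.erase r) = 1 from if_pos rfl] at h1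
    have : (d : ℝ) ≠ 0 := by positivity
    apply this
    linarith

theorem A_smul_sub (hd : 0 < d) (γV γW α : ℝ) (x y w : Broken T) :
    A T m ΓC ΓD γV γW x y x (α • w - y) = sV T ΓD γV x x + sW T m ΓC γW y y +
      α * aForm T x w - α * sW T m ΓC γW y w := by
  rw [A, (isLinearMap_aForm T x).map_sub, (isLinearMap_aForm T x).map_smul,
    (isLinearMap_sW T m ΓC hd γW y).map_sub, (isLinearMap_sW T m ΓC hd γW y).map_smul]
  simp only [smul_eq_mul]
  ring

theorem A_neg_zero (hd : 0 < d) (γV γW : ℝ) (x y v : Broken T) :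
    A T m ΓC ΓD γV γW x y (-v) 0 = -A T m ΓC ΓD γV γW x y v 0 := by
  have hV := isLinearMap_jumpForm T hd (T.union_facesIn_subset ΓD) γV x
  rw [A, A, (isLinearMap_aForm T x).map_zero, (isLinearMap_sW T m ΓC hd γW y).map_zero, sV_eq,
    sV_eq, hV.map_neg, aForm_comm T (-v), (isLinearMap_aForm T y).map_neg, aForm_comm T v]
  ring

variable {ΓC ΓD}

/-- The supremum in the inf-sup condition is nonnegative: it is taken over a nonempty set, which is
symmetric. -/
theorem exists_test_nonneg (hd : 2 ≤ d) (hΩ : IsConvexPolytopalDomain Ω)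
    (hpos : 0 < (μHE[d - 1] : Measure (E d)) (frontier Ω \ ΓD)) (hfit : T.IsFitted ΓD) {γV : ℝ}
    (hγ : 0 < γV) (γW : ℝ) (x y : Broken T) :
    ∃ v ∈ V T ΓD, ∃ w ∈ W T ΓC, 0 < triple T m ΓC ΓD γV γW v w ∧
      0 ≤ A T m ΓC ΓD γV γW x y v w := by
  have hd0 : 0 < d := by omega
  obtain ⟨v, hv, κ, hκ⟩ := exists_mem_V_slope_ne_zero T ΓD hd hΩ hpos hfit
  have h0 := zero_mem_X T hd0 (frontier Ω \ ΓC)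
  rcases le_total 0 (A T m ΓC ΓD γV γW x y v 0) with h | h
  · exact ⟨v, hv, 0, h0, triple_pos_of_slope_ne_zero T m ΓC ΓD hd0 hΩ hγ γW hκ 0, h⟩
  · refine ⟨-v, ?_, 0, h0, triple_pos_of_slope_ne_zero T m ΓC ΓD hd0 hΩ hγ γW (κ := κ) ?_ 0, ?_⟩
    · have := smul_sub_mem_X T hd0 hv hv 0
      rwa [zero_smul, zero_sub] at this
    · rwa [Pi.neg_apply, map_neg, neg_ne_zero]
    · rw [A_neg_zero T m ΓC ΓD hd0]
      linarith

/-- The square of the full norm is bounded by the three quantities that the test functions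
recover. -/
theorem triple_sq_le {C γV γW : ℝ} (hγV : 0 ≤ γV) (hγW : 0 ≤ γW) (hC : 0 ≤ C) {x : Broken T}
    (hx : γV * (T.h * normGrad T x) ^ 2 ≤ C * (normalJumpSq T ΓC γV x + sV T ΓD γV x x))
    (y : Broken T) : triple T m ΓC ΓD γV γW x y ^ 2 ≤
      4 * (C + 1) * (sV T ΓD γV x x + sW T m ΓC γW y y + normalJumpSq T ΓC γV x) := by
  have hS := sV_self_nonneg T ΓD hγV x
  have hY := sW_self_nonneg T m ΓC hγW y
  have hJ := normalJumpSq_nonneg T ΓC hγV x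
  rw [triple, tripleV_eq T ΓC ΓD hγV]
  have h1 : (√γV * (T.h * normGrad T x)) ^ 2 = γV * (T.h * normGrad T x) ^ 2 := by
    rw [mul_pow, Real.sq_sqrt hγV]
  have h2 := Real.sq_sqrt hS
  have h3 := Real.sq_sqrt hY
  have h4 := Real.sq_sqrt hJ
  set a := √γV * (T.h * normGrad T x)
  set b := √(normalJumpSq T ΓC γV x)
  set c := √(sV T ΓD γV x x)
  set e := √(sW T m ΓC γW y y)
  have h5 : (a + b + c + e) ^ 2 ≤ 4 * (a ^ 2 + b ^ 2 + c ^ 2 + e ^ 2) := by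
    nlinarith [sq_nonneg (a - b), sq_nonneg (a - c), sq_nonneg (a - e), sq_nonneg (b - c),
      sq_nonneg (b - e), sq_nonneg (c - e)]
  nlinarith [mul_nonneg hC hY]

/-- The algebra of the inf-sup argument for the test pair `(x, K⁻¹ w - y)`. Here `S = s_V(x, x)`,
`Y = s_W(y, y)`, `J` is the squared norm of the jumps of the normal derivatives, `w` is the dual
test function for `x`, `Z = s_W(w, w)`, `B = s_W(y, w)`, and `p` is `|||x|||_V`. The hypothesis
`hB` says that `s_W` is nonnegative at `s w - y`. -/
theorem infsup_algebra {S Y J Z B p K C : ℝ} (hK : 1 ≤ K) (hC : 0 ≤ C) (hS : 0 ≤ S) (hY : 0 ≤ Y)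
    (hJ : 0 ≤ J) (hJp : √J ≤ p)
    (hZ : Z ≤ K * J) (hB : ∀ s : ℝ, 0 ≤ s ^ 2 * Z - 2 * s * B + Y) (hpos : 0 < p + √Y)
    (ht : (p + √Y) ^ 2 ≤ 4 * (C + 1) * (S + Y + J)) :
    0 < p + √((K⁻¹) ^ 2 * Z - 2 * K⁻¹ * B + Y) ∧
      1 / (24 * K * (C + 1)) * (p + √Y) ≤
        (S + Y + K⁻¹ * J - K⁻¹ * B) / (p + √((K⁻¹) ^ 2 * Z - 2 * K⁻¹ * B + Y)) := by
  have hK0 : 0 < K := by linarith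
  have hKi : K⁻¹ ≤ 1 := inv_le_one_of_one_le₀ hK
  have hKi0 : 0 < K⁻¹ := inv_pos.2 hK0
  have hZ1 : (K⁻¹) ^ 2 * Z ≤ K⁻¹ * J := by
    calc (K⁻¹) ^ 2 * Z ≤ (K⁻¹) ^ 2 * (K * J) := by gcongr
      _ = _ := by field_simp
  have hZ2 : (K⁻¹) ^ 2 * Z ≤ J := hZ1.trans (by nlinarith)
  set b := K⁻¹ * B with hb
  have hm : 0 ≤ (K⁻¹) ^ 2 * Z - 2 * b + Y := by linarith [hB K⁻¹]
  have hn : 0 ≤ (K⁻¹) ^ 2 * Z + 2 * b + Y := by linarith [hB (-K⁻¹)]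
  have h2 : 0 ≤ 4 * ((K⁻¹) ^ 2 * Z) - 4 * b + Y := by linarith [hB (2 * K⁻¹)]
  have hq : (K⁻¹) ^ 2 * Z - 2 * K⁻¹ * B + Y = (K⁻¹) ^ 2 * Z - 2 * b + Y := by rw [hb]; ring
  rw [hq]
  set z := (K⁻¹) ^ 2 * Z
  set j := K⁻¹ * J with hj
  have hj0 : 0 ≤ j := by positivity
  have hJsq := Real.sq_sqrt hJ
  have hYsq := Real.sq_sqrt hY
  have hqsq := Real.sq_sqrt hm
  have hJ0 := Real.sqrt_nonneg J
  have hY0 := Real.sqrt_nonneg Y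
  have hq0 := Real.sqrt_nonneg (z - 2 * b + Y)
  -- Since `s_W(w, w)` is bounded by the jumps in `|||x|||_V`, the norm of the test pair is
  -- equivalent to that of `(x, y)`.
  have hup : √(z - 2 * b + Y) ≤ 2 * √Y + 2 * √J := by
    refine Real.sqrt_le_iff.2 ⟨by positivity, ?_⟩
    nlinarith [mul_nonneg hY0 hJ0]
  have hlow : √Y ≤ 2 * √(z - 2 * b + Y) + 2 * √J := by
    refine Real.sqrt_le_iff.2 ⟨by positivity, ?_⟩
    nlinarith [mul_nonneg hq0 hJ0]
  set t := p + √Y with ht'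
  set τ := p + √(z - 2 * b + Y) with hτ
  have hτt : τ ≤ 3 * t := by rw [hτ, ht']; linarith
  have htτ : t ≤ 3 * τ := by rw [hτ, ht']; linarith
  have hτ0 : 0 < τ := by linarith
  refine ⟨hτ0, ?_⟩
  rw [le_div_iff₀ hτ0]
  -- The Young inequality for the mixed term: half of `Y` and half of `K⁻¹ J` survive.
  have hA : (2 * K)⁻¹ * (S + Y + J) ≤ S + Y + j - b := by
    have h1 : (2 * K)⁻¹ * J = j / 2 := by rw [hj, mul_inv]; ring
    have h2 : (2 * K)⁻¹ ≤ 1 / 2 := by rw [mul_inv]; linarith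
    have h3 : (2 * K)⁻¹ * (S + Y) ≤ 1 / 2 * (S + Y) := by gcongr
    nlinarith
  calc 1 / (24 * K * (C + 1)) * t * τ ≤ 1 / (24 * K * (C + 1)) * t * (3 * t) := by gcongr
    _ = 1 / (8 * K * (C + 1)) * t ^ 2 := by field_simp; norm_num
    _ ≤ 1 / (8 * K * (C + 1)) * (4 * (C + 1) * (S + Y + J)) := by gcongr
    _ = (2 * K)⁻¹ * (S + Y + J) := by field_simp; ring
    _ ≤ _ := hA

/-- The inf-sup condition with the supremum replaced by one test pair: it is `(x, K⁻¹ w - y)` with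
the dual test function `w` for `x`, unless `(x, y)` has norm zero. -/
theorem exists_infsup (hd : 2 ≤ d) (hΩ : IsConvexPolytopalDomain Ω) (hCD : ΓC ⊆ ΓD)
    (hC : ΓC ⊆ frontier Ω) (hpos : 0 < (μHE[d - 1] : Measure (E d)) (frontier Ω \ ΓD))
    (T₀ : Mesh d Ω) (hne : (T₀.facesIn ΓC).Nonempty) {ρ : ℝ} (hρ : 0 < ρ) :
    ∃ cs > 0, ∀ T : OrientedMesh d Ω, T.IsFitted ΓC → T.IsFitted ΓD → T.Regular ρ → ∀ Ci cT : ℝ,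
      IsInverseConst T (W T ΓC) Ci → IsFaceMeanConst T (W T ΓC) cT →
      ∀ γV γW : ℝ, 0 < γV → 0 < γW → γV * γW ≤ ((Ci * cT) ^ 2)⁻¹ →
      ∀ x ∈ V T ΓD, ∀ y ∈ W T ΓC, ∃ v ∈ V T ΓD, ∃ w ∈ W T ΓC,
        triple T m ΓC ΓD γV γW v w ≠ 0 ∧ cs * triple T m ΓC ΓD γV γW x y ≤
          A T m ΓC ΓD γV γW x y v w / triple T m ΓC ΓD γV γW v w := by
  have hd0 : 0 < d := by omega
  obtain ⟨C, hC0, hgrad⟩ := exists_gradient_bound hd hΩ hCD hC T₀ hne hρ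
  set K : ℝ := 8 / ρ ^ 2 + 1 with hK
  have hK1 : 1 ≤ K := by rw [hK]; linarith [show 0 < 8 / ρ ^ 2 by positivity]
  refine ⟨1 / (24 * K * (C + 1)), by positivity, ?_⟩
  intro T hfitC hfitD hreg Ci cT hCi hcT γV γW hγV hγW hγ x hx y hy
  rcases (triple_nonneg T m ΓC ΓD hd0 hΩ hγV.le γW x y).eq_or_lt with h0 | h0
  · obtain ⟨v, hv, w, hw, hpos, hA⟩ := exists_test_nonneg T m (ΓC := ΓC) hd hΩ hpos hfitD hγV γW x y
    refine ⟨v, hv, w, hw, hpos.ne', ?_⟩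
    rw [← h0, mul_zero]
    positivity
  · obtain ⟨w, hw, hxw, hww⟩ := exists_dual_test T hd hΩ hρ hreg m hγV hγW hγ hCi hcT x
    have hJ := normalJumpSq_nonneg T ΓC hγV.le x
    have hJp : √(normalJumpSq T ΓC γV x) ≤ tripleV T ΓC ΓD γV x := by
      rw [tripleV_eq T ΓC ΓD hγV.le]
      have := mul_nonneg (Real.sqrt_nonneg γV) (h_mul_normGrad_nonneg T hd0 hΩ x)
      have := Real.sqrt_nonneg (sV T ΓD γV x x)
      linarith
    have hexp := sW_smul_sub_self T m ΓC hd0 γW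
    obtain ⟨h1, h2⟩ := infsup_algebra hK1 hC0.le (sV_self_nonneg T ΓD hγV.le x)
      (sW_self_nonneg T m ΓC hγW.le y) hJ hJp
      (hww.trans (by rw [hK]; nlinarith))
      (fun s => by rw [← hexp]; exact sW_self_nonneg T m ΓC hγW.le _) h0
      (triple_sq_le T m hγV.le hγW.le hC0.le (hgrad T hfitC hreg γV hγV.le x) y)
    rw [← hexp] at h1 h2
    refine ⟨x, hx, K⁻¹ • w - y, smul_sub_mem_X T hd0 hw hy _, h1.ne', ?_⟩
    rw [A_smul_sub T m ΓC ΓD hd0, hxw]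
    exact h2

end Stability

end

end CRCauchy

end

theorem theorem1 (d : ℕ) (hd : d = 2 ∨ d = 3)
    (Ω : Set (CRCauchy.E d)) (hΩ : CRCauchy.IsConvexPolytopalDomain Ω)
    (ΓC ΓD : Set (CRCauchy.E d)) (hCD : ΓC ⊆ ΓD) (hD : ΓD ⊆ frontier Ω)
    (hC_pos : 0 < (μHE[d - 1] : Measure (CRCauchy.E d)) ΓC)
    (hD_pos : 0 < (μHE[d - 1] : Measure (CRCauchy.E d)) ΓD)
    (hD'_pos : 0 < (μHE[d - 1] : Measure (CRCauchy.E d)) (frontier Ω \ ΓD))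
    {ι : Type*} (T : ι → CRCauchy.OrientedMesh d Ω)
    (hreg : CRCauchy.ShapeRegular T) (hqu : CRCauchy.QuasiUniform T)
    (hfitC : ∀ i, (T i).IsFitted ΓC) (hfitD : ∀ i, (T i).IsFitted ΓD)
    (m : CRCauchy.AdjointStab) :
    (∃ Ci > 0, ∃ cT > 0, ∀ i,
      CRCauchy.IsInverseConst (T i) (CRCauchy.W (T i) ΓC) Ci ∧
      CRCauchy.IsFaceMeanConst (T i) (CRCauchy.W (T i) ΓC) cT) ∧
    ∃ cs : ℝ, 0 < cs ∧ ∀ i, ∀ Ci cT : ℝ,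
      CRCauchy.IsInverseConst (T i) (CRCauchy.W (T i) ΓC) Ci →
      CRCauchy.IsFaceMeanConst (T i) (CRCauchy.W (T i) ΓC) cT →
      ∀ γV γW : ℝ, 0 < γV → 0 < γW → γV * γW ≤ ((Ci * cT) ^ 2)⁻¹ →
      ∀ x ∈ CRCauchy.V (T i) ΓD, ∀ y ∈ CRCauchy.W (T i) ΓC,
        ((cs * CRCauchy.triple (T i) m ΓC ΓD γV γW x y : ℝ) : EReal) ≤
          ⨆ (v ∈ CRCauchy.V (T i) ΓD) (w ∈ CRCauchy.W (T i) ΓC)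
            (_ : CRCauchy.triple (T i) m ΓC ΓD γV γW v w ≠ 0),
            ((CRCauchy.A (T i) m ΓC ΓD γV γW x y v w /
              CRCauchy.triple (T i) m ΓC ΓD γV γW v w : ℝ) : EReal) := by
  have hd2 : 2 ≤ d := by omega
  obtain ⟨ρ, hρ, hregρ⟩ := CRCauchy.exists_regular hreg hqu
  obtain ⟨Ci, hCi, hinv⟩ := CRCauchy.exists_inverseConst (by omega) hΩ hρ
  obtain ⟨cT, hcT, hmean⟩ := CRCauchy.exists_faceMeanConst hd2 hΩ hρ
  refine ⟨⟨Ci, hCi, cT, hcT, fun i => ⟨hinv _ (hregρ i) _, hmean _ (hregρ i) _⟩⟩, ?_⟩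
  rcases isEmpty_or_nonempty ι with hι | ⟨⟨i₀⟩⟩
  -- For an empty family there is no mesh that provides a face in `ΓC`.
  · exact ⟨1, one_pos, fun i => hι.elim i⟩
  have hC := hCD.trans hD
  obtain ⟨cs, hcs, hmain⟩ := CRCauchy.exists_infsup m hd2 hΩ hCD hC hD'_pos (T i₀).toMesh
    ((T i₀).facesIn_nonempty hd2 hΩ hC hC_pos (hfitC i₀)) hρ
  refine ⟨cs, hcs, fun i Ci cT hCi hcT γV γW hγV hγW hγ x hx y hy => ?_⟩
  obtain ⟨v, hv, w, hw, hne, hle⟩ := hmain (T i) (hfitC i) (hfitD i) (hregρ i) Ci cT hCi hcT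
    γV γW hγV hγW hγ x hx y hy
  exact le_iSup₂_of_le v hv
    (le_iSup₂_of_le w hw (le_iSup_of_le hne (EReal.coe_le_coe_iff.2 hle)))
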